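/- Let $X_1,X_2,\dots$ be i.i.d. random variables with values in a measurable space $\mathcal X$ and common distribution $\nu$, and let $f:\mathcal X^2\to\mathbb R$ be measurable with $\mathbb E|f(X_1,X_2)|^2<\infty$. Put $$\mathcal U_n=\sum_{1\le i<j\le n}(-1)^j f(X_i,X_j),$$ and let $X$ denote a variable with distribution $\nu$, $\mu=\mathbb E f(X_1,X_2)$, $f_1(x)=\mathbb E f(x,X)-\mu$, $f_2(y)=\mathbb E f(X,y)-\mu$, $f_{12}(x,y)=f(x,y)-f_1(x)-f_2(y)-\mu$. For a square integrable kernel $g$ let $T_g\varphi(x)=\int g(x,y)\varphi(y)\,dy$ be the integral operator on $L^2$ of the underlying measure space. For a function $g$ on $\mathcal X^2$ define kernels on $\mathcal X\times[0,1]$ (with the measure $\nu\times\mathrm{Leb}$) by $\hat g((x,t),(y,u))=g(x,y)$ if $t<u$ and $g(y,x)$ if $t>u$, and $\check g((x,t),(y,u))=g(x,y)$ if $t<u$ and $-g(y,x)$ if $t>u$ (both are $0$ if $t=u$). Eigenvalues are counted with multiplicity, sequences of eigenvalues may be finite (possibly empty) or infinite, and infinite sums of random variables converge in $L^2$. Then,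 as $n\to\infty$: (i) $\mathbb E\,\mathcal U_n=(-1)^n\lfloor n/2\rfloor\mu$ for every $n$. (ii) $n^{-3}\operatorname{Var}\mathcal U_n\to\sigma^2:=\frac13\mathbb E[f_2(X)^2]$ and $n^{-3/2}(\mathcal U_n-\mathbb E\,\mathcal U_n)\to N(0,\sigma^2)$ in distribution. (iii) If $f_2(X)=0$ a.s., then $\operatorname{Var}\mathcal U_n=\frac12n^2\operatorname{Var}[f_{12}(X_1,X_2)]+O(n)$, and $$n^{-1}(\mathcal U_n-\mathbb E\,\mathcal U_n)\to W=\sum_r\tfrac12\lambda_r(\zeta_r^2-1)\quad\text{in distribution},$$ where the $\zeta_r$ are independent standard normal variables and $(\lambda_r)$ are the nonzero eigenvalues of the self-adjoint operator $$\tfrac12\begin{pmatrix}-T_{\hat f_{12}}&T_{\check f_{12}}\\-T_{\check f_{12}}&T_{\hat f_{12}}\end{pmatrix}\quad\text{on } \bigl(L^2(\mathcal X\times[0,1],\nu\times\mathrm{Leb})\bigr)^2 .$$ Moreover $\operatorname{Var}W=\frac12\sum_r\lambda_r^2=\frac12\operatorname{Var}[f_{12}(X_1,X_2)]<\infty$.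 (iv) If $f_2(X)=0$ a.s. and $f$ is symmetric, then also $n^{-1}(\mathcal U_n-\mathbb E\,\mathcal U_n)\to W=\sum_r\lambda_r\xi_r$ in distribution, where the $\xi_r$ are i.i.d. with characteristic function $\mathbb E e^{it\xi_r}=1/\sqrt{\cosh t}$ (the law of $\int_0^1B_1\,dB_2$ for independent Brownian motions $B_1,B_2$) and $(\lambda_r)$ are the nonzero eigenvalues of $T_{f-\mu}$ on $L^2(\mathcal X,\nu)$. Moreover $\operatorname{Var}W=\frac12\sum_r\lambda_r^2=\frac12\operatorname{Var}[f_{12}(X_1,X_2)]$. (v) If $f_2(X)=0$ a.s. and $f$ is antisymmetric, then also $n^{-1}\mathcal U_n\to W=\sum_q\lambda'_q\eta_q$ in distribution, where the $\eta_q$ are i.i.d. with the stochastic area distribution, $\mathbb E e^{it\eta_q}=1/\cosh t$, and $(\lambda'_q)$ are the positive numbers such that $\mathrm i\lambda'_q$ is an eigenvalue of the anti-self-adjoint operator $T_f$ on the complex space $L^2(\mathcal X,\nu)$. Moreover $\operatorname{Var}W=\sum_q(\lambda'_q)^2=\frac12\operatorname{Var}[f_{12}(X_1,X_2)]$. (vi)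 If $f_2(X)=0$ a.s. and $f_{12}(X_1,X_2)=0$ a.s., then $\operatorname{Var}\mathcal U_n=n\sigma_1^2+O(1)$ with $\sigma_1^2:=\frac12\operatorname{Var}[f_1(X)]$, and $n^{-1/2}(\mathcal U_n-\mathbb E\,\mathcal U_n)\to N(0,\sigma_1^2)$ in distribution. -/

import Mathlib

open MeasureTheory ProbabilityTheory Filter Topology
open scoped ENNReal NNReal

namespace AltU

noncomputable section

/-! ### Integral operators on `L²` -/

section IntegralOperator

variable {Y : Type*} [MeasurableSpace Y] {𝕜 : Type*} [RCLike 𝕜]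

/-- The Cauchy–Schwarz (Hilbert–Schmidt) bound. -/
theorem eLpNorm_integral_le (κ : Measure Y) [SFinite κ] {g : Y → Y → 𝕜}
    (hg : MemLp (fun p : Y × Y => g p.1 p.2) 2 (κ.prod κ)) {φ : Y → 𝕜} (hφ : MemLp φ 2 κ) :
    eLpNorm (fun x => ∫ y, g x y * φ y ∂κ) 2 κ ≤
      eLpNorm (fun p : Y × Y => g p.1 p.2) 2 (κ.prod κ) * eLpNorm φ 2 κ := by
  have h2 : (2 : ℝ≥0∞) ≠ 0 := by norm_num
  have h2' : (2 : ℝ≥0∞) ≠ ⊤ := by norm_num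
  have key : ∀ᵐ x ∂κ, ‖∫ y, g x y * φ y ∂κ‖ₑ ^ (2 : ℝ) ≤
      (∫⁻ y, ‖g x y‖ₑ ^ (2 : ℝ) ∂κ) * (∫⁻ y, ‖φ y‖ₑ ^ (2 : ℝ) ∂κ) := by
    filter_upwards [hg.1.prodMk_left] with x hx
    have h1 : ‖∫ y, g x y * φ y ∂κ‖ₑ ≤ ∫⁻ y, ‖g x y‖ₑ * ‖φ y‖ₑ ∂κ :=
      (enorm_integral_le_lintegral_enorm _).trans (le_of_eq (by simp [enorm_mul]))
    have h3 := ENNReal.lintegral_mul_le_Lp_mul_Lq κ (p := 2) (q := 2)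
      (by constructor <;> norm_num) hx.enorm hφ.1.enorm
    have h4 : ‖∫ y, g x y * φ y ∂κ‖ₑ ≤ _ := h1.trans h3
    calc _ ≤ _ := ENNReal.rpow_le_rpow h4 (by norm_num : (0 : ℝ) ≤ 2)
      _ = _ := by
        rw [ENNReal.mul_rpow_of_nonneg _ _ (by norm_num), ← ENNReal.rpow_mul, ← ENNReal.rpow_mul]
        norm_num
  rw [eLpNorm_eq_lintegral_rpow_enorm_toReal h2 h2', eLpNorm_eq_lintegral_rpow_enorm_toReal h2 h2',
    eLpNorm_eq_lintegral_rpow_enorm_toReal h2 h2',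
    ← ENNReal.mul_rpow_of_nonneg _ _ (by norm_num)]
  refine ENNReal.rpow_le_rpow ?_ (by norm_num)
  simp only [ENNReal.toReal_ofNat]
  rw [lintegral_prod _ (hg.1.enorm.pow_const _)]
  refine (lintegral_mono_ae key).trans (le_of_eq ?_)
  exact lintegral_mul_const'' _ (hg.1.enorm.pow_const _).lintegral_prod_right'

theorem memLp_integral (κ : Measure Y) [SFinite κ] {g : Y → Y → 𝕜}
    (hg : MemLp (fun p : Y × Y => g p.1 p.2) 2 (κ.prod κ)) {φ : Y → 𝕜} (hφ : MemLp φ 2 κ) :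
    MemLp (fun x => ∫ y, g x y * φ y ∂κ) 2 κ := by
  refine ⟨?_, (eLpNorm_integral_le κ hg hφ).trans_lt (ENNReal.mul_lt_top hg.2 hφ.2)⟩
  exact (hg.1.mul hφ.1.comp_snd).integral_prod_right'

theorem ae_integrable_mul (κ : Measure Y) [SFinite κ] {g : Y → Y → 𝕜}
    (hg : MemLp (fun p : Y × Y => g p.1 p.2) 2 (κ.prod κ)) {φ : Y → 𝕜} (hφ : MemLp φ 2 κ) :
    ∀ᵐ x ∂κ, Integrable (fun y => g x y * φ y) κ := by
  have h1 : Integrable (fun p : Y × Y => ‖g p.1 p.2‖ ^ 2) (κ.prod κ) :=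
    (memLp_two_iff_integrable_sq_norm hg.1).1 hg
  filter_upwards [hg.1.prodMk_left, h1.prod_right_ae] with x hx hx2
  exact ((memLp_two_iff_integrable_sq_norm hx).2 hx2).integrable_mul hφ

/-- The integral operator with a kernel `g ∈ L²(Y × Y)`. -/
def integralOpAux (κ : Measure Y) [SFinite κ] (g : Y → Y → 𝕜)
    (hg : MemLp (fun p : Y × Y => g p.1 p.2) 2 (κ.prod κ)) : Lp 𝕜 2 κ →L[𝕜] Lp 𝕜 2 κ :=
  LinearMap.mkContinuous
    { toFun := fun φ => (memLp_integral κ hg (Lp.memLp φ)).toLp _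
      map_add' := by
        intro φ ψ
        rw [← MemLp.toLp_add]
        refine MemLp.toLp_congr _ _ ?_
        filter_upwards [ae_integrable_mul κ hg (Lp.memLp φ), ae_integrable_mul κ hg (Lp.memLp ψ)]
          with x h1 h2
        rw [Pi.add_apply, ← integral_add h1 h2]
        refine integral_congr_ae ?_
        filter_upwards [Lp.coeFn_add φ ψ] with y hy
        rw [hy, Pi.add_apply, mul_add]
      map_smul' := by
        intro c φ
        rw [RingHom.id_apply, ← MemLp.toLp_const_smul]
        refine MemLp.toLp_congr _ _ (ae_of_all _ fun x => ?_)
        rw [Pi.smul_apply, ← integral_smul]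
        refine integral_congr_ae ?_
        filter_upwards [Lp.coeFn_smul c φ] with y hy
        rw [hy, Pi.smul_apply, smul_eq_mul, smul_eq_mul]
        ring }
    (eLpNorm (fun p : Y × Y => g p.1 p.2) 2 (κ.prod κ)).toReal
    (by
      intro φ
      simp only [LinearMap.coe_mk, AddHom.coe_mk]
      rw [Lp.norm_toLp, Lp.norm_def, ← ENNReal.toReal_mul]
      exact ENNReal.toReal_mono (ENNReal.mul_ne_top hg.2.ne (Lp.memLp φ).2.ne)
        (eLpNorm_integral_le κ hg (Lp.memLp φ)))

open Classical in
/-- The integral operator `T_g φ (x) = ∫ g(x,y) φ(y) dκ(y)` on `L²(Y, κ)`, for `g ∈ L²(Y × Y)`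
(and, by convention, `0` for other `g`). -/
def integralOp (κ : Measure Y) [SFinite κ] (g : Y → Y → 𝕜) : Lp 𝕜 2 κ →L[𝕜] Lp 𝕜 2 κ :=
  if hg : MemLp (fun p : Y × Y => g p.1 p.2) 2 (κ.prod κ) then integralOpAux κ g hg else 0

theorem integralOp_apply (κ : Measure Y) [SFinite κ] {g : Y → Y → 𝕜}
    (hg : MemLp (fun p : Y × Y => g p.1 p.2) 2 (κ.prod κ)) (φ : Lp 𝕜 2 κ) :
    integralOp κ g φ =ᵐ[κ] fun x => ∫ y, g x y * φ y ∂κ := by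
  rw [integralOp, dif_pos hg]
  exact MemLp.coeFn_toLp (memLp_integral κ hg (Lp.memLp φ))

end IntegralOperator

/-- The operator `(a, b) ↦ (A a + B b, C a + D b)` on the Hilbert space `H ⊕ H`. -/
def blockOp {H : Type*} [NormedAddCommGroup H] [InnerProductSpace ℝ H]
    (A B C D : H →L[ℝ] H) : WithLp 2 (H × H) →L[ℝ] WithLp 2 (H × H) :=
  ((WithLp.prodContinuousLinearEquiv 2 ℝ H H).symm : H × H →L[ℝ] WithLp 2 (H × H)) ∘L
    ((A.coprod B).prod (C.coprod D)) ∘L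
    (WithLp.prodContinuousLinearEquiv 2 ℝ H H : WithLp 2 (H × H) →L[ℝ] H × H)

/-! ### Eigenvalues counted with multiplicity -/

/-- Indices of a finite or infinite sequence of length `R ∈ {0, 1, …, ∞}`. -/
abbrev Idx (R : ℕ∞) : Type := {r : ℕ // (r : ℕ∞) < R}

/-- `lam` lists the nonzero eigenvalues of `T`, each one as many times as the dimension of
its eigenspace. -/
def ListsNonzeroEigenvalues {ι V : Type*} [AddCommGroup V] [Module ℝ V] (T : V →ₗ[ℝ] V)
    (lam : ι → ℝ) : Prop :=
  (∀ r, lam r ≠ 0) ∧ ∀ c : ℝ, c ≠ 0 →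
    {r | lam r = c}.encard = Cardinal.toENat (Module.rank ℝ (Module.End.eigenspace T c))

/-- `lam` lists the numbers `c > 0` such that `i c` is an eigenvalue of `T`, each one as many times
as the dimension of the eigenspace of `i c`. -/
def ListsPositiveImaginaryEigenvalues {ι V : Type*} [AddCommGroup V] [Module ℂ V]
    (T : V →ₗ[ℂ] V) (lam : ι → ℝ) : Prop :=
  (∀ q, 0 < lam q) ∧ ∀ c : ℝ, 0 < c →
    {q | lam q = c}.encard =
      Cardinal.toENat (Module.rank ℂ (Module.End.eigenspace T (Complex.I * (c : ℂ))))

/-! ### The Hoeffding decomposition -/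

section Kernel

variable {S : Type*} [MeasurableSpace S]

/-- `μ = f_∅ = E f(X₁, X₂)`. -/
def mean (ν : Measure S) (f : S → S → ℝ) : ℝ := ∫ p : S × S, f p.1 p.2 ∂(ν.prod ν)

/-- `f₁(x) = E f(x, X) - μ`. -/
def f1 (ν : Measure S) (f : S → S → ℝ) (x : S) : ℝ := (∫ y, f x y ∂ν) - mean ν f

/-- `f₂(y) = E f(X, y) - μ`. -/
def f2 (ν : Measure S) (f : S → S → ℝ) (y : S) : ℝ := (∫ x, f x y ∂ν) - mean ν f

/-- `f₁₂(x, y) = f(x, y) - f₁(x) - f₂(y) - μ`. -/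
def f12 (ν : Measure S) (f : S → S → ℝ) (x y : S) : ℝ :=
  f x y - f1 ν f x - f2 ν f y - mean ν f

/-- `Var[f₁₂(X₁, X₂)]`. -/
def varF12 (ν : Measure S) (f : S → S → ℝ) : ℝ :=
  Var[fun p : S × S => f12 ν f p.1 p.2; ν.prod ν]

end Kernel

/-- The symmetric kernel `f̂` on `S × [0,1]`. -/
def hatK {S : Type*} (f : S → S → ℝ) (p q : S × unitInterval) : ℝ :=
  if p.2 < q.2 then f p.1 q.1 else if q.2 < p.2 then f q.1 p.1 else 0

/-- The antisymmetric kernel `f̌` on `S × [0,1]`. -/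
def checkK {S : Type*} (f : S → S → ℝ) (p q : S × unitInterval) : ℝ :=
  if p.2 < q.2 then f p.1 q.1 else if q.2 < p.2 then -f q.1 p.1 else 0

/-- The operator `½ [[-T_f̂, T_f̌], [-T_f̌, T_f̂]]` on `L²(S × [0,1], ν × Leb)²`. -/
def altOp {S : Type*} [MeasurableSpace S] (ν : Measure S) [SFinite ν] (f : S → S → ℝ) :
    WithLp 2 (Lp ℝ 2 (ν.prod (volume : Measure unitInterval)) ×
        Lp ℝ 2 (ν.prod (volume : Measure unitInterval))) →L[ℝ]
      WithLp 2 (Lp ℝ 2 (ν.prod (volume : Measure unitInterval)) ×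
        Lp ℝ 2 (ν.prod (volume : Measure unitInterval))) :=
  (1 / 2 : ℝ) • blockOp
    (-integralOp (ν.prod (volume : Measure unitInterval)) (hatK f))
    (integralOp (ν.prod (volume : Measure unitInterval)) (checkK f))
    (-integralOp (ν.prod (volume : Measure unitInterval)) (checkK f))
    (integralOp (ν.prod (volume : Measure unitInterval)) (hatK f))

/-! ### The statistic and the limit variables -/

/-- `∑_{1 ≤ i < j ≤ n} (-1)^j f(x_i, x_j)` for a sequence `x₁, x₂, …` of which `x 0` is the first
term `x₁`, `x 1` the second term `x₂`, and so on (whence the sign `(-1)^(j+1)`). -/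
def Upm {S : Type*} (f : S → S → ℝ) (x : ℕ → S) (n : ℕ) : ℝ :=
  ∑ j ∈ Finset.range n, ∑ i ∈ Finset.range j, (-1 : ℝ) ^ (j + 1) * f (x i) (x j)

section Limits

variable {Ω' : Type*} [MeasurableSpace Ω']

/-- `η` has the distribution of Lévy's stochastic area `∫₀¹ B₁ dB₂ - ∫₀¹ B₂ dB₁`, i.e. the
distribution with characteristic function `1 / cosh t`. -/
def IsStochasticArea (P' : Measure Ω') (η : Ω' → ℝ) : Prop :=
  AEMeasurable η P' ∧ ∀ t : ℝ, charFun (P'.map η) t = ((1 / Real.cosh t : ℝ) : ℂ)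

/-- `ξ` has the distribution of `∫₀¹ B₁ dB₂`, i.e. the distribution with characteristic function
`1 / √(cosh t)`. -/
def IsHalfStochasticArea (P' : Measure Ω') (ξ : Ω' → ℝ) : Prop :=
  AEMeasurable ξ P' ∧ ∀ t : ℝ, charFun (P'.map ξ) t = ((1 / √(Real.cosh t) : ℝ) : ℂ)

/-- `W = ∑ r, Z r`, the sum being (unconditionally) convergent in `L²(P')`. -/
def IsL2Sum {ι : Type*} (P' : Measure Ω') (Z : ι → Ω' → ℝ) (W : Ω' → ℝ) : Prop :=
  (∀ r, MemLp (Z r) 2 P') ∧ MemLp W 2 P' ∧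
    Tendsto (fun s : Finset ι => eLpNorm (fun ω => (∑ r ∈ s, Z r ω) - W ω) 2 P') atTop (𝓝 0)

end Limits

end

end AltU

set_option linter.unusedSectionVars false

namespace AltU


/-! The Hoeffding decomposition `Upm_eq` splits the statistic into the statistic of the degenerate
kernel `f12`, two weighted sums of `f1 (X i)` and `f2 (X i)`, and a constant. The coefficient of
`f2` grows linearly in the index, while the signs make the coefficient of `f1` an alternating sum,
hence bounded. The degenerate statistic is orthogonal to both linear sums, so all variances are
explicit polynomials in `n`. The Gaussian limits follow from a central limit theorem for weighted
sums with negligible weights, the other terms being small in `L²`.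

When `f2` vanishes, the statistic of `f12` dominates. Consecutive variables are grouped into
independent pairs: up to a negligible sum within pairs, an even number of terms gives a sum over `k
< l` of `pairKernel` at the `k`-th and `l`-th pairs (`Upm_two_mul`). This kernel is degenerate but
not symmetric. Attaching independent uniform times to the pairs and ordering them by time instead of
by index leaves the law unchanged, and the sum becomes that of the symmetric kernel `hatK`
(`IsIID.charFun_hatK`). A symmetric degenerate kernel is expanded in eigenfunctions, truncated with
an error uniformly small in `L²`, and treated by the multivariate central limit theorem and the law
of large numbers (`IsIID.tendsto_charFun_symmetric`).

The operator of `hatK (pairKernel f)` equals `altOp`, up to the factor 2, transported by the lift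
`pairLift`, which is isometric on the centred functions containing all relevant eigenvectors
(`inner_integralOp_pairKernel`, `pairProj_pairLift`). This yields the general degenerate limit.

For symmetric or antisymmetric kernels, each pair of singular vectors of `f12` with number `s` gives
explicit trigonometric eigenvectors of `altOp` with eigenvalues `s / ((k + 1/2) π)`, `k ∈ ℤ`
(`altOp_singularVec`). No completeness argument is needed: the squares of these numbers already add
up to the Hilbert–Schmidt norm, and equality in Bessel's inequality forces the expansion. The
product over `k` of the characteristic functions is `1 / √(cosh (s t))` by the Euler product of
`cosh`. In the antisymmetric case, the real and imaginary parts of complex eigenvectors make every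
positive number occur twice as `s`, which turns this into `1 / cosh`. -/

/-! ### Spectral decomposition of compact self-adjoint operators -/

/-- `lam` lists the nonzero real eigenvalues of `T` with multiplicity, over a general scalar
field. -/
def ListsEigenvalues {𝕜 ι V : Type*} [RCLike 𝕜] [AddCommGroup V] [Module 𝕜 V] (T : V →ₗ[𝕜] V)
    (lam : ι → ℝ) : Prop :=
  (∀ r, lam r ≠ 0) ∧ ∀ c : ℝ, c ≠ 0 →
    {r | lam r = c}.encard = Cardinal.toENat (Module.rank 𝕜 (Module.End.eigenspace T (c : 𝕜)))

theorem encard_setOf_comp_equiv {α β : Type*} (e : β ≃ α) (p : α → Prop) :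
    {b | p (e b)}.encard = {a | p a}.encard := by
  rw [← e.injective.encard_image {b | p (e b)}]
  congr 1
  ext a
  simp only [Set.mem_image, Set.mem_ofPred_eq]
  exact ⟨by rintro ⟨b, hb, rfl⟩; exact hb, fun h => ⟨e.symm a, by simpa using h, by simp⟩⟩

/-- Every countable type is in bijection with some index set `Idx R`. -/
theorem exists_equiv_idx (ι : Type*) [Countable ι] : ∃ R : ℕ∞, Nonempty (Idx R ≃ ι) := by
  rcases finite_or_infinite ι with h | h
  · obtain ⟨n, ⟨e⟩⟩ := Finite.exists_equiv_fin ι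
    refine ⟨n, ⟨?_⟩⟩
    refine Equiv.trans ?_ e.symm
    exact ⟨fun r => ⟨r.1, by exact_mod_cast r.2⟩, fun i => ⟨i.1, by exact_mod_cast i.2⟩,
      fun _ => rfl, fun _ => rfl⟩
  · obtain ⟨e⟩ := nonempty_equiv_of_countable (α := ℕ) (β := ι)
    refine ⟨⊤, ⟨Equiv.trans ?_ e⟩⟩
    exact ⟨fun r => r.1, fun i => ⟨i, ENat.natCast_lt_top i⟩, fun _ => rfl, fun _ => rfl⟩

section Spectral

variable {𝕜 H : Type*} [RCLike 𝕜] [NormedAddCommGroup H] [InnerProductSpace 𝕜 H]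

open Module.End

/-- The spectral theorem in terms of an orthonormal family of eigenvectors. -/
theorem exists_orthonormal_eigenvectors [CompleteSpace H] (T : H →L[𝕜] H)
    (hc : IsCompactOperator T) (hs : T.toLinearMap.IsSymmetric) :
    ∃ (ι : Type) (lam : ι → ℝ) (v : ι → H), Orthonormal 𝕜 v ∧
      (∀ r, T (v r) = (lam r : 𝕜) • v r) ∧ (∀ w, (∀ r, inner 𝕜 (v r) w = 0) → T w = 0) ∧
      ListsEigenvalues T.toLinearMap lam := by
  have hfd : ∀ c : {c : ℝ // c ≠ 0}, FiniteDimensional 𝕜 (eigenspace T.toLinearMap (c.1 : 𝕜)) :=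
    fun c => ContinuousLinearMap.finite_dimensional_eigenspace hc _ (by exact_mod_cast c.2)
  -- Compactness makes the eigenspaces of nonzero eigenvalues finite dimensional; they are mutually
  -- orthogonal, so their orthonormal bases can be put together.
  let b := fun c : {c : ℝ // c ≠ 0} => stdOrthonormalBasis 𝕜 (eigenspace T.toLinearMap (c.1 : 𝕜))
  have hof := hs.orthogonalFamily_eigenspaces.comp
    (γ := {c : ℝ // c ≠ 0}) (f := fun c => (c.1 : 𝕜))
    (fun a b h => Subtype.ext (RCLike.ofReal_injective h))
  let v : (Σ c : {c : ℝ // c ≠ 0}, Fin (Module.finrank 𝕜 (eigenspace T.toLinearMap (c.1 : 𝕜)))) → H :=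
    fun p => (b p.1 p.2 : H)
  have hv : Orthonormal 𝕜 v := hof.orthonormal_sigma_orthonormal fun c => (b c).orthonormal
  refine ⟨_, fun p => p.1.1, v, hv, fun r => ?_, fun w hw => ?_, fun r => r.1.2, fun c hc0 => ?_⟩
  · exact mem_eigenspace_iff.1 (b r.1 r.2).2
  · have hT : ∀ x y, inner 𝕜 (T x) y = inner 𝕜 x (T y) := fun x y => hs x y
    -- For `z` in an eigenspace, `⟨z, T w⟩` is the eigenvalue times `⟨z, w⟩`: it vanishes if the
    -- eigenvalue is zero, and otherwise because `z` is a combination of the `v r`. As the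
    -- eigenspaces of a compact symmetric operator have dense span, `T w = 0`.
    have h1 : ∀ (c : 𝕜) (z : H), z ∈ eigenspace T.toLinearMap c → inner 𝕜 z (T w) = 0 := by
      intro c z hz
      by_cases hz0 : z = 0
      · simp [hz0]
      have hTz : T z = c • z := mem_eigenspace_iff.1 hz
      have hre : (starRingEnd 𝕜) c = c :=
        hs.conj_eigenvalue_eq_self (hasEigenvalue_of_hasEigenvector ⟨hz, hz0⟩)
      rw [← hT, hTz, inner_smul_left]
      by_cases hc0 : c = 0
      · simp [hc0]
      obtain ⟨d, rfl⟩ : ∃ d : ℝ, (d : 𝕜) = c := ⟨RCLike.re c, RCLike.conj_eq_iff_re.1 hre⟩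
      have hd : d ≠ 0 := by rintro rfl; simp at hc0
      have hsum := (b ⟨d, hd⟩).sum_repr ⟨z, hz⟩
      have hz' : z = ∑ i, (b ⟨d, hd⟩).repr ⟨z, hz⟩ i • v ⟨⟨d, hd⟩, i⟩ := by
        have := congrArg (Subtype.val) hsum
        simpa [v] using this.symm
      rw [hz', sum_inner]
      simp [inner_smul_left, hw]
    have h2 : T w ∈ (⨆ μ, eigenspace T.toLinearMap μ)ᗮ := by
      rw [← Submodule.iInf_orthogonal, Submodule.mem_iInf]
      exact fun c z hz => h1 c z hz
    have h3 := ContinuousLinearMap.orthogonalComplement_iSup_eigenspaces_eq_bot hc hs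
    have h4 : T w ∈ (⊥ : Submodule 𝕜 H) := h3 ▸ h2
    simpa using h4
  · have := hfd ⟨c, hc0⟩
    have : {r : (Σ c : {c : ℝ // c ≠ 0},
        Fin (Module.finrank 𝕜 (eigenspace T.toLinearMap (c.1 : 𝕜)))) | r.1.1 = c} =
        Set.range (Sigma.mk (⟨c, hc0⟩ : {c : ℝ // c ≠ 0})) := by
      ext ⟨⟨d, hd⟩, i⟩
      constructor
      · intro h
        have : d = c := h
        subst this
        exact ⟨i, rfl⟩
      · rintro ⟨j, hj⟩
        rw [Sigma.mk.injEq] at hj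
        exact (congrArg Subtype.val hj.1).symm
    rw [this, ← Set.image_univ, sigma_mk_injective.encard_image, Set.encard_univ,
      ← Module.finrank_eq_rank]
    simp

/-- A vector whose coefficients along an orthonormal family satisfy Parseval's identity is the sum
of its expansion. -/
theorem hasSum_of_hasSum_norm_sq {ι : Type*} {w : ι → H} (hw : Orthonormal 𝕜 w) (G : H)
    (h : HasSum (fun r => ‖inner 𝕜 (w r) G‖ ^ 2) (‖G‖ ^ 2)) :
    HasSum (fun r => inner 𝕜 (w r) G • w r) G := by
  classical
  -- Pythagoras for the remainder after a finite set of terms: convergence of the sums of squares is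
  -- convergence of the expansion.
  have key : ∀ s : Finset ι, ‖G - ∑ r ∈ s, inner 𝕜 (w r) G • w r‖ ^ 2 =
      ‖G‖ ^ 2 - ∑ r ∈ s, ‖inner 𝕜 (w r) G‖ ^ 2 := by
    intro s
    have h₂ : (∑ i ∈ s, ∑ j ∈ s, inner 𝕜 (w i) G * inner 𝕜 G (w j) * inner 𝕜 (w j) (w i)) =
        (∑ k ∈ s, inner 𝕜 (w k) G * inner 𝕜 G (w k) : 𝕜) := by
      classical exact hw.inner_left_right_finset
    have h₃ : ∀ z : 𝕜, RCLike.re (z * (starRingEnd 𝕜) z) = ‖z‖ ^ 2 := by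
      intro z
      simp only [RCLike.mul_conj]
      norm_cast
    rw [@norm_sub_sq 𝕜, sub_add]
    simp only [@InnerProductSpace.norm_sq_eq_re_inner 𝕜 H, inner_sum, sum_inner]
    simp only [inner_smul_right, two_mul, inner_smul_left, inner_conj_symm, ← mul_assoc, h₂,
      add_sub_cancel_right, sub_right_inj]
    simp only [map_sum, ← inner_conj_symm G, ← h₃]
  have h0 : Tendsto (fun s : Finset ι => ‖G‖ ^ 2 - ∑ r ∈ s, ‖inner 𝕜 (w r) G‖ ^ 2) atTop (𝓝 0) := by
    have := (tendsto_const_nhds (x := ‖G‖ ^ 2)).sub h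
    simpa using this
  have h1 : Tendsto (fun s : Finset ι => ‖G - ∑ r ∈ s, inner 𝕜 (w r) G • w r‖) atTop (𝓝 0) := by
    have := h0.sqrt
    simp only [← key] at this
    simpa using this
  rw [HasSum, SummationFilter.unconditional_filter, tendsto_iff_norm_sub_tendsto_zero]
  simpa only [norm_sub_rev] using h1

theorem summable_smul_of_orthonormal [CompleteSpace H] {ι : Type*} {w : ι → H}
    (hw : Orthonormal 𝕜 w) {c : ι → 𝕜} (hc : Summable fun r => ‖c r‖ ^ 2) :
    Summable fun r => c r • w r := by
  have := (hw.orthogonalFamily).summable_iff_norm_sq_summable c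
  simpa [LinearIsometry.toSpanSingleton_apply] using this.2 hc

theorem hasSum_norm_sq_of_orthonormal {ι : Type*} {w : ι → H}
    (hw : Orthonormal 𝕜 w) {c : ι → 𝕜} {G : H} (hc : HasSum (fun r => c r • w r) G) :
    HasSum (fun r => ‖c r‖ ^ 2) (‖G‖ ^ 2) := by
  classical
  have h1 : ∀ r, inner 𝕜 (w r) G = c r := by
    intro r
    have := hc.mapL (innerSL 𝕜 (w r))
    simp only [innerSL_apply_apply, inner_smul_right, orthonormal_iff_ite.1 hw] at this
    simpa using this.unique (hasSum_single r (fun s hs => by simp [hs.symm]))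
  have h2 := hc.mapL (innerSL 𝕜 G)
  simp only [innerSL_apply_apply, inner_smul_right] at h2
  have h3 := h2.mapL (RCLike.reCLM (K := 𝕜))
  have h4 : ∀ z : 𝕜, RCLike.re (z * (starRingEnd 𝕜) z) = ‖z‖ ^ 2 := by
    intro z
    simp only [RCLike.mul_conj]
    norm_cast
  have h5 : ∀ r, inner 𝕜 G (w r) = (starRingEnd 𝕜) (c r) := fun r => by
    rw [← inner_conj_symm, h1]
  simpa only [h5, RCLike.reCLM_apply, h4, ← InnerProductSpace.norm_sq_eq_re_inner] using h3

end Spectral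


/-! ### Tensor products in `L²` and Hilbert–Schmidt kernels -/

section Tensor

variable {𝕜 Y Y' : Type*} [RCLike 𝕜] [MeasurableSpace Y] [MeasurableSpace Y']
  {κ : Measure Y} {κ' : Measure Y'} [IsFiniteMeasure κ] [IsFiniteMeasure κ']

theorem memLp_two_mul_prod {u : Y → 𝕜} {v : Y' → 𝕜} (hu : MemLp u 2 κ) (hv : MemLp v 2 κ') :
    MemLp (fun p : Y × Y' => u p.1 * v p.2) 2 (κ.prod κ') := by
  have hm : AEStronglyMeasurable (fun p : Y × Y' => u p.1 * v p.2) (κ.prod κ') :=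
    hu.1.comp_fst.mul hv.1.comp_snd
  rw [memLp_two_iff_integrable_sq_norm hm]
  have := ((memLp_two_iff_integrable_sq_norm hu.1).1 hu).mul_prod
    ((memLp_two_iff_integrable_sq_norm hv.1).1 hv)
  simpa [mul_pow] using this

/-- The function `(x, y) ↦ u x * v y` as an element of `L²`. -/
noncomputable def tmul (u : Lp 𝕜 2 κ) (v : Lp 𝕜 2 κ') : Lp 𝕜 2 (κ.prod κ') :=
  (memLp_two_mul_prod (Lp.memLp u) (Lp.memLp v)).toLp _

theorem coeFn_tmul (u : Lp 𝕜 2 κ) (v : Lp 𝕜 2 κ') :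
    tmul u v =ᵐ[κ.prod κ'] fun p => u p.1 * v p.2 :=
  MemLp.coeFn_toLp _

theorem inner_tmul_left (u : Lp 𝕜 2 κ) (v : Lp 𝕜 2 κ') (D : Lp 𝕜 2 (κ.prod κ')) :
    inner 𝕜 (tmul u v) D = ∫ p, (starRingEnd 𝕜) (u p.1 * v p.2) * D p ∂(κ.prod κ') := by
  rw [L2.inner_def]
  refine integral_congr_ae ?_
  filter_upwards [coeFn_tmul u v] with p hp
  rw [hp, RCLike.inner_apply, mul_comm]

theorem inner_tmul (u u' : Lp 𝕜 2 κ) (v v' : Lp 𝕜 2 κ') :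
    inner 𝕜 (tmul u v) (tmul u' v') = inner 𝕜 u u' * inner 𝕜 v v' := by
  rw [inner_tmul_left, L2.inner_def, L2.inner_def, ← integral_prod_mul]
  refine integral_congr_ae ?_
  filter_upwards [coeFn_tmul u' v'] with p hp
  simp only [hp, RCLike.inner_apply, map_mul]
  ring

theorem norm_tmul (u : Lp 𝕜 2 κ) (v : Lp 𝕜 2 κ') : ‖tmul u v‖ = ‖u‖ * ‖v‖ := by
  have h : ‖tmul u v‖ ^ 2 = (‖u‖ * ‖v‖) ^ 2 := by
    have := inner_tmul u u v v
    simp only [inner_self_eq_norm_sq_to_K] at this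
    rw [mul_pow]
    exact_mod_cast this
  exact (pow_left_inj₀ (norm_nonneg _) (by positivity) two_ne_zero).1 h

/-- Rectangles form a π-system generating the product σ-algebra, and the sets over which `D`
integrates to zero are closed under complements and disjoint unions. -/
theorem integral_prod_eq_zero_of_rectangles {D : Y × Y' → 𝕜} (hD : Integrable D (κ.prod κ'))
    (h : ∀ s t, MeasurableSet s → MeasurableSet t → ∫ p in s ×ˢ t, D p ∂(κ.prod κ') = 0) :
    D =ᵐ[κ.prod κ'] 0 := by
  refine hD.ae_eq_zero_of_forall_setIntegral_eq_zero fun s hs _ => ?_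
  induction s, hs using MeasurableSpace.induction_on_inter generateFrom_prod.symm isPiSystem_prod with
  | empty => simp
  | basic t ht =>
    obtain ⟨a, ha, b, hb, rfl⟩ := ht
    exact h a b ha hb
  | compl t htm ih =>
    have h1 := integral_add_compl htm hD
    have h2 := h Set.univ Set.univ .univ .univ
    rw [Set.univ_prod_univ, setIntegral_univ] at h2
    rw [h2, ih (measure_lt_top _ _), zero_add] at h1
    exact h1
  | iUnion F hd hm ih =>
    rw [integral_iUnion hm hd hD.integrableOn]
    simp [fun i => ih i (measure_lt_top _ _)]

/-- Elementary tensors span a dense subspace. -/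
theorem eq_zero_of_forall_inner_tmul (D : Lp 𝕜 2 (κ.prod κ'))
    (h : ∀ (u : Lp 𝕜 2 κ) (v : Lp 𝕜 2 κ'), inner 𝕜 (tmul u v) D = 0) : D = 0 := by
  rw [Lp.eq_zero_iff_ae_eq_zero]
  refine integral_prod_eq_zero_of_rectangles ((Lp.memLp D).integrable (by norm_num)) ?_
  intro s t hs ht
  have h1 := h (indicatorConstLp 2 hs (measure_ne_top _ _) 1)
    (indicatorConstLp 2 ht (measure_ne_top _ _) 1)
  rw [inner_tmul_left] at h1
  rw [← h1, ← integral_indicator (hs.prod ht)]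
  refine integral_congr_ae ?_
  have e1 := (Measure.quasiMeasurePreserving_fst (μ := κ) (ν := κ')).ae
    (indicatorConstLp_coeFn (p := 2) (hs := hs) (hμs := measure_ne_top κ s) (c := (1 : 𝕜)))
  have e2 := (Measure.quasiMeasurePreserving_snd (μ := κ) (ν := κ')).ae
    (indicatorConstLp_coeFn (p := 2) (hs := ht) (hμs := measure_ne_top κ' t) (c := (1 : 𝕜)))
  filter_upwards [e1, e2] with p h1 h2
  rw [h1, h2]
  by_cases hp1 : p.1 ∈ s <;> by_cases hp2 : p.2 ∈ t <;> simp [Set.indicator, hp1, hp2]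

end Tensor

/-! ### Hilbert–Schmidt operators and their kernels -/

section KernelOperator

variable {𝕜 Y : Type*} [RCLike 𝕜] [MeasurableSpace Y] {κ : Measure Y} [IsFiniteMeasure κ]

theorem inner_star_star (u v : Lp 𝕜 2 κ) : inner 𝕜 (star u) (star v) = inner 𝕜 v u := by
  rw [L2.inner_def, L2.inner_def]
  refine integral_congr_ae ?_
  filter_upwards [Lp.coeFn_star u, Lp.coeFn_star v] with x h1 h2
  rw [h1, h2]
  simp [mul_comm]

theorem norm_star_Lp (v : Lp 𝕜 2 κ) : ‖star v‖ = ‖v‖ := by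
  rw [@norm_eq_sqrt_re_inner 𝕜, inner_star_star, ← @norm_eq_sqrt_re_inner 𝕜]

/-- The sesquilinear form of an integral operator is the pairing with its kernel. -/
theorem inner_integralOp {g : Y → Y → 𝕜}
    (hg : MemLp (fun p : Y × Y => g p.1 p.2) 2 (κ.prod κ)) (u v : Lp 𝕜 2 κ) :
    inner 𝕜 u (integralOp κ g v) = inner 𝕜 (tmul u (star v)) (hg.toLp _) := by
  have hint : Integrable (fun p : Y × Y => (starRingEnd 𝕜) (u p.1 * (star v : Lp 𝕜 2 κ) p.2) *
      g p.1 p.2) (κ.prod κ) := by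
    have h1 := memLp_two_mul_prod (Lp.memLp u) (Lp.memLp (star v))
    exact h1.star.integrable_mul hg
  rw [inner_tmul_left, L2.inner_def]
  have e : ∫ p, (starRingEnd 𝕜) (u p.1 * (star v : Lp 𝕜 2 κ) p.2) * (hg.toLp _ : _ → 𝕜) p
      ∂(κ.prod κ) = ∫ p, (starRingEnd 𝕜) (u p.1 * (star v : Lp 𝕜 2 κ) p.2) * g p.1 p.2
      ∂(κ.prod κ) := by
    refine integral_congr_ae ?_
    filter_upwards [hg.coeFn_toLp] with p hp
    rw [hp]
  rw [e, integral_prod _ hint]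
  refine integral_congr_ae ?_
  filter_upwards [integralOp_apply κ hg v] with x hx
  rw [hx, RCLike.inner_apply, mul_comm, ← integral_const_mul]
  refine integral_congr_ae ?_
  filter_upwards [Lp.coeFn_star v] with y hy
  rw [hy]
  simp
  ring

theorem inner_integralOp_coeFn (D : Lp 𝕜 2 (κ.prod κ)) (u v : Lp 𝕜 2 κ) :
    inner 𝕜 u (integralOp κ (fun x y => D (x, y)) v) = inner 𝕜 (tmul u (star v)) D := by
  have h := inner_integralOp (g := fun x y => D (x, y)) (Lp.memLp D) u v
  rwa [show (Lp.memLp D).toLp (fun p : Y × Y => (fun x y => D (x, y)) p.1 p.2) = D from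
    Lp.toLp_coeFn D (Lp.memLp D)] at h

/-- The linear map from `L²` kernels to integral operators. -/
noncomputable def kerOp (κ : Measure Y) [IsFiniteMeasure κ] :
    Lp 𝕜 2 (κ.prod κ) →L[𝕜] Lp 𝕜 2 κ →L[𝕜] Lp 𝕜 2 κ :=
  LinearMap.mkContinuous
    { toFun := fun D => integralOp κ (fun x y => D (x, y))
      map_add' := fun D D' => by
        ext1 v
        refine ext_inner_left 𝕜 fun u => ?_
        rw [add_apply, inner_add_right, inner_integralOp_coeFn,
          inner_integralOp_coeFn, inner_integralOp_coeFn, inner_add_right]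
      map_smul' := fun c D => by
        ext1 v
        refine ext_inner_left 𝕜 fun u => ?_
        rw [RingHom.id_apply, smul_apply, inner_smul_right,
          inner_integralOp_coeFn, inner_integralOp_coeFn, inner_smul_right] }
    1 (fun D => by
      rw [one_mul]
      refine ContinuousLinearMap.opNorm_le_bound _ (norm_nonneg _) fun v => ?_
      simp only [LinearMap.coe_mk, AddHom.coe_mk]
      by_cases h0 : ‖integralOp κ (fun x y => D (x, y)) v‖ = 0
      · rw [h0]; positivity
      -- Pairing `T v` with itself gives `‖T v‖² = ⟨T v ⊗ star v, D⟩ ≤ ‖T v‖ ‖v‖ ‖D‖`, so the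
      -- operator norm is at most the Hilbert–Schmidt norm.
      have h := inner_integralOp_coeFn D (integralOp κ (fun x y => D (x, y)) v) v
      have h2 : ‖integralOp κ (fun x y => D (x, y)) v‖ ^ 2 ≤
          ‖integralOp κ (fun x y => D (x, y)) v‖ * ‖v‖ * ‖D‖ := by
        rw [inner_self_eq_norm_sq_to_K] at h
        have h3 := congrArg norm h
        rw [norm_pow, RCLike.norm_ofReal, abs_of_nonneg (norm_nonneg _)] at h3
        rw [h3]
        refine (norm_inner_le_norm _ _).trans ?_
        rw [norm_tmul, norm_star_Lp]
      have hpos : 0 < ‖integralOp κ (fun x y => D (x, y)) v‖ :=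
        lt_of_le_of_ne (norm_nonneg _) (Ne.symm h0)
      nlinarith)

theorem inner_kerOp (D : Lp 𝕜 2 (κ.prod κ)) (u v : Lp 𝕜 2 κ) :
    inner 𝕜 u (kerOp κ D v) = inner 𝕜 (tmul u (star v)) D := by
  exact inner_integralOp_coeFn D u v

theorem integralOp_eq_kerOp {g : Y → Y → 𝕜}
    (hg : MemLp (fun p : Y × Y => g p.1 p.2) 2 (κ.prod κ)) :
    integralOp κ g = kerOp κ (hg.toLp _) := by
  ext1 v
  refine ext_inner_left 𝕜 fun u => ?_
  rw [inner_kerOp, inner_integralOp]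

theorem kerOp_tmul (u v w : Lp 𝕜 2 κ) :
    kerOp κ (tmul u v) w = inner 𝕜 (star w) v • u := by
  refine ext_inner_left 𝕜 fun z => ?_
  rw [inner_kerOp, inner_tmul, inner_smul_right, mul_comm]

/-- The kernels with compact operator form a closed subspace. It contains the elementary tensors,
whose operators have rank at most one, and nothing but zero is orthogonal to all of these. -/
theorem isCompactOperator_kerOp (D : Lp 𝕜 2 (κ.prod κ)) : IsCompactOperator (kerOp κ D) := by
  let K : Submodule 𝕜 (Lp 𝕜 2 (κ.prod κ)) :=
    (compactOperator (RingHom.id 𝕜) (Lp 𝕜 2 κ) (Lp 𝕜 2 κ)).comap (kerOp κ).toLinearMap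
  have hcl : IsClosed (K : Set (Lp 𝕜 2 (κ.prod κ))) :=
    IsClosed.preimage (kerOp κ).continuous
      (isClosed_setOfPred_isCompactOperator (σ₁₂ := RingHom.id 𝕜) (M₁ := Lp 𝕜 2 κ) (M₂ := Lp 𝕜 2 κ))
  have : CompleteSpace K := hcl.completeSpace_coe
  have hK : Kᗮ = ⊥ := by
    rw [Submodule.eq_bot_iff]
    intro D hD
    refine eq_zero_of_forall_inner_tmul D fun u v => hD _ ?_
    have h1 : kerOp κ (tmul u v) =
        (ContinuousLinearMap.toSpanSingleton 𝕜 u) ∘L (innerSL 𝕜 (star v)) := by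
      ext1 w
      rw [kerOp_tmul]
      simp only [ContinuousLinearMap.coe_comp, Function.comp_apply, innerSL_apply_apply,
        ContinuousLinearMap.toSpanSingleton_apply]
      rw [← inner_star_star, star_star]
    change IsCompactOperator (kerOp κ (tmul u v))
    rw [h1]
    have h2 : IsCompactOperator (ContinuousLinearMap.toSpanSingleton 𝕜 u) :=
      isCompactOperator_of_locallyCompactSpace_rng _
    exact h2.comp_clm (innerSL 𝕜 (star v))
  rw [Submodule.orthogonal_eq_bot_iff] at hK
  have : D ∈ K := hK ▸ Submodule.mem_top
  exact this

theorem isCompactOperator_integralOp {g : Y → Y → 𝕜}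
    (hg : MemLp (fun p : Y × Y => g p.1 p.2) 2 (κ.prod κ)) :
    IsCompactOperator (integralOp κ g) := by
  rw [integralOp_eq_kerOp hg]
  exact isCompactOperator_kerOp _

theorem memLp_swap {g : Y → Y → 𝕜} (hg : MemLp (fun p : Y × Y => g p.1 p.2) 2 (κ.prod κ)) :
    MemLp (fun p : Y × Y => g p.2 p.1) 2 (κ.prod κ) :=
  hg.comp_measurePreserving Measure.measurePreserving_swap

theorem inner_integralOp_left {g : Y → Y → 𝕜}
    (hg : MemLp (fun p : Y × Y => g p.1 p.2) 2 (κ.prod κ)) (u v : Lp 𝕜 2 κ) :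
    inner 𝕜 (integralOp κ (fun x y => (starRingEnd 𝕜) (g y x)) u) v =
      inner 𝕜 u (integralOp κ g v) := by
  have hg' : MemLp (fun p : Y × Y => (fun x y => (starRingEnd 𝕜) (g y x)) p.1 p.2) 2 (κ.prod κ) :=
    (memLp_swap hg).star
  rw [← inner_conj_symm, inner_integralOp hg', inner_integralOp hg, inner_tmul_left,
    inner_tmul_left, ← integral_conj, ← integral_prod_swap]
  refine integral_congr_ae ?_
  have e1 := (Measure.measurePreserving_swap (μ := κ) (ν := κ)).quasiMeasurePreserving.ae
    hg'.coeFn_toLp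
  have e2 := (Measure.quasiMeasurePreserving_fst (μ := κ) (ν := κ)).ae (Lp.coeFn_star u)
  have e3 := (Measure.quasiMeasurePreserving_snd (μ := κ) (ν := κ)).ae (Lp.coeFn_star v)
  filter_upwards [hg.coeFn_toLp, e1, e2, e3] with p h1 h2 h3 h4
  simp only [Prod.fst_swap, Prod.snd_swap] at h2 ⊢
  rw [h1, h2, h3, h4]
  simp only [Pi.star_apply, RCLike.star_def, map_mul, RCLike.conj_conj]
  ring

theorem adjoint_integralOp {g : Y → Y → 𝕜}
    (hg : MemLp (fun p : Y × Y => g p.1 p.2) 2 (κ.prod κ)) :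
    ContinuousLinearMap.adjoint (integralOp κ g) =
      integralOp κ (fun x y => (starRingEnd 𝕜) (g y x)) := by
  symm
  rw [ContinuousLinearMap.eq_adjoint_iff]
  exact inner_integralOp_left hg

theorem orthonormal_tmul_star {ι : Type*} {v : ι → Lp 𝕜 2 κ} (hv : Orthonormal 𝕜 v) :
    Orthonormal 𝕜 fun r => tmul (v r) (star (v r)) := by
  classical
  rw [orthonormal_iff_ite] at hv ⊢
  intro i j
  rw [inner_tmul, inner_star_star, hv, hv]
  by_cases h : i = j <;> simp [h, eq_comm]

/-- The expansion of a kernel in the eigenvectors of its integral operator. -/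
theorem hasSum_kernel {ι : Type*} {v : ι → Lp 𝕜 2 κ} (hv : Orthonormal 𝕜 v)
    (G : Lp 𝕜 2 (κ.prod κ)) (lam : ι → 𝕜) (hl : ∀ r, kerOp κ G (v r) = lam r • v r)
    (h0 : ∀ w, (∀ r, inner 𝕜 (v r) w = 0) → kerOp κ G w = 0) :
    HasSum (fun r => lam r • tmul (v r) (star (v r))) G := by
  classical
  have hort := orthonormal_tmul_star hv
  have hco : ∀ r, inner 𝕜 (tmul (v r) (star (v r))) G = lam r := fun r => by
    rw [← inner_kerOp, hl, inner_smul_right, orthonormal_iff_ite.1 hv]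
    simp
  have hsq : Summable fun r => ‖lam r‖ ^ 2 := by
    have := hort.inner_products_summable (x := G)
    simpa [hco] using this
  -- The eigenvalues are the coefficients of `G` along orthonormal tensors, so Bessel's inequality
  -- makes the candidate series converge.
  obtain ⟨G', hG'⟩ := summable_smul_of_orthonormal hort hsq
  suffices G - G' = 0 by rwa [sub_eq_zero.1 this]
  have hop : ∀ w, HasSum (fun r => lam r • inner 𝕜 (star w) (star (v r)) • v r) (kerOp κ G' w) := by
    intro w
    have h1 := (hG'.mapL (kerOp κ)).mapL (ContinuousLinearMap.apply 𝕜 (Lp 𝕜 2 κ) w)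
    simpa [kerOp_tmul] using h1
  -- The null space of the operator of `G - G'` is closed and contains the eigenvectors `v r` as
  -- well as every vector orthogonal to them, so it is the whole space and `G = G'`.
  let Z : Submodule 𝕜 (Lp 𝕜 2 κ) := (kerOp κ (G - G')).ker
  have hZc : IsClosed (Z : Set (Lp 𝕜 2 κ)) := (kerOp κ (G - G')).isClosed_ker
  have : CompleteSpace Z := hZc.completeSpace_coe
  have hvZ : ∀ r, v r ∈ Z := fun s => by
    have h1 := (hop (v s)).unique (hasSum_single s (fun r hr => by
      rw [inner_star_star, orthonormal_iff_ite.1 hv, if_neg hr]; simp))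
    rw [LinearMap.mem_ker, ContinuousLinearMap.coe_coe, map_sub, sub_apply, hl,
      h1, inner_star_star, orthonormal_iff_ite.1 hv]
    simp
  have hZ : Zᗮ = ⊥ := by
    rw [Submodule.eq_bot_iff]
    intro w hw
    have hw' : ∀ r, inner 𝕜 (v r) w = 0 := fun r => hw _ (hvZ r)
    have hwZ : w ∈ Z := by
      rw [LinearMap.mem_ker, ContinuousLinearMap.coe_coe, map_sub, sub_apply,
        h0 w hw']
      have h1 := (hop w).unique (hasSum_zero.congr_fun fun r => by rw [inner_star_star, hw']; simp)
      rw [h1, sub_zero]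
    exact inner_self_eq_zero.1 (hw w hwZ)
  rw [Submodule.orthogonal_eq_bot_iff] at hZ
  refine eq_zero_of_forall_inner_tmul _ fun u w => ?_
  have h1 : star w ∈ Z := hZ ▸ Submodule.mem_top
  have h2 := inner_kerOp (G - G') u (star w)
  rw [star_star] at h2
  rw [← h2, show kerOp κ (G - G') (star w) = 0 from h1, inner_zero_right]

end KernelOperator


/-! ### Second moments of degenerate statistics -/

/-- A square integrable kernel both of whose marginals vanish. -/
structure IsDegenerate {S : Type*} [MeasurableSpace S] (ν : Measure S) (f : S → S → ℝ) : Prop where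
  meas : Measurable (fun p : S × S => f p.1 p.2)
  memLp : MemLp (fun p : S × S => f p.1 p.2) 2 (ν.prod ν)
  left : ∀ᵐ y ∂ν, ∫ x, f x y ∂ν = 0
  right : ∀ᵐ x ∂ν, ∫ y, f x y ∂ν = 0

/-- A sequence of independent variables with law `ν`. -/
structure IsIID {Ω S : Type*} [MeasurableSpace Ω] [MeasurableSpace S] (P : Measure Ω)
    (ν : Measure S) (X : ℕ → Ω → S) : Prop where
  meas : ∀ i, Measurable (X i)
  law : ∀ i, P.map (X i) = ν
  indep : iIndepFun X P

/-- The squared `L²` norm of a kernel. -/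
noncomputable def kernelNormSq {S : Type*} [MeasurableSpace S] (ν : Measure S) (f : S → S → ℝ) : ℝ :=
  ∫ p, f p.1 p.2 ^ 2 ∂(ν.prod ν)

theorem kernelNormSq_nonneg {S : Type*} [MeasurableSpace S] (ν : Measure S) (f : S → S → ℝ) :
    0 ≤ kernelNormSq ν f := integral_nonneg fun _ => sq_nonneg _

theorem integral_sq_sum_of_orthogonal {Ω ι : Type*} [MeasurableSpace Ω] {P : Measure Ω}
    (s : Finset ι) (Z : ι → Ω → ℝ) (hZ : ∀ i ∈ s, MemLp (Z i) 2 P)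
    (ho : ∀ i ∈ s, ∀ j ∈ s, i ≠ j → ∫ ω, Z i ω * Z j ω ∂P = 0) :
    ∫ ω, (∑ i ∈ s, Z i ω) ^ 2 ∂P = ∑ i ∈ s, ∫ ω, Z i ω ^ 2 ∂P := by
  classical
  have hint : ∀ i ∈ s, ∀ j ∈ s, Integrable (fun ω => Z i ω * Z j ω) P :=
    fun i hi j hj => (hZ i hi).integrable_mul (hZ j hj)
  simp_rw [sq, Finset.sum_mul_sum]
  rw [integral_finsetSum _ fun i hi => integrable_finsetSum _ fun j hj => hint i hi j hj]
  refine Finset.sum_congr rfl fun i hi => ?_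
  rw [integral_finsetSum _ fun j hj => hint i hi j hj]
  exact Finset.sum_eq_single_of_mem i hi fun j hj hji => ho i hi j hj hji.symm

section IID

variable {Ω S : Type*} [MeasurableSpace Ω] [MeasurableSpace S] {P : Measure Ω}
  [IsProbabilityMeasure P] {ν : Measure S} [IsProbabilityMeasure ν] {X : ℕ → Ω → S}
  {f : S → S → ℝ}

theorem IsDegenerate.flip (hf : IsDegenerate ν f) : IsDegenerate ν (fun x y => f y x) :=
  ⟨hf.meas.comp measurable_swap, memLp_swap hf.memLp, hf.right, hf.left⟩

theorem IsIID.measurePreserving (hX : IsIID P ν X) (i : ℕ) : MeasurePreserving (X i) P ν :=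
  ⟨hX.meas i, hX.law i⟩

theorem IsIID.measurePreserving_pair (hX : IsIID P ν X) {i j : ℕ} (hij : i ≠ j) :
    MeasurePreserving (fun ω => (X i ω, X j ω)) P (ν.prod ν) := by
  refine ⟨(hX.meas i).prodMk (hX.meas j), ?_⟩
  rw [(indepFun_iff_map_prod_eq_prod_map_map (hX.meas i).aemeasurable (hX.meas j).aemeasurable).1
    (hX.indep.indepFun hij), hX.law, hX.law]

theorem IsIID.memLp_pair (hX : IsIID P ν X) {i j : ℕ} (hij : i ≠ j)
    (hf : MemLp (fun p : S × S => f p.1 p.2) 2 (ν.prod ν)) :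
    MemLp (fun ω => f (X i ω) (X j ω)) 2 P :=
  hf.comp_measurePreserving (hX.measurePreserving_pair hij)

theorem IsIID.integral_pair (hX : IsIID P ν X) {i j : ℕ} (hij : i ≠ j) {F : S → S → ℝ}
    (hF : AEStronglyMeasurable (fun p : S × S => F p.1 p.2) (ν.prod ν)) :
    ∫ ω, F (X i ω) (X j ω) ∂P = ∫ p, F p.1 p.2 ∂(ν.prod ν) := by
  have h := hX.measurePreserving_pair hij
  rw [← h.map_eq, integral_map h.measurable.aemeasurable (by rw [h.map_eq]; exact hF)]

/-- A degenerate kernel in `X a` and `X b` is orthogonal to functions of variables other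
than `X a`. -/
theorem IsIID.integral_mul_eq_zero (hX : IsIID P ν X) (hf : IsDegenerate ν f) {a b : ℕ}
    (T : Finset ℕ) (ha : a ∉ T) (hb : b ∈ T) (g : (T → S) → ℝ) (hg : Measurable g)
    (hG : MemLp (fun ω => g fun i => X i ω) 2 P) :
    ∫ ω, f (X a ω) (X b ω) * g (fun i => X i ω) ∂P = 0 := by
  have hab : a ≠ b := fun h => ha (h ▸ hb)
  let V : Ω → T → S := fun ω i => X i ω
  have hV : Measurable V := measurable_pi_lambda _ fun i => hX.meas i
  have hind : IndepFun (X a) V P := by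
    have h := hX.indep.indepFun_finset {a} T (by simpa using ha) hX.meas
    exact h.comp (φ := fun z : (({a} : Finset ℕ) → S) => z ⟨a, by simp⟩) (ψ := id)
      (measurable_pi_apply _) measurable_id
  have hlaw : P.map (fun ω => (X a ω, V ω)) = ν.prod (P.map V) := by
    rw [(indepFun_iff_map_prod_eq_prod_map_map (hX.meas a).aemeasurable hV.aemeasurable).1 hind,
      hX.law]
  have : IsProbabilityMeasure (P.map V) := Measure.isProbabilityMeasure_map hV.aemeasurable
  let F : S × (T → S) → ℝ := fun q => f q.1 (q.2 ⟨b, hb⟩) * g q.2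
  have hF : Measurable F :=
    (hf.meas.comp (measurable_fst.prodMk ((measurable_pi_apply _).comp measurable_snd))).mul
      (hg.comp measurable_snd)
  have hFi : Integrable F (ν.prod (P.map V)) := by
    rw [← hlaw, integrable_map_measure hF.aestronglyMeasurable
      ((hX.meas a).prodMk hV).aemeasurable]
    exact (hX.memLp_pair hab hf.memLp).integrable_mul hG
  have h1 : ∫ ω, f (X a ω) (X b ω) * g (fun i => X i ω) ∂P = ∫ q, F q ∂(ν.prod (P.map V)) := by
    rw [← hlaw, integral_map ((hX.meas a).prodMk hV).aemeasurable hF.aestronglyMeasurable]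
  -- By independence the integral over `X a` can be taken first, with the other variables fixed;
  -- there the marginal of `f` vanishes.
  rw [h1, integral_prod_symm _ hFi]
  refine integral_eq_zero_of_ae ?_
  have h2 : MeasurePreserving (fun w : T → S => w ⟨b, hb⟩) (P.map V) ν := by
    refine ⟨measurable_pi_apply _, ?_⟩
    rw [Measure.map_map (measurable_pi_apply _) hV]
    exact hX.law b
  filter_upwards [h2.quasiMeasurePreserving.ae hf.left] with w hw
  simp only [F, Pi.zero_apply]
  rw [integral_mul_const, hw, zero_mul]

/-- At least one of the two arguments of `f` is not `X k`, and integrating over it gives zero. -/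
theorem IsIID.integral_mul_single (hX : IsIID P ν X) (hf : IsDegenerate ν f) {i j : ℕ}
    (hij : i ≠ j) (k : ℕ) {g : S → ℝ} (hg : Measurable g) (hg2 : MemLp g 2 ν) :
    ∫ ω, f (X i ω) (X j ω) * g (X k ω) ∂P = 0 := by
  by_cases hik : i = k
  · exact hX.integral_mul_eq_zero hf.flip {i, k} (a := j) (b := i)
      (by simp [hij.symm, ← hik]) (by simp)
      (fun w => g (w ⟨k, by simp⟩)) (hg.comp (measurable_pi_apply _))
      (hg2.comp_measurePreserving (hX.measurePreserving k))
  · exact hX.integral_mul_eq_zero hf {j, k} (a := i) (b := j)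
      (by simp [hij, hik]) (by simp)
      (fun w => g (w ⟨k, by simp⟩)) (hg.comp (measurable_pi_apply _))
      (hg2.comp_measurePreserving (hX.measurePreserving k))

/-- One of `i`, `j` is missing from `{k, l}`, since otherwise the two ordered pairs would coincide;
integrating over that variable gives zero. -/
theorem IsIID.integral_mul_pair (hX : IsIID P ν X) (hf : IsDegenerate ν f) {i j k l : ℕ}
    (hij : i < j) (hkl : k < l) (hne : (i, j) ≠ (k, l)) :
    ∫ ω, f (X i ω) (X j ω) * f (X k ω) (X l ω) ∂P = 0 := by
  have key : ∀ {a b c d : ℕ} (_ : a ≠ b) (_ : c ≠ d) (_ : a ≠ c) (_ : a ≠ d) {F G : S → S → ℝ}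
      (_ : IsDegenerate ν F) (_ : IsDegenerate ν G),
      ∫ ω, F (X a ω) (X b ω) * G (X c ω) (X d ω) ∂P = 0 := by
    intro a b c d hab hcd hac had F G hF hG
    have hm : Measurable (fun w : (({b, c, d} : Finset ℕ) → S) =>
        (w ⟨c, by simp⟩, w ⟨d, by simp⟩)) :=
      (measurable_pi_apply _).prodMk (measurable_pi_apply _)
    exact hX.integral_mul_eq_zero hF {b, c, d} (a := a) (b := b)
      (by simp [hab, hac, had]) (by simp)
      (fun w => G (w ⟨c, by simp⟩) (w ⟨d, by simp⟩))
      (hG.meas.comp hm) (hX.memLp_pair hcd hG.memLp)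
  by_cases h1 : i ≠ k ∧ i ≠ l
  · exact key hij.ne hkl.ne h1.1 h1.2 hf hf
  by_cases h2 : j ≠ k ∧ j ≠ l
  · exact key hij.ne' hkl.ne h2.1 h2.2 hf.flip hf
  exfalso
  apply hne
  rw [Prod.mk.injEq]
  omega

/-- The second moment of a weighted sum of a degenerate kernel. -/
theorem IsIID.integral_sq_sum (hX : IsIID P ν X) (hf : IsDegenerate ν f) (s : Finset (ℕ × ℕ))
    (hs : ∀ p ∈ s, p.1 < p.2) (c : ℕ × ℕ → ℝ) :
    ∫ ω, (∑ p ∈ s, c p * f (X p.1 ω) (X p.2 ω)) ^ 2 ∂P =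
      (∑ p ∈ s, c p ^ 2) * kernelNormSq ν f := by
  rw [integral_sq_sum_of_orthogonal s (fun p ω => c p * f (X p.1 ω) (X p.2 ω))
    (fun p hp => (hX.memLp_pair (hs p hp).ne hf.memLp).const_mul _), Finset.sum_mul]
  · refine Finset.sum_congr rfl fun p hp => ?_
    simp only [mul_pow]
    rw [integral_const_mul, kernelNormSq,
      hX.integral_pair (hs p hp).ne (F := fun x y => f x y ^ 2) (hf.memLp.1.pow 2)]
  · intro p hp q hq hpq
    have : ∀ ω, c p * f (X p.1 ω) (X p.2 ω) * (c q * f (X q.1 ω) (X q.2 ω)) =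
        (c p * c q) * (f (X p.1 ω) (X p.2 ω) * f (X q.1 ω) (X q.2 ω)) := fun ω => by ring
    simp only [this]
    rw [integral_const_mul, hX.integral_mul_pair hf (hs p hp) (hs q hq) hpq, mul_zero]

/-- The pairs `(i, j)` with `i < j < n`. -/
def ltPairs (n : ℕ) : Finset (ℕ × ℕ) :=
  (Finset.range n ×ˢ Finset.range n).filter fun p => p.1 < p.2

theorem sum_ltPairs {M : Type*} [AddCommMonoid M] (n : ℕ) (F : ℕ → ℕ → M) :
    ∑ p ∈ ltPairs n, F p.1 p.2 = ∑ j ∈ Finset.range n, ∑ i ∈ Finset.range j, F i j := by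
  rw [ltPairs, Finset.sum_filter, Finset.sum_product_right]
  refine Finset.sum_congr rfl fun j hj => ?_
  rw [← Finset.sum_filter]
  refine Finset.sum_congr ?_ fun _ _ => rfl
  ext i
  simp only [Finset.mem_filter, Finset.mem_range] at *
  omega

theorem lt_of_mem_ltPairs {n : ℕ} {p : ℕ × ℕ} (hp : p ∈ ltPairs n) : p.1 < p.2 :=
  (Finset.mem_filter.1 hp).2

theorem card_ltPairs (n : ℕ) : ((ltPairs n).card : ℝ) = n * (n - 1) / 2 := by
  have h := sum_ltPairs n (fun _ _ => (1 : ℝ))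
  simp only [Finset.sum_const, Finset.card_range, nsmul_eq_mul, mul_one] at h
  rw [h]
  clear h
  induction n with
  | zero => simp
  | succ n ih => rw [Finset.sum_range_succ, ih]; push_cast; ring

end IID

/-! ### Characteristic functions -/

section CharFun

variable {Ω : Type*} [MeasurableSpace Ω] {P : Measure Ω} [IsProbabilityMeasure P]

theorem charFun_map_eq {Z : Ω → ℝ} (hZ : AEMeasurable Z P) (t : ℝ) :
    charFun (P.map Z) t = ∫ ω, Complex.exp (t * Z ω * Complex.I) ∂P := by
  rw [charFun_apply_real, integral_map hZ (by fun_prop)]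

theorem integrable_cexp {Z : Ω → ℝ} (hZ : AEMeasurable Z P) (t : ℝ) :
    Integrable (fun ω => Complex.exp (t * Z ω * Complex.I)) P := by
  refine Integrable.of_bound (C := 1) (by fun_prop) (ae_of_all _ fun ω => ?_)
  rw [← Complex.ofReal_mul, Complex.norm_exp_ofReal_mul_I]

theorem norm_cexp_sub_le (a b : ℝ) :
    ‖Complex.exp (a * Complex.I) - Complex.exp (b * Complex.I)‖ ≤ |a - b| := by
  have h : Complex.exp (a * Complex.I) - Complex.exp (b * Complex.I) =
      Complex.exp (b * Complex.I) * (Complex.exp (Complex.I * (a - b : ℝ)) - 1) := by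
    rw [mul_sub, ← Complex.exp_add]
    push_cast
    ring_nf
  rw [h, norm_mul, Complex.norm_exp_ofReal_mul_I, one_mul]
  exact Real.norm_exp_I_mul_ofReal_sub_one_le

theorem integral_abs_le_sqrt {Z : Ω → ℝ} (hZ : MemLp Z 2 P) :
    ∫ ω, |Z ω| ∂P ≤ √(∫ ω, Z ω ^ 2 ∂P) := by
  refine Real.le_sqrt_of_sq_le ?_
  have h := variance_nonneg (fun ω => |Z ω|) P
  rw [variance_eq_sub (X := fun ω => |Z ω|) hZ.abs] at h
  have e : ∫ ω, ((fun ω => |Z ω|) ^ 2) ω ∂P = ∫ ω, Z ω ^ 2 ∂P := by simp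
  rw [e] at h
  linarith

/-- The exponential `x ↦ exp (i t x)` is `|t|`-Lipschitz, and the `L¹` norm is at most the `L²`
norm. -/
theorem norm_charFun_sub_le {Z Z' : Ω → ℝ} (hZ : MemLp Z 2 P) (hZ' : MemLp Z' 2 P) (t : ℝ) :
    ‖charFun (P.map Z) t - charFun (P.map Z') t‖ ≤ |t| * √(∫ ω, (Z ω - Z' ω) ^ 2 ∂P) := by
  have h1 := hZ.1.aemeasurable
  have h2 := hZ'.1.aemeasurable
  rw [charFun_map_eq h1, charFun_map_eq h2, ← integral_sub (integrable_cexp h1 t)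
    (integrable_cexp h2 t)]
  calc _ ≤ ∫ ω, |t| * |Z ω - Z' ω| ∂P := by
        refine norm_integral_le_of_norm_le (((hZ.sub hZ').integrable (by norm_num)).abs.const_mul _)
          (ae_of_all _ fun ω => ?_)
        have := norm_cexp_sub_le (t * Z ω) (t * Z' ω)
        rw [← mul_sub, abs_mul] at this
        simpa using this
    _ ≤ _ := by
        rw [integral_const_mul]
        exact mul_le_mul_of_nonneg_left (integral_abs_le_sqrt (hZ.sub hZ')) (abs_nonneg _)

/-- Sequences that are asymptotically equal in `L²` have the same limiting characteristic
function. -/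
theorem tendsto_charFun_of_sub {Z Z' : ℕ → Ω → ℝ} (hZ : ∀ n, MemLp (Z n) 2 P)
    (hZ' : ∀ n, MemLp (Z' n) 2 P)
    (h : Tendsto (fun n => ∫ ω, (Z n ω - Z' n ω) ^ 2 ∂P) atTop (𝓝 0)) {t : ℝ} {L : ℂ}
    (hL : Tendsto (fun n => charFun (P.map (Z' n)) t) atTop (𝓝 L)) :
    Tendsto (fun n => charFun (P.map (Z n)) t) atTop (𝓝 L) := by
  have h1 : Tendsto (fun n => charFun (P.map (Z n)) t - charFun (P.map (Z' n)) t) atTop (𝓝 0) := by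
    refine squeeze_zero_norm (fun n => norm_charFun_sub_le (hZ n) (hZ' n) t) ?_
    simpa using (h.sqrt).const_mul |t|
  simpa using h1.add hL

/-- Interchange of limits for characteristic functions. -/
theorem tendsto_charFun_of_approx {ι : Type*} {l : Filter ι} [l.NeBot] {Z : ℕ → Ω → ℝ}
    {Z' : ι → ℕ → Ω → ℝ} (hZ : ∀ n, MemLp (Z n) 2 P) (hZ' : ∀ s n, MemLp (Z' s n) 2 P)
    {δ : ι → ℝ} (hδ : Tendsto δ l (𝓝 0))
    (h : ∀ s, ∀ᶠ n in atTop, ∫ ω, (Z n ω - Z' s n ω) ^ 2 ∂P ≤ δ s) {t : ℝ} {Φ : ι → ℂ} {L : ℂ}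
    (hΦ : ∀ s, Tendsto (fun n => charFun (P.map (Z' s n)) t) atTop (𝓝 (Φ s)))
    (hL : Tendsto Φ l (𝓝 L)) :
    Tendsto (fun n => charFun (P.map (Z n)) t) atTop (𝓝 L) := by
  rw [Metric.tendsto_atTop]
  intro ε hε
  have h1 : Tendsto (fun s => |t| * √(δ s)) l (𝓝 0) := by simpa using (hδ.sqrt).const_mul |t|
  obtain ⟨s, hs1, hs2⟩ := ((h1.eventually (gt_mem_nhds (show (0 : ℝ) < ε / 3 by linarith))).and
    (hL.eventually (Metric.ball_mem_nhds L (show (0 : ℝ) < ε / 3 by linarith)))).exists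
  obtain ⟨N, hN⟩ := eventually_atTop.1 ((h s).and
    ((hΦ s).eventually (Metric.ball_mem_nhds _ (show (0 : ℝ) < ε / 3 by linarith))))
  refine ⟨N, fun n hn => ?_⟩
  obtain ⟨h2, h3⟩ := hN n hn
  have h4 := norm_charFun_sub_le (hZ n) (hZ' s n) t
  have h5 : |t| * √(∫ ω, (Z n ω - Z' s n ω) ^ 2 ∂P) ≤ |t| * √(δ s) := by gcongr
  rw [← dist_eq_norm] at h4
  have h6 := dist_triangle4 (charFun (P.map (Z n)) t) (charFun (P.map (Z' s n)) t) (Φ s) L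
  linarith

/-- Convergence in distribution from pointwise convergence of characteristic functions. -/
theorem tendstoInDistribution_of_charFun {Ω' : Type*} [MeasurableSpace Ω'] {P' : Measure Ω'}
    [IsProbabilityMeasure P'] {Z : ℕ → Ω → ℝ} {W : Ω' → ℝ} (hZ : ∀ n, AEMeasurable (Z n) P)
    (hW : AEMeasurable W P')
    (h : ∀ t, Tendsto (fun n => charFun (P.map (Z n)) t) atTop (𝓝 (charFun (P'.map W) t))) :
    TendstoInDistribution Z atTop W (fun _ => P) P' where
  forall_aemeasurable := hZ
  aemeasurable_limit := hW
  tendsto := ProbabilityMeasure.tendsto_iff_tendsto_charFun.2 h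

end CharFun


/-! ### A central limit theorem for weighted sums -/

/-- The factors are exchanged one at a time; all the others have modulus at most 1. -/
theorem norm_prod_sub_prod_le {ι : Type*} (s : Finset ι) (a b : ι → ℂ) (ha : ∀ i ∈ s, ‖a i‖ ≤ 1)
    (hb : ∀ i ∈ s, ‖b i‖ ≤ 1) : ‖∏ i ∈ s, a i - ∏ i ∈ s, b i‖ ≤ ∑ i ∈ s, ‖a i - b i‖ := by
  classical
  induction s using Finset.induction_on with
  | empty => simp
  | insert i s hi ih =>
    have ha' := fun j hj => ha j (Finset.mem_insert_of_mem hj)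
    have hb' := fun j hj => hb j (Finset.mem_insert_of_mem hj)
    rw [Finset.prod_insert hi, Finset.prod_insert hi, Finset.sum_insert hi]
    have h1 : ‖∏ i ∈ s, a i‖ ≤ 1 := by
      rw [norm_prod]
      exact Finset.prod_le_one (fun _ _ => norm_nonneg _) ha'
    have e : a i * ∏ j ∈ s, a j - b i * ∏ j ∈ s, b j =
        (a i - b i) * ∏ j ∈ s, a j + b i * (∏ j ∈ s, a j - ∏ j ∈ s, b j) := by ring
    rw [e]
    refine (norm_add_le _ _).trans (add_le_add ?_ ?_)
    · rw [norm_mul]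
      exact mul_le_of_le_one_right (norm_nonneg _) h1
    · rw [norm_mul]
      exact (mul_le_of_le_one_left (norm_nonneg _) (hb i (Finset.mem_insert_self _ _))).trans
        (ih ha' hb')

/-- Both functions equal `1 - v s² / 2` up to `o(s²)`: the first by Taylor's formula with two
moments, the second by the derivative of the exponential at zero. -/
theorem charFun_sub_gaussian_isLittleO {μ : Measure ℝ} [IsProbabilityMeasure μ]
    (h2 : MemLp id 2 μ) (h0 : ∫ x, x ∂μ = 0) :
    (fun s : ℝ => charFun μ s - Complex.exp (-((∫ x, x ^ 2 ∂μ) * s ^ 2 / 2 : ℝ)))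
      =o[𝓝 0] fun s => s ^ 2 := by
  set v := ∫ x, x ^ 2 ∂μ with hv
  have h1 : (fun s : ℝ => charFun μ s - (1 - v * s ^ 2 / 2)) =o[𝓝 0] fun s => s ^ 2 := by
    have e : ∀ t : ℝ, taylorWithinEval (charFun μ) 2 Set.univ 0 t = 1 - v * t ^ 2 / 2 := by
      intro t
      have := taylorWithinEval_charFun_two_zero (P := μ) (X := id) aemeasurable_id
        (by simpa using h2) t
      simp only [Measure.map_id, Pi.pow_apply, id] at this
      rw [this, h0, ← hv]
      simp
    simp_rw [← e]
    convert! taylor_isLittleO_univ (contDiff_charFun (n := 2) (by exact_mod_cast h2)) using 2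
    simp
  have h3 : (fun z : ℂ => Complex.exp z - 1 - z) =o[𝓝 0] fun z => z := by
    have := (Complex.hasDerivAt_exp 0).isLittleO
    simpa using this
  have h4 : Tendsto (fun s : ℝ => (-(v * s ^ 2 / 2 : ℝ) : ℂ)) (𝓝 0) (𝓝 0) := by
    have : Continuous (fun s : ℝ => (-(v * s ^ 2 / 2 : ℝ) : ℂ)) := by fun_prop
    simpa using this.tendsto 0
  have h5 := h3.comp_tendsto h4
  have h6 : ((fun z : ℂ => z) ∘ fun s : ℝ => (-(v * s ^ 2 / 2 : ℝ) : ℂ)) =O[𝓝 0]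
      fun s : ℝ => s ^ 2 := by
    refine Asymptotics.IsBigO.of_bound (|v| / 2) (Eventually.of_forall fun s => ?_)
    simp only [Function.comp_apply, norm_neg, Complex.norm_real, Real.norm_eq_abs, abs_div, abs_mul,
      abs_two]
    apply le_of_eq
    ring
  refine (h1.sub (h5.trans_isBigO h6)).congr_left fun s => ?_
  simp only [Function.comp_apply]
  push_cast
  ring

section WeightedCLT

variable {Ω S : Type*} [MeasurableSpace Ω] [MeasurableSpace S] {P : Measure Ω}
  [IsProbabilityMeasure P] {ν : Measure S} [IsProbabilityMeasure ν] {X : ℕ → Ω → S}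

theorem IsIID.charFun_sum (hX : IsIID P ν X) {g : S → ℝ} (hg : Measurable g) (s : Finset ℕ)
    (a : ℕ → ℝ) (t : ℝ) :
    charFun (P.map fun ω => ∑ i ∈ s, a i * g (X i ω)) t =
      ∏ i ∈ s, charFun (ν.map g) (a i * t) := by
  have hm : ∀ i, Measurable fun ω => g (X i ω) := fun i => hg.comp (hX.meas i)
  have hind : iIndepFun (fun i ω => a i * g (X i ω)) P :=
    hX.indep.comp (fun i x => a i * g x) fun i => hg.const_mul _
  rw [(hind.precomp (g := ((↑) : s → ℕ)) Subtype.val_injective).charFun_map_fun_finsetSum_eq_prod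
    fun i _ => ((hm i).const_mul _).aemeasurable, Finset.prod_apply]
  refine Finset.prod_congr rfl fun i _ => ?_
  rw [charFun_map_mul_comp (hm i).aemeasurable, ← hX.law i, Measure.map_map hg (hX.meas i)]
  rfl

/-- The central limit theorem for weighted sums of i.i.d. centered variables with asymptotically
negligible weights. -/
theorem IsIID.tendsto_charFun_weighted_sum (hX : IsIID P ν X) {g : S → ℝ} (hg : Measurable g)
    (hg2 : MemLp g 2 ν) (h0 : ∫ x, g x ∂ν = 0) (a : ℕ → ℕ → ℝ) (b : ℕ → ℝ)
    (hab : ∀ n, ∀ i < n, |a n i| ≤ b n) (hb : Tendsto b atTop (𝓝 0)) {A : ℝ}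
    (hA : Tendsto (fun n => ∑ i ∈ Finset.range n, a n i ^ 2) atTop (𝓝 A)) (t : ℝ) :
    Tendsto (fun n => charFun (P.map fun ω => ∑ i ∈ Finset.range n, a n i * g (X i ω)) t) atTop
      (𝓝 (Complex.exp (-(A * (∫ x, g x ^ 2 ∂ν) * t ^ 2 / 2 : ℝ)))) := by
  set v := ∫ x, g x ^ 2 ∂ν with hv
  have : IsProbabilityMeasure (ν.map g) := Measure.isProbabilityMeasure_map hg.aemeasurable
  have hmap : ∀ F : ℝ → ℝ, Measurable F → ∫ x, F x ∂(ν.map g) = ∫ x, F (g x) ∂ν :=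
    fun F hF => integral_map hg.aemeasurable hF.aestronglyMeasurable
  have ho := charFun_sub_gaussian_isLittleO (μ := ν.map g)
    ((memLp_map_measure_iff (by fun_prop) hg.aemeasurable).2 hg2)
    (by rw [hmap _ (by fun_prop), h0])
  rw [hmap _ (by fun_prop), ← hv] at ho
  set e : ℝ → ℂ := fun s => Complex.exp (-(v * s ^ 2 / 2 : ℝ)) with he
  have hv0 : 0 ≤ v := integral_nonneg fun _ => sq_nonneg _
  have hee : Tendsto (fun n => ∏ i ∈ Finset.range n, e (a n i * t)) atTop
      (𝓝 (Complex.exp (-(A * v * t ^ 2 / 2 : ℝ)))) := by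
    have h1 : ∀ n, ∏ i ∈ Finset.range n, e (a n i * t) =
        Complex.exp (-((∑ i ∈ Finset.range n, a n i ^ 2) * v * t ^ 2 / 2 : ℝ)) := by
      intro n
      simp only [he]
      rw [← Complex.exp_sum]
      congr 1
      push_cast
      rw [Finset.sum_neg_distrib]
      simp only [Finset.sum_mul, Finset.sum_div]
      congr 1
      exact Finset.sum_congr rfl fun i _ => by ring
    simp only [h1]
    have hc : Continuous fun x : ℝ => Complex.exp (-(x * v * t ^ 2 / 2 : ℝ)) := by fun_prop
    exact (hc.tendsto A).comp hA
  have hdiff : Tendsto (fun n => ∏ i ∈ Finset.range n, charFun (ν.map g) (a n i * t) -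
      ∏ i ∈ Finset.range n, e (a n i * t)) atTop (𝓝 0) := by
    rw [Metric.tendsto_nhds]
    intro ε hε
    obtain ⟨M, hM0, hM⟩ : ∃ M : ℝ, 0 < M ∧ A * t ^ 2 < M :=
      ⟨|A * t ^ 2| + 1, by positivity, by linarith [le_abs_self (A * t ^ 2)]⟩
    -- Negligible weights bring every argument `a n i * t` into the neighbourhood where the factors
    -- differ by at most `ε / M` times its square, and these squares sum to less than `M`.
    have h1 := ho.def (show 0 < ε / M by positivity)
    obtain ⟨δ, hδ, h2⟩ := Metric.eventually_nhds_iff.1 h1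
    have h3 : ∀ᶠ n in atTop, b n * |t| < δ := by
      have : Tendsto (fun n => b n * |t|) atTop (𝓝 0) := by simpa using hb.mul_const |t|
      exact this.eventually (gt_mem_nhds hδ)
    have h4 : ∀ᶠ n in atTop, (∑ i ∈ Finset.range n, a n i ^ 2) * t ^ 2 < M :=
      (hA.mul_const (t ^ 2)).eventually (gt_mem_nhds hM)
    filter_upwards [h3, h4] with n hn3 hn4
    rw [dist_zero_right]
    refine (norm_prod_sub_prod_le _ _ _ (fun i _ => norm_charFun_le_one _) fun i _ => ?_).trans_lt ?_
    · simp only [he]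
      rw [← Complex.ofReal_neg, Complex.norm_exp_ofReal, Real.exp_le_one_iff]
      have : 0 ≤ v * (a n i * t) ^ 2 / 2 := by positivity
      linarith
    · calc _ ≤ ∑ i ∈ Finset.range n, ε / M * (a n i ^ 2 * t ^ 2) := by
            refine Finset.sum_le_sum fun i hi => ?_
            rw [← mul_pow]
            have h5 : dist (a n i * t) 0 < δ := by
              rw [dist_zero_right, Real.norm_eq_abs, abs_mul]
              exact (mul_le_mul_of_nonneg_right (hab n i (Finset.mem_range.1 hi))
                (abs_nonneg t)).trans_lt hn3
            have h6 := h2 h5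
            rwa [Real.norm_of_nonneg (sq_nonneg _)] at h6
        _ = ε / M * ((∑ i ∈ Finset.range n, a n i ^ 2) * t ^ 2) := by
            rw [Finset.sum_mul, Finset.mul_sum]
        _ < ε / M * M := by gcongr
        _ = ε := by field_simp
  have := hdiff.add hee
  simp only [sub_add_cancel, zero_add] at this
  simpa only [hX.charFun_sum hg] using this

end WeightedCLT

/-! ### Square summable combinations of independent variables -/

section L2Sum

variable {Ω' ι : Type*} [MeasurableSpace Ω'] {P' : Measure Ω'} [IsProbabilityMeasure P']

/-- Divided by `√v`, independent centred variables are orthonormal, so square summable coefficients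
give an `L²` limit. The net of finite partial sums converges in `L²`, whence the product formula
with unconditional convergence. -/
theorem exists_l2Sum {Z : ι → Ω' → ℝ} (hZ : ∀ r, MemLp (Z r) 2 P') (hind : iIndepFun Z P')
    (h0 : ∀ r, ∫ ω, Z r ω ∂P' = 0) {v : ℝ} (hv : 0 < v) (hvar : ∀ r, ∫ ω, Z r ω ^ 2 ∂P' = v)
    {lam : ι → ℝ} {c : ℝ} (hl : HasSum (fun r => lam r ^ 2) c) :
    ∃ W : Ω' → ℝ, IsL2Sum P' (fun r ω => lam r * Z r ω) W ∧ Var[W; P'] = v * c ∧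
      ∀ t : ℝ, HasProd (fun r => charFun (P'.map (Z r)) (lam r * t)) (charFun (P'.map W) t) := by
  classical
  let z : ι → Lp ℝ 2 P' := fun r => (√v)⁻¹ • (hZ r).toLp _
  have hin : ∀ r s, inner ℝ ((hZ r).toLp _) ((hZ s).toLp _) = ∫ ω, Z r ω * Z s ω ∂P' := by
    intro r s
    rw [L2.inner_def]
    refine integral_congr_ae ?_
    filter_upwards [(hZ r).coeFn_toLp, (hZ s).coeFn_toLp] with ω h1 h2
    rw [h1, h2]
    simp [mul_comm]
  have hz : Orthonormal ℝ z := by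
    rw [orthonormal_iff_ite]
    intro r s
    simp only [z, inner_smul_left, inner_smul_right, hin]
    have hs : √v ≠ 0 := (Real.sqrt_pos.2 hv).ne'
    by_cases h : r = s
    · subst h
      simp only [← sq, hvar]
      simp only [if_true, conj_trivial]
      field_simp
      rw [Real.sq_sqrt hv.le]
    · rw [if_neg h, (hind.indepFun h).integral_fun_mul_eq_mul_integral (hZ r).1 (hZ s).1, h0]
      simp
  have hsum : Summable fun r => ‖√v * lam r‖ ^ 2 := by
    have : (fun r => ‖√v * lam r‖ ^ 2) = fun r => v * lam r ^ 2 := by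
      ext r
      rw [Real.norm_eq_abs, sq_abs, mul_pow, Real.sq_sqrt hv.le]
    rw [this]
    exact hl.summable.mul_left v
  obtain ⟨W, hW⟩ := summable_smul_of_orthonormal hz hsum
  have hnorm := hasSum_norm_sq_of_orthonormal hz hW
  have hcoe : ∀ s : Finset ι, (∑ r ∈ s, (√v * lam r) • z r : Lp ℝ 2 P') =ᵐ[P']
      fun ω => ∑ r ∈ s, lam r * Z r ω := by
    intro s
    have e1 : ∀ r, (√v * lam r) • z r = ((hZ r).const_mul (lam r)).toLp _ := by
      intro r
      have hs : √v ≠ 0 := (Real.sqrt_pos.2 hv).ne'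
      simp only [z, smul_smul]
      rw [show √v * lam r * (√v)⁻¹ = lam r by field_simp]
      rfl
    simp only [e1]
    induction s using Finset.induction_on with
    | empty => simp only [Finset.sum_empty]; exact Lp.coeFn_zero _ _ _
    | insert i s hi ih =>
      rw [Finset.sum_insert hi]
      filter_upwards [Lp.coeFn_add (((hZ i).const_mul (lam i)).toLp _)
        (∑ r ∈ s, ((hZ r).const_mul (lam r)).toLp _), ih, ((hZ i).const_mul (lam i)).coeFn_toLp]
        with ω h1 h2 h3
      rw [h1, Pi.add_apply, h2, h3, Finset.sum_insert hi]
  -- The mean is the inner product with the constant 1, so it passes through the series, whose terms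
  -- are centred.
  have hWm : ∫ ω, W ω ∂P' = 0 := by
    have h1 := hW.mapL (innerSL ℝ (indicatorConstLp 2 MeasurableSet.univ (measure_ne_top P' _) (1 : ℝ)))
    have h2 : ∀ r, innerSL ℝ (indicatorConstLp 2 MeasurableSet.univ (measure_ne_top P' _) (1 : ℝ))
        ((√v * lam r) • z r) = 0 := by
      intro r
      simp only [z, map_smul, innerSL_apply_apply, L2.inner_indicatorConstLp_one, setIntegral_univ]
      rw [integral_congr_ae (hZ r).coeFn_toLp, h0]
      simp
    simp only [h2, innerSL_apply_apply, L2.inner_indicatorConstLp_one, setIntegral_univ] at h1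
    exact h1.unique hasSum_zero
  have hWv : ∫ ω, W ω ^ 2 ∂P' = v * c := by
    have h1 : ‖W‖ ^ 2 = v * c := by
      refine hnorm.unique ?_
      have : (fun r => ‖√v * lam r‖ ^ 2) = fun r => v * lam r ^ 2 := by
        ext r
        rw [Real.norm_eq_abs, sq_abs, mul_pow, Real.sq_sqrt hv.le]
      rw [this]
      exact hl.mul_left v
    rw [← h1, ← real_inner_self_eq_norm_sq, L2.inner_def]
    simp [sq]
  have hlim : Tendsto (fun s : Finset ι => ∫ ω, ((∑ r ∈ s, lam r * Z r ω) - W ω) ^ 2 ∂P') atTop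
      (𝓝 0) := by
    have h1 : Tendsto (fun s : Finset ι => ‖∑ r ∈ s, (√v * lam r) • z r - W‖ ^ 2) atTop (𝓝 0) := by
      have := (tendsto_iff_norm_sub_tendsto_zero.1 hW).pow 2
      simpa using this
    refine h1.congr fun s => ?_
    rw [← real_inner_self_eq_norm_sq, L2.inner_def]
    refine integral_congr_ae ?_
    filter_upwards [Lp.coeFn_sub (∑ r ∈ s, (√v * lam r) • z r) W, hcoe s] with ω e1 e2
    rw [e1, Pi.sub_apply, e2]
    simp [sq]
  have hZl : ∀ r, MemLp (fun ω => lam r * Z r ω) 2 P' := fun r => (hZ r).const_mul _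
  refine ⟨W, ⟨hZl, Lp.memLp W, ?_⟩, ?_, fun t => ?_⟩
  · have h1 : Tendsto (fun s : Finset ι => ‖∑ r ∈ s, (√v * lam r) • z r - W‖ₑ) atTop (𝓝 0) := by
      have := tendsto_iff_edist_tendsto_0.1 hW
      simpa only [edist_eq_enorm_sub, SummationFilter.unconditional_filter] using this
    refine h1.congr fun s => ?_
    rw [Lp.enorm_def]
    refine eLpNorm_congr_ae ?_
    filter_upwards [Lp.coeFn_sub (∑ r ∈ s, (√v * lam r) • z r) W, hcoe s] with ω e1 e2
    rw [e1, Pi.sub_apply, e2]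
  · rw [variance_eq_sub (Lp.memLp W), hWm]
    simpa using hWv
  · have h1 : ∀ s : Finset ι, charFun (P'.map fun ω => ∑ r ∈ s, lam r * Z r ω) t =
        ∏ r ∈ s, charFun (P'.map (Z r)) (lam r * t) := by
      intro s
      have hind' : iIndepFun (fun r ω => lam r * Z r ω) P' :=
        hind.comp (fun r x => lam r * x) fun r => by fun_prop
      rw [(hind'.precomp (g := ((↑) : s → ι)) Subtype.val_injective).charFun_map_fun_finsetSum_eq_prod
        fun r _ => (hZl r).1.aemeasurable, Finset.prod_apply]
      exact Finset.prod_congr rfl fun r _ => charFun_map_mul_comp (hZ r).1.aemeasurable _ _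
    rw [HasProd, SummationFilter.unconditional_filter]
    simp only [← h1]
    rw [tendsto_iff_norm_sub_tendsto_zero]
    refine squeeze_zero (fun _ => norm_nonneg _) (fun s => norm_charFun_sub_le
      (memLp_finsetSum s fun r _ => hZl r) (Lp.memLp W) t) ?_
    simpa using (hlim.sqrt).const_mul |t|

end L2Sum

/-! ### Centered squares of Gaussian variables -/

/-- The fourth derivative at zero of the moment generating function `exp (t² / 2)`; differentiating
`p exp (t² / 2)` replaces `p` by `p' + t p`. -/
theorem integral_pow_four_gaussianReal : ∫ x, x ^ 4 ∂(gaussianReal 0 1) = 3 := by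
  have h1 := iteratedDeriv_mgf_zero (X := id) (μ := gaussianReal 0 1) (by simp) 4
  have h2 : mgf id (gaussianReal 0 1) = fun t => Real.exp (t ^ 2 / 2) := by
    simp [mgf_id_gaussianReal]
  have hd : ∀ (p p' : ℝ → ℝ) (_ : ∀ t, HasDerivAt p (p' t) t),
      deriv (fun t => p t * Real.exp (t ^ 2 / 2)) =
        fun t => (p' t + t * p t) * Real.exp (t ^ 2 / 2) := by
    intro p p' hp
    ext t
    have h3 : HasDerivAt (fun t : ℝ => Real.exp (t ^ 2 / 2)) (Real.exp (t ^ 2 / 2) * t) t := by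
      have := ((hasDerivAt_pow 2 t).div_const 2).exp
      simpa using this
    have h4 : HasDerivAt (fun t => p t * Real.exp (t ^ 2 / 2)) _ t := (hp t).mul h3
    rw [h4.deriv]
    ring
  have e0 : (fun t : ℝ => Real.exp (t ^ 2 / 2)) = fun t => 1 * Real.exp (t ^ 2 / 2) := by simp
  have e1 : ∀ t : ℝ, HasDerivAt (fun t : ℝ => (0 : ℝ) + t * 1) 1 t := fun t => by
    simpa using hasDerivAt_id' t
  have e2 : ∀ t : ℝ, HasDerivAt (fun t : ℝ => 1 + t * (0 + t * 1)) (2 * t) t := fun t => by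
    have := (hasDerivAt_pow 2 t).const_add 1
    refine (this.congr_deriv (by simp)).congr_of_eventuallyEq (Eventually.of_forall fun x => ?_)
    simp only
    ring
  have e3 : ∀ t : ℝ, HasDerivAt (fun t : ℝ => 2 * t + t * (1 + t * (0 + t * 1)))
      (3 + 3 * t ^ 2) t := fun t => by
    have := ((hasDerivAt_id t).const_mul 3).add (hasDerivAt_pow 3 t)
    refine (this.congr_deriv (by simp)).congr_of_eventuallyEq (Eventually.of_forall fun x => ?_)
    simp only [Pi.add_apply, id]
    ring
  rw [h2] at h1
  simp only [iteratedDeriv_succ, iteratedDeriv_zero] at h1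
  rw [e0, hd _ _ (fun t => hasDerivAt_const t 1), hd _ _ e1, hd _ _ e2, hd _ _ e3] at h1
  simp at h1
  exact h1.symm

theorem integral_sq_gaussianReal : ∫ x, x ^ 2 ∂(gaussianReal 0 1) = 1 := by
  have h := variance_id_gaussianReal (μ := 0) (v := 1)
  rw [variance_eq_sub (memLp_id_gaussianReal 2)] at h
  simpa using h

/-- The law of `(ζ² - 1) / 2` for a standard normal variable `ζ`. -/
noncomputable def chiLaw : Measure ℝ := (gaussianReal 0 1).map fun x => (x ^ 2 - 1) / 2

theorem integrable_pow_four_gaussianReal : Integrable (fun x : ℝ => x ^ 4) (gaussianReal 0 1) := by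
  have := (memLp_id_gaussianReal (μ := 0) (v := 1) 4).integrable_norm_pow (p := 4) (by norm_num)
  refine this.congr (ae_of_all _ fun x => ?_)
  simp [Even.pow_abs (by decide : Even 4)]

theorem memLp_two_sq_gaussianReal : MemLp (fun x : ℝ => x ^ 2) 2 (gaussianReal 0 1) := by
  rw [memLp_two_iff_integrable_sq (by fun_prop)]
  refine integrable_pow_four_gaussianReal.congr (ae_of_all _ fun x => ?_)
  simp only
  ring

theorem memLp_chi : MemLp (fun x : ℝ => (x ^ 2 - 1) / 2) 2 (gaussianReal 0 1) := by
  have := (memLp_two_sq_gaussianReal.sub (memLp_const 1)).const_mul (1 / 2)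
  refine this.ae_eq (ae_of_all _ fun x => ?_)
  simp only [Pi.sub_apply]
  ring

theorem integral_chi : ∫ x, (x ^ 2 - 1) / 2 ∂(gaussianReal 0 1) = 0 := by
  rw [integral_div, integral_sub (memLp_two_sq_gaussianReal.integrable (by norm_num))
    (integrable_const _), integral_sq_gaussianReal]
  simp

theorem integral_chi_sq : ∫ x, ((x ^ 2 - 1) / 2) ^ 2 ∂(gaussianReal 0 1) = 1 / 2 := by
  have e : ∀ x : ℝ, ((x ^ 2 - 1) / 2) ^ 2 = (x ^ 4 - 2 * x ^ 2 + 1) / 4 := fun x => by ring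
  have h2 := memLp_two_sq_gaussianReal.integrable (by norm_num)
  simp only [e]
  have h4 : Integrable (fun x : ℝ => x ^ 4 - 2 * x ^ 2) (gaussianReal 0 1) :=
    integrable_pow_four_gaussianReal.sub (h2.const_mul 2)
  rw [integral_div, integral_add h4 (integrable_const _), integral_sub integrable_pow_four_gaussianReal (h2.const_mul 2),
    integral_const_mul, integral_sq_gaussianReal, integral_pow_four_gaussianReal]
  norm_num

/-- A Gaussian integral with complex parameter. Only the modulus is computed, which avoids choosing
a branch of the square root of `1 - i s`. -/
theorem norm_charFun_chiLaw_sq (s : ℝ) : ‖charFun chiLaw s‖ ^ 2 = 1 / √(1 + s ^ 2) := by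
  have hpi := Real.pi_pos
  have hc : charFun chiLaw s = ((√(2 * Real.pi))⁻¹ : ℝ) * Complex.exp ((-(s / 2) : ℝ) * Complex.I) *
      (Real.pi / ((1 - s * Complex.I) / 2)) ^ ((1 / 2 : ℝ) : ℂ) := by
    rw [chiLaw, charFun_apply_real, integral_map (by fun_prop) (by fun_prop),
      integral_gaussianReal_eq_integral_smul (by norm_num : (1 : ℝ≥0) ≠ 0)]
    have e : ∀ x : ℝ, gaussianPDFReal 0 1 x •
        Complex.exp (s * ((x ^ 2 - 1) / 2 : ℝ) * Complex.I) =
        ((√(2 * Real.pi))⁻¹ : ℝ) * Complex.exp ((-(s / 2) : ℝ) * Complex.I) *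
          Complex.exp (-((1 - s * Complex.I) / 2) * (x : ℂ) ^ 2) := by
      intro x
      have h1 : Complex.exp ((-(s / 2) : ℝ) * Complex.I) *
          Complex.exp (-((1 - s * Complex.I) / 2) * (x : ℂ) ^ 2) =
          Complex.exp ((-x ^ 2 / 2 : ℝ)) * Complex.exp (s * ((x ^ 2 - 1) / 2 : ℝ) * Complex.I) := by
        rw [← Complex.exp_add, ← Complex.exp_add]
        congr 1
        push_cast
        ring
      rw [mul_assoc (((√(2 * Real.pi))⁻¹ : ℝ) : ℂ), h1, gaussianPDFReal]
      simp only [NNReal.coe_one, mul_one, sub_zero, Complex.real_smul]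
      push_cast
      ring
    simp only [e]
    rw [integral_const_mul, integral_gaussian_complex (by simp)]
    congr 2
    push_cast
    rfl
  have hn : ‖(1 - s * Complex.I : ℂ)‖ = √(1 + s ^ 2) := by
    have := Complex.norm_add_mul_I 1 (-s)
    simpa [sub_eq_add_neg] using this
  have hpos : 0 < √(1 + s ^ 2) := Real.sqrt_pos.2 (by positivity)
  rw [hc, norm_mul, norm_mul, Complex.norm_exp_ofReal_mul_I, Complex.norm_cpow_real, mul_pow, mul_pow,
    ← Real.sqrt_eq_rpow, Real.sq_sqrt (norm_nonneg _), norm_div, norm_div, hn, Complex.norm_real,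
    Complex.norm_real, norm_inv, inv_pow, Real.norm_of_nonneg (Real.sqrt_nonneg _),
    Real.sq_sqrt (by positivity), Real.norm_of_nonneg hpi.le]
  simp only [Complex.norm_ofNat, one_pow, mul_one]
  field_simp

/-- The two factors are conjugate, so the product is a squared modulus. Opposite eigenvalues will be
paired in this way. -/
theorem charFun_chiLaw_mul_neg (s : ℝ) :
    charFun chiLaw s * charFun chiLaw (-s) = ((1 / √(1 + s ^ 2) : ℝ) : ℂ) := by
  rw [charFun_neg, Complex.mul_conj, Complex.normSq_eq_norm_sq, norm_charFun_chiLaw_sq]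

/-! ### The limit variables -/

theorem exists_l2Sum_of_law (ι : Type) (ρ : Measure ℝ) [IsProbabilityMeasure ρ] (hρ : MemLp id 2 ρ)
    (h0 : ∫ x, x ∂ρ = 0) {v : ℝ} (hv : 0 < v) (hvar : ∫ x, x ^ 2 ∂ρ = v)
    {lam : ι → ℝ} {c : ℝ} (hl : HasSum (fun r => lam r ^ 2) c) :
    ∃ (Ω' : Type) (_ : MeasurableSpace Ω') (P' : Measure Ω') (_ : IsProbabilityMeasure P')
      (Z : ι → Ω' → ℝ) (W : Ω' → ℝ), (∀ r, HasLaw (Z r) ρ P') ∧ iIndepFun Z P' ∧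
      IsL2Sum P' (fun r ω => lam r * Z r ω) W ∧ Var[W; P'] = v * c ∧
      ∀ t : ℝ, HasProd (fun r => charFun ρ (lam r * t)) (charFun (P'.map W) t) := by
  obtain ⟨Ω', _, P', Z, hm, hlaw, hind, hP⟩ := exists_iid ι ρ
  have hmp : ∀ r, MeasurePreserving (Z r) P' ρ := fun r => ⟨hm r, (hlaw r).map_eq⟩
  have hint : ∀ (F : ℝ → ℝ) (_ : Measurable F) (r : ι), ∫ ω, F (Z r ω) ∂P' = ∫ x, F x ∂ρ := by
    intro F hF r
    rw [← (hlaw r).map_eq, integral_map (hm r).aemeasurable hF.aestronglyMeasurable]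
  obtain ⟨W, h1, h2, h3⟩ := exists_l2Sum (fun r => hρ.comp_measurePreserving (hmp r)) hind
    (fun r => (hint id measurable_id r).trans h0) hv
    (fun r => (hint (fun x => x ^ 2) (by fun_prop) r).trans hvar) hl
  exact ⟨Ω', _, P', hP, Z, W, hlaw, hind, h1, h2, fun t => by
    simpa only [Function.id_comp, (hlaw _).map_eq] using h3 t⟩

theorem exists_gaussian_l2Sum (ι : Type) {lam : ι → ℝ} {c : ℝ}
    (hl : HasSum (fun r => lam r ^ 2) c) :
    ∃ (Ω' : Type) (_ : MeasurableSpace Ω') (P' : Measure Ω') (_ : IsProbabilityMeasure P')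
      (ζ : ι → Ω' → ℝ) (W : Ω' → ℝ), iIndepFun ζ P' ∧ (∀ r, HasLaw (ζ r) (gaussianReal 0 1) P') ∧
      IsL2Sum P' (fun r ω => (1 / 2) * lam r * (ζ r ω ^ 2 - 1)) W ∧ Var[W; P'] = (1 / 2) * c ∧
      ∀ t : ℝ, HasProd (fun r => charFun chiLaw (lam r * t)) (charFun (P'.map W) t) := by
  obtain ⟨Ω', _, P', Z, hm, hlaw, hind, hP⟩ := exists_iid ι (gaussianReal 0 1)
  have hmp : ∀ r, MeasurePreserving (Z r) P' (gaussianReal 0 1) :=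
    fun r => ⟨hm r, (hlaw r).map_eq⟩
  have hint : ∀ (F : ℝ → ℝ) (_ : Measurable F) (r : ι),
      ∫ ω, F (Z r ω) ∂P' = ∫ x, F x ∂(gaussianReal 0 1) := by
    intro F hF r
    rw [← (hlaw r).map_eq, integral_map (hm r).aemeasurable hF.aestronglyMeasurable]
  have hch : Measurable fun x : ℝ => (x ^ 2 - 1) / 2 := by fun_prop
  obtain ⟨W, h1, h2, h3⟩ := exists_l2Sum (Z := fun r ω => (Z r ω ^ 2 - 1) / 2)
    (fun r => memLp_chi.comp_measurePreserving (hmp r)) (hind.comp _ fun _ => hch)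
    (fun r => (hint _ hch r).trans integral_chi) (by norm_num : (0 : ℝ) < 1 / 2)
    (fun r => (hint _ (hch.pow_const 2) r).trans integral_chi_sq) hl
  have e : (fun r ω => (1 / 2) * lam r * (Z r ω ^ 2 - 1)) =
      fun r ω => lam r * ((Z r ω ^ 2 - 1) / 2) := by
    ext r ω
    ring
  have e2 : ∀ r, P'.map (fun ω => (Z r ω ^ 2 - 1) / 2) = chiLaw := by
    intro r
    rw [chiLaw, ← (hlaw r).map_eq, Measure.map_map hch (hm r)]
    rfl
  exact ⟨Ω', _, P', hP, Z, W, hind, hlaw, by rwa [e], h2, fun t => by simpa only [e2] using h3 t⟩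


/-! ### The limit of a degenerate symmetric statistic -/

theorem sum_ltPairs_mul (m : ℕ) (a : ℕ → ℝ) :
    ∑ p ∈ ltPairs m, a p.1 * a p.2 =
      ((∑ k ∈ Finset.range m, a k) ^ 2 - ∑ k ∈ Finset.range m, a k ^ 2) / 2 := by
  rw [sum_ltPairs m fun i j => a i * a j]
  induction m with
  | zero => simp
  | succ m ih =>
    rw [Finset.sum_range_succ, ih, Finset.sum_range_succ (fun k => a k),
      Finset.sum_range_succ (fun k => a k ^ 2), ← Finset.sum_mul]
    ring

section Symmetric

variable {Ω E : Type*} [MeasurableSpace Ω] [MeasurableSpace E] {P : Measure Ω}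
  [IsProbabilityMeasure P] {π : Measure E} [IsProbabilityMeasure π] {Y : ℕ → Ω → E}

theorem measurable_coeFn_Lp (φ : Lp ℝ 2 π) : Measurable (φ : E → ℝ) :=
  (Lp.stronglyMeasurable φ).measurable

theorem integral_sum_mul_sq {ι : Type*} {φ : ι → Lp ℝ 2 π} (hφ : Orthonormal ℝ φ) (s : Finset ι)
    (θ : ι → ℝ) : ∫ x, (∑ r ∈ s, θ r * φ r x) ^ 2 ∂π = ∑ r ∈ s, θ r ^ 2 := by
  classical
  have hin : ∀ r q, ∫ x, φ r x * φ q x ∂π = if r = q then 1 else 0 := by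
    intro r q
    rw [← orthonormal_iff_ite.1 hφ r q, L2.inner_def]
    simp [mul_comm]
  rw [integral_sq_sum_of_orthogonal s (fun r x => θ r * φ r x)
    (fun r _ => (Lp.memLp (φ r)).const_mul _)]
  · refine Finset.sum_congr rfl fun r _ => ?_
    have := hin r r
    simp only [mul_pow]
    rw [integral_const_mul]
    simp only [sq (φ r _), this, if_true, mul_one]
  · intro r _ q _ hrq
    have e : ∀ x, θ r * φ r x * (θ q * φ q x) = θ r * θ q * (φ r x * φ q x) := fun x => by ring
    simp only [e]
    rw [integral_const_mul, hin, if_neg hrq, mul_zero]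

theorem tendsto_inv_sqrt : Tendsto (fun n : ℕ => (√(n : ℝ))⁻¹) atTop (𝓝 0) :=
  tendsto_inv_atTop_zero.comp (Real.tendsto_sqrt_atTop.comp tendsto_natCast_atTop_atTop)

/-- The normalized vector of sums of `φ r (Y k)`. -/
noncomputable def normalizedSum {κ : Type*} [Fintype κ] (φ : κ → Lp ℝ 2 π) (Y : ℕ → Ω → E) (m : ℕ)
    (ω : Ω) : EuclideanSpace ℝ κ :=
  WithLp.toLp 2 fun r => (√(m : ℝ))⁻¹ * ∑ k ∈ Finset.range m, φ r (Y k ω)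

/-- The standard Gaussian measure on a Euclidean space. -/
noncomputable def stdGaussianVec (κ : Type*) [Fintype κ] : Measure (EuclideanSpace ℝ κ) :=
  (Measure.pi fun _ : κ => gaussianReal 0 1).map (WithLp.toLp 2)

instance (κ : Type*) [Fintype κ] : IsProbabilityMeasure (stdGaussianVec κ) :=
  Measure.isProbabilityMeasure_map (WithLp.measurable_toLp 2 _).aemeasurable

theorem charFun_stdGaussianVec {κ : Type*} [Fintype κ] (θ : EuclideanSpace ℝ κ) :
    charFun (stdGaussianVec κ) θ = Complex.exp (-((∑ r, θ r ^ 2) / 2 : ℝ)) := by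
  rw [stdGaussianVec, charFun_pi]
  simp only [charFun_gaussianReal]
  rw [← Complex.exp_sum]
  congr 1
  push_cast
  rw [Finset.sum_div, ← Finset.sum_neg_distrib]
  refine Finset.sum_congr rfl fun r _ => ?_
  simp

theorem IsIID.measurable_normalizedSum (hY : IsIID P π Y) {κ : Type*} [Fintype κ]
    (φ : κ → Lp ℝ 2 π) (m : ℕ) : Measurable (normalizedSum φ Y m) := by
  refine (WithLp.measurable_toLp 2 _).comp (measurable_pi_lambda _ fun r => ?_)
  exact (Finset.measurable_fun_sum _ fun k _ =>
    (measurable_coeFn_Lp _).comp (hY.meas k)).const_mul _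

theorem IsIID.tendsto_charFun_normalizedSum (hY : IsIID P π Y) {κ : Type*} [Fintype κ]
    {φ : κ → Lp ℝ 2 π} (hφ : Orthonormal ℝ φ) (h0 : ∀ r, ∫ x, φ r x ∂π = 0)
    (θ : EuclideanSpace ℝ κ) :
    Tendsto (fun m : ℕ => charFun (P.map (normalizedSum φ Y m)) θ) atTop
      (𝓝 (charFun (stdGaussianVec κ) θ)) := by
  have hg : Measurable fun x => ∑ r, θ r * φ r x :=
    Finset.measurable_fun_sum _ fun r _ => (measurable_coeFn_Lp _).const_mul _
  have hg2 : MemLp (fun x => ∑ r, θ r * φ r x) 2 π :=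
    memLp_finsetSum _ fun r _ => (Lp.memLp (φ r)).const_mul _
  have hg0 : ∫ x, ∑ r, θ r * φ r x ∂π = 0 := by
    rw [integral_finsetSum _ fun r _ =>
      ((Lp.memLp (φ r)).integrable (by norm_num)).const_mul _]
    simp [integral_const_mul, h0]
  have hclt := hY.tendsto_charFun_weighted_sum hg hg2 hg0 (fun n _ => (√(n : ℝ))⁻¹)
    (fun n => (√(n : ℝ))⁻¹) (fun n i _ => by rw [abs_of_nonneg (by positivity)])
    tendsto_inv_sqrt (A := 1) (by
      refine tendsto_const_nhds.congr' ?_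
      filter_upwards [eventually_gt_atTop 0] with n hn
      have : (n : ℝ) ≠ 0 := by positivity
      simp [this]) 1
  rw [integral_sum_mul_sq hφ Finset.univ] at hclt
  rw [charFun_stdGaussianVec]
  simp only [one_mul, one_pow, mul_one] at hclt
  refine hclt.congr fun m => ?_
  have hms : Measurable fun ω => ∑ i ∈ Finset.range m, (√(m : ℝ))⁻¹ * ∑ r, θ r * φ r (Y i ω) :=
    Finset.measurable_fun_sum _ fun k _ => (hg.comp (hY.meas k)).const_mul _
  rw [charFun_map_eq hms.aemeasurable, charFun_apply,
    integral_map (hY.measurable_normalizedSum φ m).aemeasurable (by fun_prop)]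
  refine integral_congr_ae (ae_of_all _ fun ω => ?_)
  have e : inner ℝ (normalizedSum φ Y m ω) θ =
      ∑ i ∈ Finset.range m, (√(m : ℝ))⁻¹ * ∑ r, θ r * φ r (Y i ω) := by
    rw [PiLp.inner_apply]
    simp only [normalizedSum, RCLike.inner_apply, conj_trivial, Finset.mul_sum]
    rw [Finset.sum_comm]
    exact Finset.sum_congr rfl fun r _ => Finset.sum_congr rfl fun k _ => by ring
  simp only [e, Complex.ofReal_one, one_mul]

/-- A diagonal quadratic form, centred under the standard Gaussian measure. -/
noncomputable def diagForm {κ : Type*} [Fintype κ] (lam : κ → ℝ) (x : EuclideanSpace ℝ κ) : ℝ :=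
  ∑ r, lam r * ((x r ^ 2 - 1) / 2)

theorem continuous_diagForm {κ : Type*} [Fintype κ] (lam : κ → ℝ) : Continuous (diagForm lam) := by
  unfold diagForm
  fun_prop

theorem charFun_diagForm {κ : Type*} [Fintype κ] (lam : κ → ℝ) (t : ℝ) :
    ∫ x, Complex.exp (t * diagForm lam x * Complex.I) ∂(stdGaussianVec κ) =
      ∏ r, charFun chiLaw (lam r * t) := by
  have h3 : ∀ r, charFun chiLaw (lam r * t) = ∫ x : ℝ,
      Complex.exp (t * (lam r * ((x ^ 2 - 1) / 2)) * Complex.I) ∂(gaussianReal 0 1) := by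
    intro r
    rw [chiLaw, charFun_apply_real, integral_map (by fun_prop) (by fun_prop)]
    refine integral_congr_ae (ae_of_all _ fun x => ?_)
    push_cast
    ring_nf
  simp only [h3]
  have hc := continuous_diagForm lam
  rw [← integral_fintype_prod_eq_prod, stdGaussianVec,
    integral_map (WithLp.measurable_toLp 2 _).aemeasurable (by fun_prop)]
  refine integral_congr_ae (ae_of_all _ fun x => ?_)
  simp only [diagForm]
  rw [← Complex.exp_sum]
  congr 1
  push_cast
  rw [Finset.mul_sum, Finset.sum_mul]

/-- The multivariate central limit theorem tested on a quadratic exponential. -/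
theorem IsIID.tendsto_charFun_quadratic (hY : IsIID P π Y) {κ : Type*} [Fintype κ]
    {φ : κ → Lp ℝ 2 π} (hφ : Orthonormal ℝ φ) (h0 : ∀ r, ∫ x, φ r x ∂π = 0) (lam : κ → ℝ) (t : ℝ) :
    Tendsto (fun m : ℕ => charFun (P.map fun ω => diagForm lam (normalizedSum φ Y m ω)) t) atTop
      (𝓝 (∏ r, charFun chiLaw (lam r * t))) := by
  have hV := hY.measurable_normalizedSum φ
  let μ : ℕ → ProbabilityMeasure (EuclideanSpace ℝ κ) := fun m =>
    ⟨P.map (normalizedSum φ Y m), Measure.isProbabilityMeasure_map (hV m).aemeasurable⟩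
  have hconv : Tendsto μ atTop (𝓝 ⟨stdGaussianVec κ, inferInstance⟩) :=
    ProbabilityMeasure.tendsto_iff_tendsto_charFun.2 fun θ =>
      hY.tendsto_charFun_normalizedSum hφ h0 θ
  have hq := continuous_diagForm lam
  let F : BoundedContinuousFunction (EuclideanSpace ℝ κ) ℂ :=
    BoundedContinuousFunction.ofNormedAddCommGroup
      (fun x => Complex.exp (t * diagForm lam x * Complex.I)) (by fun_prop) 1 (fun x => by
        rw [← Complex.ofReal_mul, Complex.norm_exp_ofReal_mul_I])
  have h1 := (ProbabilityMeasure.tendsto_iff_forall_integral_rclike_tendsto ℂ).1 hconv F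
  rw [← charFun_diagForm]
  refine h1.congr fun m => ?_
  have hm : Measurable fun ω => diagForm lam (normalizedSum φ Y m ω) :=
    hq.measurable.comp (hV m)
  rw [charFun_map_eq hm.aemeasurable]
  exact integral_map (hV m).aemeasurable (by fun_prop)

theorem IsIID.ae_tendsto_average (hY : IsIID P π Y) {g : E → ℝ} (hg : Measurable g)
    (hi : Integrable g π) :
    ∀ᵐ ω ∂P, Tendsto (fun m : ℕ => (∑ k ∈ Finset.range m, g (Y k ω)) / m) atTop
      (𝓝 (∫ x, g x ∂π)) := by
  have h := strong_law_ae_real (fun k ω => g (Y k ω)) (μ := P)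
    ((hY.measurePreserving 0).integrable_comp_of_integrable hi)
    (fun i j hij => (hY.indep.indepFun hij).comp hg hg)
    (fun k => IdentDistrib.comp ⟨(hY.meas k).aemeasurable, (hY.meas 0).aemeasurable,
      by rw [hY.law, hY.law]⟩ hg)
  have e : ∫ ω, g (Y 0 ω) ∂P = ∫ x, g x ∂π := by
    rw [← hY.law 0, integral_map (hY.meas 0).aemeasurable hg.aestronglyMeasurable]
  rwa [e] at h

/-- For each `φ r`, the sum over pairs is half the square of the sum minus half the sum of squares.
By the strong law the mean square tends to 1, so the statistic differs from `diagForm` of the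
normalized sums by a sequence tending to zero almost surely; dominated convergence transfers the
limit. -/
theorem IsIID.tendsto_charFun_finite_rank (hY : IsIID P π Y) {κ : Type*} [Fintype κ]
    {φ : κ → Lp ℝ 2 π} (hφ : Orthonormal ℝ φ) (h0 : ∀ r, ∫ x, φ r x ∂π = 0) (lam : κ → ℝ) (t : ℝ) :
    Tendsto (fun m : ℕ => charFun (P.map fun ω =>
        (m : ℝ)⁻¹ * ∑ p ∈ ltPairs m, ∑ r, lam r * (φ r (Y p.1 ω) * φ r (Y p.2 ω))) t) atTop
      (𝓝 (∏ r, charFun chiLaw (lam r * t))) := by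
  have hm : ∀ r k, Measurable fun ω => φ r (Y k ω) :=
    fun r k => (measurable_coeFn_Lp _).comp (hY.meas k)
  have hZ : ∀ m : ℕ, Measurable fun ω =>
      (m : ℝ)⁻¹ * ∑ p ∈ ltPairs m, ∑ r, lam r * (φ r (Y p.1 ω) * φ r (Y p.2 ω)) := fun m =>
    (Finset.measurable_fun_sum _ fun p _ => Finset.measurable_fun_sum _ fun r _ =>
      ((hm r p.1).mul (hm r p.2)).const_mul _).const_mul _
  have hZ' : ∀ m : ℕ, Measurable fun ω =>
      ∑ r, lam r * ((((√(m : ℝ))⁻¹ * ∑ k ∈ Finset.range m, φ r (Y k ω)) ^ 2 - 1) / 2) := fun m =>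
    Finset.measurable_fun_sum _ fun r _ =>
      (((((Finset.measurable_fun_sum _ fun k _ => hm r k).const_mul _).pow_const 2).sub_const
        1).div_const 2).const_mul _
  have hlim := hY.tendsto_charFun_quadratic hφ h0 lam t
  simp only [diagForm, normalizedSum] at hlim
  have hdiff : ∀ᵐ ω ∂P, Tendsto (fun m : ℕ =>
      (m : ℝ)⁻¹ * ∑ p ∈ ltPairs m, ∑ r, lam r * (φ r (Y p.1 ω) * φ r (Y p.2 ω)) -
      ∑ r, lam r * ((((√(m : ℝ))⁻¹ * ∑ k ∈ Finset.range m, φ r (Y k ω)) ^ 2 - 1) / 2)) atTop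
      (𝓝 0) := by
    have h1 : ∀ᵐ ω ∂P, ∀ r, Tendsto (fun m : ℕ => (∑ k ∈ Finset.range m, φ r (Y k ω) ^ 2) / m) atTop
        (𝓝 1) := by
      rw [ae_all_iff]
      intro r
      have := hY.ae_tendsto_average ((measurable_coeFn_Lp (φ r)).pow_const 2)
        (Lp.memLp (φ r)).integrable_sq
      have e : ∫ x, φ r x ^ 2 ∂π = 1 := by
        have := real_inner_self_eq_norm_sq (φ r)
        rw [hφ.1 r, L2.inner_def] at this
        simpa [sq] using this
      rwa [e] at this
    filter_upwards [h1] with ω hω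
    have h2 : Tendsto (fun m : ℕ => ∑ r, lam r / 2 *
        (1 - (∑ k ∈ Finset.range m, φ r (Y k ω) ^ 2) / m)) atTop (𝓝 0) := by
      have := tendsto_finsetSum Finset.univ fun r _ =>
        ((tendsto_const_nhds (x := (1 : ℝ))).sub (hω r)).const_mul (lam r / 2)
      simpa using this
    refine h2.congr' ?_
    filter_upwards [eventually_gt_atTop 0] with m hm0
    have hm1 : (m : ℝ) ≠ 0 := by positivity
    rw [Finset.sum_comm, Finset.mul_sum, ← Finset.sum_sub_distrib]
    refine Finset.sum_congr rfl fun r _ => ?_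
    rw [← Finset.mul_sum, sum_ltPairs_mul m fun k => φ r (Y k ω), mul_pow, inv_pow,
      Real.sq_sqrt (Nat.cast_nonneg m)]
    field_simp
    ring
  have h3 : Tendsto (fun m : ℕ => charFun (P.map fun ω =>
        (m : ℝ)⁻¹ * ∑ p ∈ ltPairs m, ∑ r, lam r * (φ r (Y p.1 ω) * φ r (Y p.2 ω))) t -
      charFun (P.map fun ω =>
        ∑ r, lam r * ((((√(m : ℝ))⁻¹ * ∑ k ∈ Finset.range m, φ r (Y k ω)) ^ 2 - 1) / 2)) t) atTop
      (𝓝 0) := by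
    have e : ∀ m : ℕ, charFun (P.map fun ω =>
        (m : ℝ)⁻¹ * ∑ p ∈ ltPairs m, ∑ r, lam r * (φ r (Y p.1 ω) * φ r (Y p.2 ω))) t -
      charFun (P.map fun ω =>
        ∑ r, lam r * ((((√(m : ℝ))⁻¹ * ∑ k ∈ Finset.range m, φ r (Y k ω)) ^ 2 - 1) / 2)) t =
      ∫ ω, (Complex.exp (t * ((m : ℝ)⁻¹ * ∑ p ∈ ltPairs m,
          ∑ r, lam r * (φ r (Y p.1 ω) * φ r (Y p.2 ω)) : ℝ) * Complex.I) -
        Complex.exp (t * (∑ r, lam r * ((((√(m : ℝ))⁻¹ *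
          ∑ k ∈ Finset.range m, φ r (Y k ω)) ^ 2 - 1) / 2) : ℝ) * Complex.I)) ∂P := by
      intro m
      rw [integral_sub (integrable_cexp (hZ m).aemeasurable t)
        (integrable_cexp (hZ' m).aemeasurable t), charFun_map_eq (hZ m).aemeasurable,
        charFun_map_eq (hZ' m).aemeasurable]
    simp only [e]
    rw [← integral_zero Ω ℂ (μ := P)]
    refine tendsto_integral_of_dominated_convergence (fun _ => 2)
      (fun m => ((integrable_cexp (hZ m).aemeasurable t).sub
        (integrable_cexp (hZ' m).aemeasurable t)).1) (integrable_const _)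
      (fun m => ae_of_all _ fun ω => ?_) ?_
    · refine (norm_sub_le _ _).trans ?_
      rw [← Complex.ofReal_mul, ← Complex.ofReal_mul, Complex.norm_exp_ofReal_mul_I,
        Complex.norm_exp_ofReal_mul_I]
      norm_num
    · filter_upwards [hdiff] with ω hω
      refine squeeze_zero_norm (fun m => ?_) (by simpa using (hω.abs).const_mul |t|)
      rw [← Complex.ofReal_mul, ← Complex.ofReal_mul]
      refine (norm_cexp_sub_le _ _).trans ?_
      rw [← mul_sub, abs_mul]
  simpa using h3.add hlim

theorem IsDegenerate.sub {f g : E → E → ℝ} (hf : IsDegenerate π f) (hg : IsDegenerate π g) :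
    IsDegenerate π fun x y => f x y - g x y where
  meas := hf.meas.sub hg.meas
  memLp := hf.memLp.sub hg.memLp
  left := by
    have h1 := (hf.memLp.integrable (by norm_num)).prod_left_ae
    have h2 := (hg.memLp.integrable (by norm_num)).prod_left_ae
    filter_upwards [hf.left, hg.left, h1, h2] with y e1 e2 i1 i2
    rw [integral_sub i1 i2, e1, e2, sub_zero]
  right := by
    have h1 := (hf.memLp.integrable (by norm_num)).prod_right_ae
    have h2 := (hg.memLp.integrable (by norm_num)).prod_right_ae
    filter_upwards [hf.right, hg.right, h1, h2] with y e1 e2 i1 i2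
    rw [integral_sub i1 i2, e1, e2, sub_zero]

theorem isDegenerate_sum_mul {ι : Type*} (s : Finset ι) (φ : ι → Lp ℝ 2 π)
    (h0 : ∀ r, ∫ x, φ r x ∂π = 0) (lam : ι → ℝ) :
    IsDegenerate π fun x y => ∑ r ∈ s, lam r * (φ r x * φ r y) where
  meas := Finset.measurable_fun_sum _ fun r _ =>
    (((measurable_coeFn_Lp _).comp measurable_fst).mul
      ((measurable_coeFn_Lp _).comp measurable_snd)).const_mul _
  memLp := memLp_finsetSum _ fun r _ =>
    (memLp_two_mul_prod (Lp.memLp (φ r)) (Lp.memLp (φ r))).const_mul _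
  left := ae_of_all _ fun y => by
    rw [integral_finsetSum _ fun r _ =>
      (((Lp.memLp (φ r)).integrable (by norm_num)).mul_const _).const_mul _]
    simp [integral_const_mul, integral_mul_const, h0]
  right := ae_of_all _ fun y => by
    rw [integral_finsetSum _ fun r _ =>
      (((Lp.memLp (φ r)).integrable (by norm_num)).const_mul _).const_mul _]
    simp [integral_const_mul, h0]

theorem kernelNormSq_eq_norm_sq {f : E → E → ℝ}
    (hf : MemLp (fun p : E × E => f p.1 p.2) 2 (π.prod π)) :
    kernelNormSq π f = ‖hf.toLp _‖ ^ 2 := by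
  rw [← real_inner_self_eq_norm_sq, L2.inner_def, kernelNormSq]
  refine integral_congr_ae ?_
  filter_upwards [hf.coeFn_toLp] with p hp
  rw [hp]
  simp [sq]

/-- The limit law of a degenerate statistic, in terms of an expansion of its kernel. -/
theorem IsIID.tendsto_charFun_symmetric (hY : IsIID P π Y) {h : E → E → ℝ} (hh : IsDegenerate π h)
    {ι : Type} {φ : ι → Lp ℝ 2 π} (hφ : Orthonormal ℝ φ) (h0 : ∀ r, ∫ x, φ r x ∂π = 0)
    {lam : ι → ℝ} (hsum : HasSum (fun r => lam r • tmul (φ r) (φ r)) (hh.memLp.toLp _)) (t : ℝ) :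
    ∃ L, HasProd (fun r => charFun chiLaw (lam r * t)) L ∧
      Tendsto (fun m : ℕ => charFun (P.map fun ω =>
        (m : ℝ)⁻¹ * ∑ p ∈ ltPairs m, h (Y p.1 ω) (Y p.2 ω)) t) atTop (𝓝 L) := by
  classical
  have hort : Orthonormal ℝ fun r => tmul (φ r) (φ r) := by
    have := orthonormal_tmul_star hφ
    simpa using this
  have hsq := hasSum_norm_sq_of_orthonormal hort hsum
  simp only [Real.norm_eq_abs, sq_abs] at hsq
  -- The Gaussian sum is used here only for the convergence of the infinite product.
  obtain ⟨Ω', _, P', _, ζ, W, -, -, -, -, hprod⟩ := exists_gaussian_l2Sum ι hsq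
  refine ⟨_, hprod t, ?_⟩
  let hs : Finset ι → E → E → ℝ := fun s x y => ∑ r ∈ s, lam r * (φ r x * φ r y)
  have hsd : ∀ s, IsDegenerate π (hs s) := fun s => isDegenerate_sum_mul s φ h0 lam
  have hmem : ∀ {k : E → E → ℝ} (_ : IsDegenerate π k) (m : ℕ),
      MemLp (fun ω => (m : ℝ)⁻¹ * ∑ p ∈ ltPairs m, k (Y p.1 ω) (Y p.2 ω)) 2 P := fun hk m =>
    (memLp_finsetSum _ fun p hp => hY.memLp_pair (lt_of_mem_ltPairs hp).ne hk.memLp).const_mul _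
  refine tendsto_charFun_of_approx (l := atTop) (fun m => hmem hh m)
    (Z' := fun s m ω => (m : ℝ)⁻¹ * ∑ p ∈ ltPairs m, hs s (Y p.1 ω) (Y p.2 ω))
    (fun s m => hmem (hsd s) m) (δ := fun s => kernelNormSq π fun x y => h x y - hs s x y)
    ?_ ?_ (Φ := fun s => ∏ r ∈ s, charFun chiLaw (lam r * t)) ?_ ?_
  · have h1 : ∀ s, kernelNormSq π (fun x y => h x y - hs s x y) =
        ‖∑ r ∈ s, lam r • tmul (φ r) (φ r) - hh.memLp.toLp _‖ ^ 2 := by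
      intro s
      have e : (hsd s).memLp.toLp _ = ∑ r ∈ s, lam r • tmul (φ r) (φ r) := by
        have e1 : ∀ s : Finset ι, (∑ r ∈ s, lam r • tmul (φ r) (φ r) : Lp ℝ 2 (π.prod π))
            =ᵐ[π.prod π] fun p => hs s p.1 p.2 := by
          intro s
          induction s using Finset.induction_on with
          | empty => simp only [Finset.sum_empty, hs]; exact Lp.coeFn_zero _ _ _
          | insert i s hi ih =>
            rw [Finset.sum_insert hi]
            filter_upwards [Lp.coeFn_add (lam i • tmul (φ i) (φ i))
              (∑ r ∈ s, lam r • tmul (φ r) (φ r)), ih, Lp.coeFn_smul (lam i) (tmul (φ i) (φ i)),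
              coeFn_tmul (φ i) (φ i)] with p h1 h2 h3 h4
            rw [h1, Pi.add_apply, h2, h3, Pi.smul_apply, h4]
            simp only [hs, Finset.sum_insert hi, smul_eq_mul]
        refine Lp.ext ((hsd s).memLp.coeFn_toLp.trans (e1 s).symm)
      rw [kernelNormSq_eq_norm_sq (hh.sub (hsd s)).memLp, norm_sub_rev, ← e]
      rfl
    simp only [h1]
    have := (tendsto_iff_norm_sub_tendsto_zero.1 hsum).pow 2
    simpa using this
  -- Orthogonality of distinct pairs bounds the truncation error by the number of pairs over `m²`,
  -- at most 1, times the squared norm of the discarded kernel: uniformly in `m`.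
  · intro s
    refine Eventually.of_forall fun m => ?_
    have e : ∀ ω, (m : ℝ)⁻¹ * ∑ p ∈ ltPairs m, h (Y p.1 ω) (Y p.2 ω) -
        (m : ℝ)⁻¹ * ∑ p ∈ ltPairs m, hs s (Y p.1 ω) (Y p.2 ω) =
        ∑ p ∈ ltPairs m, (m : ℝ)⁻¹ * (h (Y p.1 ω) (Y p.2 ω) - hs s (Y p.1 ω) (Y p.2 ω)) := by
      intro ω
      rw [← mul_sub, ← Finset.sum_sub_distrib, Finset.mul_sum]
    simp only [e]
    rw [hY.integral_sq_sum (hh.sub (hsd s)) _ (fun p hp => lt_of_mem_ltPairs hp)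
      (fun _ => (m : ℝ)⁻¹), Finset.sum_const, nsmul_eq_mul, card_ltPairs]
    refine mul_le_of_le_one_left (kernelNormSq_nonneg _ _) ?_
    rcases Nat.eq_zero_or_pos m with rfl | hm
    · simp
    · have hm' : (1 : ℝ) ≤ m := by exact_mod_cast hm
      rw [inv_pow, ← div_eq_mul_inv, div_le_one (by positivity)]
      nlinarith
  · intro s
    have h1 := hY.tendsto_charFun_finite_rank (κ := s) (φ := fun r => φ r)
      (hφ.comp _ Subtype.val_injective) (fun r => h0 r) (fun r => lam r) t
    rw [Finset.prod_coe_sort s fun r => charFun chiLaw (lam r * t)] at h1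
    refine h1.congr fun m => ?_
    congr 2
    ext ω
    congr 1
    exact Finset.sum_congr rfl fun p _ =>
      Finset.sum_coe_sort s fun r => lam r * (φ r (Y p.1 ω) * φ r (Y p.2 ω))
  · have := hprod t
    rwa [HasProd, SummationFilter.unconditional_filter] at this

end Symmetric


/-! ### Kernels on `S × [0,1]` -/

section HatKernel

variable {S : Type*} [MeasurableSpace S] {ν : Measure S} [IsProbabilityMeasure ν] {f : S → S → ℝ}

theorem hatK_symm (f : S → S → ℝ) (p q : S × unitInterval) : hatK f p q = hatK f q p := by
  unfold hatK
  rcases lt_trichotomy p.2 q.2 with h | h | h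
  · simp [h, h.not_gt]
  · simp [h]
  · simp [h, h.not_gt]

theorem checkK_symm (f : S → S → ℝ) (p q : S × unitInterval) : checkK f p q = -checkK f q p := by
  unfold checkK
  rcases lt_trichotomy p.2 q.2 with h | h | h
  · simp [h, h.not_gt]
  · simp [h]
  · simp [h, h.not_gt]

theorem measurable_fst_fst {A B C D : Type*} [MeasurableSpace A] [MeasurableSpace B]
    [MeasurableSpace C] [MeasurableSpace D] :
    Measurable fun p : (A × B) × (C × D) => (p.1.1, p.2.1) := by fun_prop

theorem measurable_hatK (hf : Measurable fun p : S × S => f p.1 p.2) :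
    Measurable fun p : (S × unitInterval) × (S × unitInterval) => hatK f p.1 p.2 :=
  Measurable.ite (measurableSet_lt (by fun_prop) (by fun_prop)) (hf.comp measurable_fst_fst)
    (Measurable.ite (measurableSet_lt (by fun_prop) (by fun_prop))
      ((hf.comp measurable_swap).comp measurable_fst_fst) measurable_const)

theorem measurable_checkK (hf : Measurable fun p : S × S => f p.1 p.2) :
    Measurable fun p : (S × unitInterval) × (S × unitInterval) => checkK f p.1 p.2 :=
  Measurable.ite (measurableSet_lt (by fun_prop) (by fun_prop)) (hf.comp measurable_fst_fst)
    (Measurable.ite (measurableSet_lt (by fun_prop) (by fun_prop))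
      ((hf.comp measurable_swap).comp measurable_fst_fst).neg measurable_const)

theorem measurePreserving_fst_fst (ν : Measure S) [IsProbabilityMeasure ν] :
    MeasurePreserving (fun p : (S × unitInterval) × (S × unitInterval) => (p.1.1, p.2.1))
      ((ν.prod volume).prod (ν.prod volume)) (ν.prod ν) :=
  measurePreserving_fst.prod measurePreserving_fst

theorem memLp_abs_add_flip (hf : MemLp (fun p : S × S => f p.1 p.2) 2 (ν.prod ν)) :
    MemLp (fun p : (S × unitInterval) × (S × unitInterval) => |f p.1.1 p.2.1| + |f p.2.1 p.1.1|) 2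
      ((ν.prod volume).prod (ν.prod volume)) :=
  (hf.abs.add (memLp_swap hf).abs).comp_measurePreserving (measurePreserving_fst_fst ν)

theorem memLp_hatK (hm : Measurable fun p : S × S => f p.1 p.2)
    (hf : MemLp (fun p : S × S => f p.1 p.2) 2 (ν.prod ν)) :
    MemLp (fun p : (S × unitInterval) × (S × unitInterval) => hatK f p.1 p.2) 2
      ((ν.prod volume).prod (ν.prod volume)) := by
  refine (memLp_abs_add_flip hf).mono (measurable_hatK hm).aestronglyMeasurable
    (ae_of_all _ fun p => ?_)
  rw [Real.norm_eq_abs, Real.norm_eq_abs, abs_of_nonneg (by positivity : 0 ≤ |f p.1.1 p.2.1| + _)]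
  have h1 := abs_nonneg (f p.1.1 p.2.1)
  have h2 := abs_nonneg (f p.2.1 p.1.1)
  unfold hatK
  split_ifs
  · linarith
  · linarith
  · simp only [abs_zero]; linarith

theorem memLp_checkK (hm : Measurable fun p : S × S => f p.1 p.2)
    (hf : MemLp (fun p : S × S => f p.1 p.2) 2 (ν.prod ν)) :
    MemLp (fun p : (S × unitInterval) × (S × unitInterval) => checkK f p.1 p.2) 2
      ((ν.prod volume).prod (ν.prod volume)) := by
  refine (memLp_abs_add_flip hf).mono (measurable_checkK hm).aestronglyMeasurable
    (ae_of_all _ fun p => ?_)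
  rw [Real.norm_eq_abs, Real.norm_eq_abs, abs_of_nonneg (by positivity : 0 ≤ |f p.1.1 p.2.1| + _)]
  have h1 := abs_nonneg (f p.1.1 p.2.1)
  have h2 := abs_nonneg (f p.2.1 p.1.1)
  unfold checkK
  split_ifs
  · linarith
  · rw [abs_neg]; linarith
  · simp only [abs_zero]; linarith

/-- For fixed times, `hatK f` is `f` in one of the two orders or zero, so integrating over the space
variable uses one of the two vanishing marginals. -/
theorem IsDegenerate.hatK (hf : IsDegenerate ν f) :
    IsDegenerate (ν.prod (volume : Measure unitInterval)) (hatK f) := by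
  have key : ∀ᵐ q ∂(ν.prod (volume : Measure unitInterval)),
      ∫ p, AltU.hatK f p q ∂(ν.prod volume) = 0 := by
    have h1 := Measure.quasiMeasurePreserving_fst (μ := ν) (ν := (volume : Measure unitInterval))
      |>.ae hf.left
    have h2 := Measure.quasiMeasurePreserving_fst (μ := ν) (ν := (volume : Measure unitInterval))
      |>.ae hf.right
    filter_upwards [h1, h2] with q h1 h2
    by_cases hi : Integrable (fun p => AltU.hatK f p q) (ν.prod (volume : Measure unitInterval))
    · rw [integral_prod_symm _ hi]
      refine integral_eq_zero_of_ae (ae_of_all _ fun t => ?_)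
      unfold AltU.hatK
      dsimp only
      split_ifs
      · exact h1
      · exact h2
      · simp
    -- The integral of a non-integrable function is zero by convention.
    · exact integral_undef hi
  refine ⟨measurable_hatK hf.meas, memLp_hatK hf.meas hf.memLp, key, ?_⟩
  simpa only [hatK_symm f] using key

theorem measurePreserving_prod_prod_comm (μ : Measure unitInterval) [IsProbabilityMeasure μ] :
    MeasurePreserving (fun p : (S × unitInterval) × (S × unitInterval) =>
        ((p.1.1, p.2.1), (p.1.2, p.2.2)))
      ((ν.prod μ).prod (ν.prod μ)) ((ν.prod ν).prod (μ.prod μ)) := by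
  have hm : Measurable fun p : (S × unitInterval) × (S × unitInterval) =>
      ((p.1.1, p.2.1), (p.1.2, p.2.2)) := by fun_prop
  refine ⟨hm, ?_⟩
  refine (Measure.prod_eq_generateFrom (C := Set.image2 (· ×ˢ ·) {s : Set S | MeasurableSet s}
    {s : Set S | MeasurableSet s}) (D := Set.image2 (· ×ˢ ·) {s : Set unitInterval | MeasurableSet s}
    {s : Set unitInterval | MeasurableSet s}) generateFrom_prod generateFrom_prod isPiSystem_prod
    isPiSystem_prod ⟨fun _ => Set.univ, ?_, ?_, ?_⟩ ⟨fun _ => Set.univ, ?_, ?_, ?_⟩ ?_).symm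
  · exact fun _ => ⟨Set.univ, by simp, Set.univ, by simp, by simp⟩
  · exact fun _ => measure_lt_top _ _
  · exact Set.iUnion_const _
  · exact fun _ => ⟨Set.univ, by simp, Set.univ, by simp, by simp⟩
  · exact fun _ => measure_lt_top _ _
  · exact Set.iUnion_const _
  · rintro _ ⟨a, ha, b, hb, rfl⟩ _ ⟨c, hc, d, hd, rfl⟩
    rw [Set.mem_ofPred_eq] at ha hb hc hd
    rw [Measure.map_apply hm ((ha.prod hb).prod (hc.prod hd))]
    have e : (fun p : (S × unitInterval) × (S × unitInterval) =>
        ((p.1.1, p.2.1), (p.1.2, p.2.2))) ⁻¹' ((a ×ˢ b) ×ˢ (c ×ˢ d)) =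
        (a ×ˢ c) ×ˢ (b ×ˢ d) := by
      ext p
      simp only [Set.mem_preimage, Set.mem_prod]
      tauto
    rw [e]
    simp only [Measure.prod_prod]
    ring

theorem ae_ne_unitInterval :
    ∀ᵐ p ∂((volume : Measure unitInterval).prod volume), p.1 ≠ p.2 := by
  refine (Measure.ae_prod_iff_ae_ae (p := fun p : unitInterval × unitInterval => p.1 ≠ p.2)
    (measurableSet_eq_fun measurable_fst measurable_snd).compl).2 ?_
  exact ae_of_all _ fun t => by simp [ae_iff]

/-- The square is that of `f` on one side of the diagonal and of the flipped `f` on the other. Both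
have the same integral over `S × S`, and the two regions of times have total mass 1. -/
theorem kernelNormSq_hatK (hf : IsDegenerate ν f) :
    kernelNormSq (ν.prod (volume : Measure unitInterval)) (hatK f) = kernelNormSq ν f := by
  have hmp := measurePreserving_prod_prod_comm (ν := ν) (volume : Measure unitInterval)
  have hne := hmp.quasiMeasurePreserving.ae
    (Measure.quasiMeasurePreserving_snd.ae ae_ne_unitInterval)
  let A : Set (unitInterval × unitInterval) := {p | p.1 < p.2}
  have hA : MeasurableSet A := measurableSet_lt measurable_fst measurable_snd
  let u : (S × S) × (unitInterval × unitInterval) → ℝ :=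
    fun p => f p.1.1 p.1.2 ^ 2 * A.indicator 1 p.2
  let v : (S × S) × (unitInterval × unitInterval) → ℝ :=
    fun p => f p.1.2 p.1.1 ^ 2 * Aᶜ.indicator 1 p.2
  have hiA : ∀ B : Set (unitInterval × unitInterval), MeasurableSet B →
      Integrable (B.indicator (1 : unitInterval × unitInterval → ℝ))
        ((volume : Measure unitInterval).prod volume) := fun B hB =>
    (integrable_const (1 : ℝ)).indicator hB
  have hu : Integrable u ((ν.prod ν).prod (volume.prod volume)) :=
    hf.memLp.integrable_sq.mul_prod (hiA A hA)
  have hv : Integrable v ((ν.prod ν).prod (volume.prod volume)) :=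
    hf.flip.memLp.integrable_sq.mul_prod (hiA Aᶜ hA.compl)
  have e1 : kernelNormSq (ν.prod (volume : Measure unitInterval)) (hatK f) =
      ∫ p, (u p + v p) ∂((ν.prod ν).prod ((volume : Measure unitInterval).prod volume)) := by
    rw [← hmp.map_eq, integral_map hmp.measurable.aemeasurable
      (by rw [hmp.map_eq]; exact (hu.add hv).1), kernelNormSq]
    refine integral_congr_ae ?_
    filter_upwards [hne] with p hp
    simp only [u, v, A, Set.indicator, Set.mem_compl_iff, Set.mem_ofPred_eq, AltU.hatK,
      Pi.one_apply]
    rcases lt_or_gt_of_ne hp with h | h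
    · simp [h]
    · simp [h, h.not_gt]
  have e2 : ∫ p : S × S, f p.2 p.1 ^ 2 ∂(ν.prod ν) = ∫ p, f p.1 p.2 ^ 2 ∂(ν.prod ν) :=
    integral_prod_swap (fun p : S × S => f p.1 p.2 ^ 2)
  have e3 : ∫ p, A.indicator (1 : unitInterval × unitInterval → ℝ) p ∂(volume.prod volume) +
      ∫ p, Aᶜ.indicator (1 : unitInterval × unitInterval → ℝ) p ∂(volume.prod volume) = 1 := by
    rw [← integral_add (hiA A hA) (hiA _ hA.compl)]
    have : ∀ p, A.indicator (1 : unitInterval × unitInterval → ℝ) p + Aᶜ.indicator 1 p = 1 :=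
      fun p => Set.indicator_self_add_compl_apply A 1 p
    simp [this]
  rw [e1, integral_add hu hv, integral_prod_mul (fun p : S × S => f p.1 p.2 ^ 2),
    integral_prod_mul (fun p : S × S => f p.2 p.1 ^ 2), e2, ← mul_add, e3, mul_one, kernelNormSq]

end HatKernel


/-! ### Removing the order of the index set -/

section Sorting

theorem sum_ltPairs_fin {M : Type*} [AddCommMonoid M] (m : ℕ) (F : ℕ → ℕ → M) :
    ∑ p ∈ ltPairs m, F p.1 p.2 = ∑ k : Fin m, ∑ l : Fin m, if k < l then F k l else 0 := by
  rw [ltPairs, Finset.sum_filter, Finset.sum_product, Finset.sum_range]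
  refine Finset.sum_congr rfl fun k _ => ?_
  rw [Finset.sum_range]
  rfl

/-- For each unordered pair of positions, `hatK g` feeds `g` its arguments in the order of their
times, whatever the order of the positions. -/
theorem sum_hatK_eq {A : Type*} {m : ℕ} (g : A → A → ℝ) (z : Fin m → A)
    (t : Fin m → unitInterval) :
    (∑ k, ∑ l, if k < l then hatK g (z k, t k) (z l, t l) else 0) =
      ∑ k, ∑ l, if t k < t l then g (z k) (z l) else 0 := by
  let a : Fin m → Fin m → ℝ := fun k l => if t k < t l then g (z k) (z l) else 0
  have h1 : ∀ k l, hatK g (z k, t k) (z l, t l) = a k l + a l k := by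
    intro k l
    simp only [hatK, a]
    rcases lt_trichotomy (t k) (t l) with h | h | h
    · simp [h, h.not_gt]
    · simp [h]
    · simp [h, h.not_gt]
  have h2 : (∑ k, ∑ l, if k < l then a l k else 0) = ∑ k, ∑ l, if l < k then a k l else 0 :=
    Finset.sum_comm
  calc _ = (∑ k, ∑ l, if k < l then a k l else 0) + ∑ k, ∑ l, if k < l then a l k else 0 := by
        simp only [← Finset.sum_add_distrib]
        refine Finset.sum_congr rfl fun k _ => Finset.sum_congr rfl fun l _ => ?_
        rw [h1]
        split_ifs <;> simp
    _ = _ := by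
        rw [h2]
        simp only [← Finset.sum_add_distrib]
        refine Finset.sum_congr rfl fun k _ => Finset.sum_congr rfl fun l _ => ?_
        rcases lt_trichotomy k l with h | h | h
        · simp [h, h.not_gt, a]
        · simp [h]
        · simp [h, h.not_gt, a]

/-- Both sums are relabelled by the sorting permutation, along which distinct times increase
strictly. -/
theorem sum_lt_eq_sort {A : Type*} {m : ℕ} (g : A → A → ℝ) (z : Fin m → A)
    {t : Fin m → unitInterval} (ht : Function.Injective t) :
    (∑ k, ∑ l, if t k < t l then g (z k) (z l) else 0) =
      ∑ k, ∑ l, if k < l then g (z (Tuple.sort t k)) (z (Tuple.sort t l)) else 0 := by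
  have hs : StrictMono (t ∘ Tuple.sort t) :=
    (Tuple.monotone_sort t).strictMono_of_injective (ht.comp (Tuple.sort t).injective)
  rw [← Equiv.sum_comp (Tuple.sort t)]
  refine Finset.sum_congr rfl fun k _ => ?_
  rw [← Equiv.sum_comp (Tuple.sort t)]
  refine Finset.sum_congr rfl fun l _ => ?_
  simp only [← hs.lt_iff_lt (a := k), Function.comp_apply]

theorem ae_injective_unitInterval (m : ℕ) :
    ∀ᵐ t ∂(Measure.pi fun _ : Fin m => (volume : Measure unitInterval)), Function.Injective t := by
  have h : ∀ k l : Fin m, k ≠ l →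
      ∀ᵐ t ∂(Measure.pi fun _ : Fin m => (volume : Measure unitInterval)), t k ≠ t l := by
    intro k l hkl
    have hi := iIndepFun_pi (μ := fun _ : Fin m => (volume : Measure unitInterval))
      (X := fun _ => id) fun _ => aemeasurable_id
    have h1 := (indepFun_iff_map_prod_eq_prod_map_map
      (measurable_pi_apply (X := fun _ : Fin m => unitInterval) k).aemeasurable
      (measurable_pi_apply (X := fun _ : Fin m => unitInterval) l).aemeasurable).1
      (hi.indepFun hkl)
    have h3 := (measurePreserving_eval (fun _ : Fin m => (volume : Measure unitInterval)) k).map_eq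
    have h4 := (measurePreserving_eval (fun _ : Fin m => (volume : Measure unitInterval)) l).map_eq
    have h2 := ae_ne_unitInterval
    rw [← h3] at h2
    nth_rw 2 [h3] at h2
    nth_rw 2 [← h4] at h2
    exact ae_of_ae_map (f := fun t : Fin m → unitInterval => (t k, t l)) (by fun_prop)
      (h1 ▸ h2)
  have h' : ∀ᵐ t ∂(Measure.pi fun _ : Fin m => (volume : Measure unitInterval)),
      ∀ k l : Fin m, k ≠ l → t k ≠ t l := by
    simp only [ae_all_iff]
    exact h
  filter_upwards [h'] with t ht k l hkl
  by_contra hne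
  exact ht k l hne hkl

variable {A : Type*} [MeasurableSpace A] {α : Measure A} [IsProbabilityMeasure α]

/-- For fixed distinct times, the left sum is the right one evaluated at permuted variables, and the
product measure is invariant under permutations. Thus ordering by random times gives the same law as
ordering by index. -/
theorem integral_pi_hatK {g : A → A → ℝ} (hg : Measurable fun p : A × A => g p.1 p.2) (m : ℕ)
    {F : ℝ → ℂ} (hF : Continuous F) (hF1 : ∀ x, ‖F x‖ ≤ 1) :
    ∫ y, F (∑ k, ∑ l, if k < l then hatK g (y k) (y l) else 0)
        ∂(Measure.pi fun _ : Fin m => α.prod (volume : Measure unitInterval)) =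
      ∫ z, F (∑ k, ∑ l, if k < l then g (z k) (z l) else 0) ∂(Measure.pi fun _ : Fin m => α) := by
  have hmp := measurePreserving_arrowProdEquivProdArrow A unitInterval (Fin m) (fun _ => α)
    (fun _ => volume)
  let G : (Fin m → A) × (Fin m → unitInterval) → ℂ :=
    fun p => F (∑ k, ∑ l, if p.2 k < p.2 l then g (p.1 k) (p.1 l) else 0)
  have hGm : Measurable G := by
    refine hF.measurable.comp (Finset.measurable_fun_sum _ fun k _ =>
      Finset.measurable_fun_sum _ fun l _ => Measurable.ite (measurableSet_lt (by fun_prop)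
        (by fun_prop)) ?_ measurable_const)
    exact hg.comp (f := fun p : (Fin m → A) × (Fin m → unitInterval) => (p.1 k, p.1 l))
      (by fun_prop)
  have hGi : Integrable G ((Measure.pi fun _ : Fin m => α).prod
      (Measure.pi fun _ : Fin m => (volume : Measure unitInterval))) :=
    Integrable.of_bound hGm.aestronglyMeasurable 1 (ae_of_all _ fun p => hF1 _)
  have e1 : ∫ y, F (∑ k, ∑ l, if k < l then hatK g (y k) (y l) else 0)
        ∂(Measure.pi fun _ : Fin m => α.prod (volume : Measure unitInterval)) =
      ∫ p, G p ∂((Measure.pi fun _ : Fin m => α).prod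
        (Measure.pi fun _ : Fin m => (volume : Measure unitInterval))) := by
    rw [← hmp.map_eq, integral_map hmp.measurable.aemeasurable hGm.aestronglyMeasurable]
    refine integral_congr_ae (ae_of_all _ fun y => ?_)
    exact congrArg F (sum_hatK_eq g (fun k => (y k).1) fun k => (y k).2)
  rw [e1, integral_prod_symm _ hGi]
  have e2 : ∀ᵐ t ∂(Measure.pi fun _ : Fin m => (volume : Measure unitInterval)),
      ∫ z, G (z, t) ∂(Measure.pi fun _ : Fin m => α) =
      ∫ z, F (∑ k, ∑ l, if k < l then g (z k) (z l) else 0) ∂(Measure.pi fun _ : Fin m => α) := by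
    filter_upwards [ae_injective_unitInterval m] with t ht
    have hσ := measurePreserving_piCongrLeft (α := fun _ : Fin m => A) (fun _ => α)
      (Tuple.sort t)
    rw [← hσ.integral_comp']
    refine integral_congr_ae (ae_of_all _ fun z => ?_)
    refine congrArg F ((sum_lt_eq_sort g _ ht).trans ?_)
    simp only [MeasurableEquiv.coe_piCongrLeft, Equiv.piCongrLeft_apply_eq_cast,
      cast_eq, Equiv.symm_apply_apply]
  rw [integral_congr_ae e2]
  simp

theorem IsIID.map_pi {Ω : Type*} [MeasurableSpace Ω] {P : Measure Ω} [IsProbabilityMeasure P]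
    {Z : ℕ → Ω → A} (hZ : IsIID P α Z) (m : ℕ) :
    P.map (fun ω (k : Fin m) => Z k ω) = Measure.pi fun _ => α := by
  have h := hZ.indep.precomp (g := fun k : Fin m => (k : ℕ)) Fin.val_injective
  rw [(iIndepFun_iff_map_fun_eq_pi_map fun k : Fin m => (hZ.meas k).aemeasurable).1 h]
  simp only [hZ.law]

theorem IsIID.charFun_hatK {Ω Ω' : Type*} [MeasurableSpace Ω] [MeasurableSpace Ω'] {P : Measure Ω}
    [IsProbabilityMeasure P] {P' : Measure Ω'} [IsProbabilityMeasure P'] {Z : ℕ → Ω → A}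
    {Y : ℕ → Ω' → A × unitInterval} (hZ : IsIID P α Z) (hY : IsIID P' (α.prod volume) Y)
    {g : A → A → ℝ} (hg : Measurable fun p : A × A => g p.1 p.2) (m : ℕ) (c t : ℝ) :
    charFun (P.map fun ω => c * ∑ p ∈ ltPairs m, g (Z p.1 ω) (Z p.2 ω)) t =
      charFun (P'.map fun ω => c * ∑ p ∈ ltPairs m, hatK g (Y p.1 ω) (Y p.2 ω)) t := by
  have hm1 : Measurable fun ω => c * ∑ p ∈ ltPairs m, g (Z p.1 ω) (Z p.2 ω) :=
    (Finset.measurable_fun_sum _ fun p _ =>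
      hg.comp (f := fun ω => (Z p.1 ω, Z p.2 ω)) ((hZ.meas _).prodMk (hZ.meas _))).const_mul _
  have hm2 : Measurable fun ω => c * ∑ p ∈ ltPairs m, hatK g (Y p.1 ω) (Y p.2 ω) :=
    (Finset.measurable_fun_sum _ fun p _ =>
      (measurable_hatK hg).comp (f := fun ω => (Y p.1 ω, Y p.2 ω))
        ((hY.meas _).prodMk (hY.meas _))).const_mul _
  rw [charFun_map_eq hm1.aemeasurable, charFun_map_eq hm2.aemeasurable]
  let F : ℝ → ℂ := fun x => Complex.exp (t * (c * x : ℝ) * Complex.I)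
  have hF : Continuous F := by fun_prop
  have hF1 : ∀ x, ‖F x‖ ≤ 1 := fun x => by
    simp only [F]
    rw [← Complex.ofReal_mul, Complex.norm_exp_ofReal_mul_I]
  have h := integral_pi_hatK (α := α) hg m hF hF1
  rw [← hZ.map_pi m, ← hY.map_pi m, integral_map, integral_map] at h
  · refine Eq.trans ?_ (h.symm.trans ?_)
    · refine integral_congr_ae (ae_of_all _ fun ω => ?_)
      simp only [F, sum_ltPairs_fin m fun k l => g (Z k ω) (Z l ω)]
    · refine integral_congr_ae (ae_of_all _ fun ω => ?_)
      simp only [F, sum_ltPairs_fin m fun k l => hatK g (Y k ω) (Y l ω)]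
  · exact (measurable_pi_lambda (fun ω (k : Fin m) => Z k ω) fun k => hZ.meas k).aemeasurable
  · refine (hF.measurable.comp (Finset.measurable_fun_sum _ fun k _ =>
      Finset.measurable_fun_sum _ fun l _ => Measurable.ite (by simp) ?_
        measurable_const)).aestronglyMeasurable
    exact hg.comp (f := fun z : Fin m → A => (z k, z l)) (by fun_prop)
  · exact (measurable_pi_lambda (fun ω (k : Fin m) => Y k ω) fun k => hY.meas k).aemeasurable
  · refine (hF.measurable.comp (Finset.measurable_fun_sum _ fun k _ =>
      Finset.measurable_fun_sum _ fun l _ => Measurable.ite (by simp) ?_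
        measurable_const)).aestronglyMeasurable
    exact (measurable_hatK hg).comp (f := fun z : Fin m → A × unitInterval => (z k, z l))
      (by fun_prop)

/-- The limit law of a degenerate statistic with an asymmetric kernel `g`, in terms of an expansion
of the symmetric kernel `ĝ`. -/
theorem IsIID.tendsto_charFun_asymmetric {Ω : Type*} [MeasurableSpace Ω] {P : Measure Ω}
    [IsProbabilityMeasure P] {Z : ℕ → Ω → A} (hZ : IsIID P α Z) {g : A → A → ℝ}
    (hg : IsDegenerate α g) {ι : Type} {φ : ι → Lp ℝ 2 (α.prod (volume : Measure unitInterval))}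
    (hφ : Orthonormal ℝ φ) (h0 : ∀ r, ∫ x, φ r x ∂(α.prod volume) = 0) {lam : ι → ℝ}
    (hsum : HasSum (fun r => lam r • tmul (φ r) (φ r)) (hg.hatK.memLp.toLp _)) (t : ℝ) :
    ∃ L, HasProd (fun r => charFun chiLaw (lam r * t)) L ∧
      Tendsto (fun m : ℕ => charFun (P.map fun ω =>
        (m : ℝ)⁻¹ * ∑ p ∈ ltPairs m, g (Z p.1 ω) (Z p.2 ω)) t) atTop (𝓝 L) := by
  obtain ⟨Ω', _, P', Y, hY, hlaw, hind, _⟩ :=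
    exists_iid ℕ (α.prod (volume : Measure unitInterval))
  have hY : IsIID P' (α.prod volume) Y := ⟨hY, fun i => (hlaw i).map_eq, hind⟩
  obtain ⟨L, hL, hlim⟩ := hY.tendsto_charFun_symmetric hg.hatK hφ h0 hsum t
  exact ⟨L, hL, hlim.congr fun m => (hZ.charFun_hatK hY hg.meas m _ t).symm⟩

/-- Consecutive pairs of an i.i.d. sequence. -/
theorem IsIID.pairs {Ω : Type*} [MeasurableSpace Ω] {P : Measure Ω} [IsProbabilityMeasure P]
    {X : ℕ → Ω → A} (hX : IsIID P α X) :
    IsIID P (α.prod α) fun k ω => (X (2 * k) ω, X (2 * k + 1) ω) where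
  meas k := (hX.meas _).prodMk (hX.meas _)
  law k := (hX.measurePreserving_pair (by omega)).map_eq
  indep := by
    have hinj : Function.Injective fun p : ℕ × Fin 2 => 2 * p.1 + (p.2 : ℕ) := by
      rintro ⟨k, i⟩ ⟨l, j⟩ h
      simp only at h
      have h1 : k = l := by omega
      have h2 : i = j := by omega
      rw [h1, h2]
    have h1 := (iIndepFun_iff_map_fun_eq_infinitePi_map fun p : ℕ × Fin 2 =>
      hX.meas (2 * p.1 + (p.2 : ℕ))).1 (hX.indep.precomp hinj)
    have hm : Measurable fun ω (p : ℕ × Fin 2) => X (2 * p.1 + (p.2 : ℕ)) ω :=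
      measurable_pi_lambda _ fun p => hX.meas _
    have h2 : iIndepFun (fun k ω (i : Fin 2) => X (2 * k + (i : ℕ)) ω) P := by
      have hlaw : ∀ k, P.map (fun ω (i : Fin 2) => X (2 * k + (i : ℕ)) ω) =
          Measure.infinitePi fun _ : Fin 2 => α := by
        intro k
        have h3 := (iIndepFun_iff_map_fun_eq_infinitePi_map fun i : Fin 2 =>
          hX.meas (2 * k + (i : ℕ))).1 (hX.indep.precomp (g := fun i : Fin 2 => 2 * k + (i : ℕ))
            fun i j hij => by simp only at hij; omega)
        simp only [hX.law] at h3
        exact h3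
      rw [iIndepFun_iff_map_fun_eq_infinitePi_map fun k => measurable_pi_lambda _ fun i =>
        hX.meas _]
      simp only [hlaw]
      simp only [hX.law] at h1
      -- The variables, indexed by `ℕ × Fin 2`, have an infinite product as joint law; currying
      -- exhibits it as a product over `ℕ` of the laws of the pairs.
      have h4 := Measure.infinitePi_map_curry (ι := ℕ) (κ := Fin 2) (X := A) (fun _ _ => α)
      rw [← h4, ← h1, Measure.map_map (MeasurableEquiv.measurable _) hm]
      rfl
    exact h2.comp (fun _ x => (x 0, x 1)) fun _ => by fun_prop

end Sorting


/-! ### Pulling back along measure preserving maps -/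

section Pull

variable {E E' Y Y' : Type*} [MeasurableSpace E] [MeasurableSpace E'] [MeasurableSpace Y]
  [MeasurableSpace Y'] {π : Measure E} {π' : Measure E'} {κ : Measure Y} {κ' : Measure Y'}
  [IsProbabilityMeasure π] [IsProbabilityMeasure π'] [IsProbabilityMeasure κ]
  [IsProbabilityMeasure κ'] {q : E → Y} {q' : E' → Y'}

/-- Composition with a measure preserving map. -/
noncomputable def pull (hq : MeasurePreserving q π κ) : Lp ℝ 2 κ →L[ℝ] Lp ℝ 2 π :=
  (Lp.compMeasurePreservingₗᵢ ℝ q hq).toContinuousLinearMap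

theorem coeFn_pull (hq : MeasurePreserving q π κ) (a : Lp ℝ 2 κ) :
    pull hq a =ᵐ[π] fun x => a (q x) :=
  Lp.coeFn_compMeasurePreserving a hq

theorem inner_pull_pull (hq : MeasurePreserving q π κ) (a b : Lp ℝ 2 κ) :
    inner ℝ (pull hq a) (pull hq b) = inner ℝ a b :=
  (Lp.compMeasurePreservingₗᵢ ℝ q hq).inner_map_map a b

theorem pull_prod_tmul (hq : MeasurePreserving q π κ) (hq' : MeasurePreserving q' π' κ')
    (a : Lp ℝ 2 κ) (b : Lp ℝ 2 κ') :
    pull (hq.prod hq') (tmul a b) = tmul (pull hq a) (pull hq' b) := by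
  refine Lp.ext ?_
  filter_upwards [coeFn_pull (hq.prod hq') (tmul a b),
    (hq.prod hq').quasiMeasurePreserving.ae (coeFn_tmul a b),
    coeFn_tmul (pull hq a) (pull hq' b),
    Measure.quasiMeasurePreserving_fst.ae (coeFn_pull hq a),
    Measure.quasiMeasurePreserving_snd.ae (coeFn_pull hq' b)] with p h1 h2 h3 h4 h5
  rw [h1, h2, h3, h4, h5]
  rfl

/-- The adjoint of a pull-back along a product map acts on elementary tensors factor by factor; it
is enough to test this against elementary tensors. -/
theorem inner_tmul_pull (hq : MeasurePreserving q π κ) (hq' : MeasurePreserving q' π' κ')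
    (u : Lp ℝ 2 π) (w : Lp ℝ 2 π') (G : Lp ℝ 2 (κ.prod κ')) :
    inner ℝ (tmul u w) (pull (hq.prod hq') G) =
      inner ℝ (tmul (ContinuousLinearMap.adjoint (pull hq) u)
        (ContinuousLinearMap.adjoint (pull hq') w)) G := by
  have h : ContinuousLinearMap.adjoint (pull (hq.prod hq')) (tmul u w) =
      tmul (ContinuousLinearMap.adjoint (pull hq) u)
        (ContinuousLinearMap.adjoint (pull hq') w) := by
    rw [← sub_eq_zero]
    refine eq_zero_of_forall_inner_tmul _ fun a b => ?_
    rw [inner_sub_right, ContinuousLinearMap.adjoint_inner_right,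
      pull_prod_tmul hq hq', inner_tmul, inner_tmul, ContinuousLinearMap.adjoint_inner_right, ContinuousLinearMap.adjoint_inner_right,
      sub_self]
  rw [← h, ContinuousLinearMap.adjoint_inner_left]

theorem inner_integralOp_real {g : Y → Y → ℝ}
    (hg : MemLp (fun p : Y × Y => g p.1 p.2) 2 (κ.prod κ)) (u v : Lp ℝ 2 κ) :
    inner ℝ u (integralOp κ g v) = inner ℝ (tmul u v) (hg.toLp _) := by
  have h := inner_integralOp hg u v
  rwa [star_trivial] at h

end Pull

/-! ### The operator of the limit and the kernel of the paired statistic -/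

section PairOperator

variable {S : Type*} [MeasurableSpace S] {ν : Measure S} [IsProbabilityMeasure ν] {f : S → S → ℝ}

theorem integral_add_add_sub_sub_eq_zero {A : Type*} [MeasurableSpace A] {α : Measure A}
    {a b c d : A → ℝ} (ha : Integrable a α) (hb : Integrable b α) (hc : Integrable c α)
    (hd : Integrable d α) (a0 : ∫ x, a x ∂α = 0) (b0 : ∫ x, b x ∂α = 0) (c0 : ∫ x, c x ∂α = 0)
    (d0 : ∫ x, d x ∂α = 0) : ∫ x, (a x + b x - c x - d x) ∂α = 0 := by
  have hab : Integrable (fun x => a x + b x) α := ha.add hb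
  have habc : Integrable (fun x => a x + b x - c x) α := hab.sub hc
  rw [integral_sub habc hd, integral_sub hab hc, integral_add ha hb, a0, b0, c0, d0]
  simp

/-- The kernel of the statistic in terms of consecutive pairs. -/
def pairKernel (f : S → S → ℝ) (x z : S × S) : ℝ :=
  f x.1 z.2 + f x.2 z.2 - f x.1 z.1 - f x.2 z.1

theorem measurePreserving_pairFst (ν : Measure S) [IsProbabilityMeasure ν] :
    MeasurePreserving (Prod.map Prod.fst id : (S × S) × unitInterval → S × unitInterval)
      ((ν.prod ν).prod volume) (ν.prod volume) :=
  measurePreserving_fst.prod (MeasurePreserving.id _)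

theorem measurePreserving_pairSnd (ν : Measure S) [IsProbabilityMeasure ν] :
    MeasurePreserving (Prod.map Prod.snd id : (S × S) × unitInterval → S × unitInterval)
      ((ν.prod ν).prod volume) (ν.prod volume) :=
  measurePreserving_snd.prod (MeasurePreserving.id _)

/-- This is where the blocks of `altOp` come from. Exchanging the two pairs changes the sign of the
terms mixing first and second coordinates, which therefore assemble into `checkK`, and preserves the
sign of the other two, which assemble into `hatK`. -/
theorem hatK_pairKernel (f : S → S → ℝ) (e e' : (S × S) × unitInterval) :
    hatK (pairKernel f) e e' =
      -hatK f (e.1.1, e.2) (e'.1.1, e'.2) + checkK f (e.1.1, e.2) (e'.1.2, e'.2) -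
        checkK f (e.1.2, e.2) (e'.1.1, e'.2) + hatK f (e.1.2, e.2) (e'.1.2, e'.2) := by
  simp only [hatK, checkK, pairKernel]
  split_ifs <;> ring

theorem IsDegenerate.pairKernel (hf : IsDegenerate ν f) :
    IsDegenerate (ν.prod ν) (pairKernel f) := by
  have m1 : MeasurePreserving (Prod.fst : S × S → S) (ν.prod ν) ν := measurePreserving_fst
  have m2 : MeasurePreserving (Prod.snd : S × S → S) (ν.prod ν) ν := measurePreserving_snd
  have hm : ∀ {p q : S × S → S} (hp : MeasurePreserving p (ν.prod ν) ν)
      (hq : MeasurePreserving q (ν.prod ν) ν), MemLp (fun z : (S × S) × (S × S) =>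
        f (p z.1) (q z.2)) 2 ((ν.prod ν).prod (ν.prod ν)) := fun hp hq =>
    hf.memLp.comp_measurePreserving (hp.prod hq)
  have hme : ∀ {p q : S × S → S} (hp : Measurable p) (hq : Measurable q),
      Measurable fun z : (S × S) × (S × S) => f (p z.1) (q z.2) := fun hp hq =>
    hf.meas.comp (hp.comp measurable_fst |>.prodMk (hq.comp measurable_snd))
  have hint : ∀ {F : S → ℝ} {p : S × S → S} (hp : MeasurePreserving p (ν.prod ν) ν)
      (hF : Integrable F ν), ∫ z, F (p z) ∂(ν.prod ν) = ∫ x, F x ∂ν := fun hp hF => by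
    rw [← hp.map_eq, integral_map hp.measurable.aemeasurable (by rw [hp.map_eq]; exact hF.1),
      hp.map_eq]
  have hi := hf.memLp.integrable (by norm_num : (1 : ℝ≥0∞) ≤ 2)
  refine ⟨?_, ?_, ?_, ?_⟩
  · exact (((hme m1.measurable m2.measurable).add (hme m2.measurable m2.measurable)).sub
      (hme m1.measurable m1.measurable)).sub (hme m2.measurable m1.measurable)
  · exact (((hm m1 m2).add (hm m2 m2)).sub (hm m1 m1)).sub (hm m2 m1)
  · have key : ∀ᵐ y ∂ν, Integrable (fun x => f x y) ν ∧ ∫ x, f x y ∂ν = 0 :=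
      hi.prod_left_ae.and hf.left
    filter_upwards [m1.quasiMeasurePreserving.ae key, m2.quasiMeasurePreserving.ae key] with z h1 h2
    have i1 := h1.1.comp_fst ν
    have i2 := h2.1.comp_fst ν
    have i3 := h1.1.comp_snd ν
    have i4 := h2.1.comp_snd ν
    exact integral_add_add_sub_sub_eq_zero i2 i4 i1 i3 ((hint m1 h2.1).trans h2.2)
      ((hint m2 h2.1).trans h2.2) ((hint m1 h1.1).trans h1.2) ((hint m2 h1.1).trans h1.2)
  · have key : ∀ᵐ x ∂ν, Integrable (fun y => f x y) ν ∧ ∫ y, f x y ∂ν = 0 :=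
      hi.prod_right_ae.and hf.right
    filter_upwards [m1.quasiMeasurePreserving.ae key, m2.quasiMeasurePreserving.ae key] with z h1 h2
    have i1 := h1.1.comp_fst ν
    have i2 := h2.1.comp_fst ν
    have i3 := h1.1.comp_snd ν
    have i4 := h2.1.comp_snd ν
    exact integral_add_add_sub_sub_eq_zero i3 i4 i1 i2 ((hint m2 h1.1).trans h1.2)
      ((hint m2 h2.1).trans h2.2) ((hint m1 h1.1).trans h1.2) ((hint m1 h2.1).trans h2.2)

/-- Evaluated at four independent variables, the four terms involve four distinct pairs of indices,
so they are orthogonal and each contributes the norm of `f`. -/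
theorem kernelNormSq_pairKernel (hf : IsDegenerate ν f) :
    kernelNormSq (ν.prod ν) (pairKernel f) = 4 * kernelNormSq ν f := by
  obtain ⟨Ω', _, P', X, hX, hlaw, hind, _⟩ := exists_iid ℕ ν
  have hX : IsIID P' ν X := ⟨hX, fun i => (hlaw i).map_eq, hind⟩
  let c : ℕ × ℕ → ℝ := fun p => if p.2 = 3 then 1 else -1
  have h1 := hX.integral_sq_sum hf {(0, 3), (1, 3), (0, 2), (1, 2)} (by simp) c
  have h2 := hX.pairs.integral_pair (i := 0) (j := 1) (by norm_num)
    (F := fun x z => AltU.pairKernel f x z ^ 2) (hf.pairKernel.meas.pow_const 2).aestronglyMeasurable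
  rw [kernelNormSq, ← h2]
  have e : (∑ p ∈ ({(0, 3), (1, 3), (0, 2), (1, 2)} : Finset (ℕ × ℕ)), c p ^ 2) = 4 := by
    simp [c]
  rw [e] at h1
  rw [← h1]
  refine integral_congr_ae (ae_of_all _ fun ω => ?_)
  simp [c, AltU.pairKernel]
  ring

/-- `(a, b) ↦ a(x₁, t) + b(x₂, t)`. -/
noncomputable def pairLift (ν : Measure S) [IsProbabilityMeasure ν]
    (v : WithLp 2 (Lp ℝ 2 (ν.prod (volume : Measure unitInterval)) ×
      Lp ℝ 2 (ν.prod (volume : Measure unitInterval)))) :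
    Lp ℝ 2 ((ν.prod ν).prod (volume : Measure unitInterval)) :=
  pull (measurePreserving_pairFst ν) v.fst + pull (measurePreserving_pairSnd ν) v.snd

/-- The adjoint of `pairLift`. -/
noncomputable def pairProj (ν : Measure S) [IsProbabilityMeasure ν]
    (w : Lp ℝ 2 ((ν.prod ν).prod (volume : Measure unitInterval))) :
    WithLp 2 (Lp ℝ 2 (ν.prod (volume : Measure unitInterval)) ×
      Lp ℝ 2 (ν.prod (volume : Measure unitInterval))) :=
  WithLp.toLp 2 (ContinuousLinearMap.adjoint (pull (measurePreserving_pairFst ν)) w,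
    ContinuousLinearMap.adjoint (pull (measurePreserving_pairSnd ν)) w)

theorem inner_prod_eq {H : Type*} [NormedAddCommGroup H] [InnerProductSpace ℝ H]
    (v w : WithLp 2 (H × H)) : inner ℝ v w = inner ℝ v.fst w.fst + inner ℝ v.snd w.snd := rfl

theorem inner_pairLift (v w) :
    inner ℝ (pairLift ν v) w = inner ℝ v (pairProj ν w) := by
  rw [pairLift, inner_add_left, inner_prod_eq]
  change _ = inner ℝ v.fst (ContinuousLinearMap.adjoint (pull (measurePreserving_pairFst ν)) w) +
    inner ℝ v.snd (ContinuousLinearMap.adjoint (pull (measurePreserving_pairSnd ν)) w)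
  rw [ContinuousLinearMap.adjoint_inner_right, ContinuousLinearMap.adjoint_inner_right]

theorem altOp_fst (ν : Measure S) [IsProbabilityMeasure ν] (f : S → S → ℝ) (v) :
    (altOp ν f v).fst = (1 / 2 : ℝ) •
      (-integralOp (ν.prod volume) (hatK f) v.fst + integralOp (ν.prod volume) (checkK f) v.snd) :=
  rfl

theorem altOp_snd (ν : Measure S) [IsProbabilityMeasure ν] (f : S → S → ℝ) (v) :
    (altOp ν f v).snd = (1 / 2 : ℝ) •
      (-integralOp (ν.prod volume) (checkK f) v.fst + integralOp (ν.prod volume) (hatK f) v.snd) :=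
  rfl

theorem inner_altOp (ν : Measure S) [IsProbabilityMeasure ν] (f : S → S → ℝ) (v w) :
    inner ℝ v (altOp ν f w) = (1 / 2) *
      (-inner ℝ v.fst (integralOp (ν.prod volume) (hatK f) w.fst) +
        inner ℝ v.fst (integralOp (ν.prod volume) (checkK f) w.snd) -
        inner ℝ v.snd (integralOp (ν.prod volume) (checkK f) w.fst) +
        inner ℝ v.snd (integralOp (ν.prod volume) (hatK f) w.snd)) := by
  rw [inner_prod_eq, altOp_fst, altOp_snd, inner_smul_right, inner_smul_right, inner_add_right,
    inner_add_right, inner_neg_right, inner_neg_right]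
  ring

theorem toLp_hatK_pairKernel (hf : IsDegenerate ν f) :
    hf.pairKernel.hatK.memLp.toLp _ =
      -pull ((measurePreserving_pairFst ν).prod (measurePreserving_pairFst ν))
          ((memLp_hatK hf.meas hf.memLp).toLp _) +
        pull ((measurePreserving_pairFst ν).prod (measurePreserving_pairSnd ν))
          ((memLp_checkK hf.meas hf.memLp).toLp _) -
        pull ((measurePreserving_pairSnd ν).prod (measurePreserving_pairFst ν))
          ((memLp_checkK hf.meas hf.memLp).toLp _) +
        pull ((measurePreserving_pairSnd ν).prod (measurePreserving_pairSnd ν))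
          ((memLp_hatK hf.meas hf.memLp).toLp _) := by
  have hh := memLp_hatK hf.meas hf.memLp
  have hc := memLp_checkK hf.meas hf.memLp
  have h1 := measurePreserving_pairFst ν
  have h2 := measurePreserving_pairSnd ν
  have e : hf.pairKernel.hatK.memLp.toLp _ = -(hh.comp_measurePreserving (h1.prod h1)).toLp _ +
      (hc.comp_measurePreserving (h1.prod h2)).toLp _ -
      (hc.comp_measurePreserving (h2.prod h1)).toLp _ +
      (hh.comp_measurePreserving (h2.prod h2)).toLp _ := by
    rw [← MemLp.toLp_neg, ← MemLp.toLp_add, ← MemLp.toLp_sub, ← MemLp.toLp_add]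
    exact MemLp.toLp_congr _ _ (ae_of_all _ fun p => hatK_pairKernel f p.1 p.2)
  exact e

theorem inner_tmul_hatK_pairKernel (hf : IsDegenerate ν f)
    (u w : Lp ℝ 2 ((ν.prod ν).prod (volume : Measure unitInterval))) :
    inner ℝ (tmul u w) (hf.pairKernel.hatK.memLp.toLp _) =
      -inner ℝ (tmul (pairProj ν u).fst (pairProj ν w).fst)
          ((memLp_hatK hf.meas hf.memLp).toLp _) +
        inner ℝ (tmul (pairProj ν u).fst (pairProj ν w).snd)
          ((memLp_checkK hf.meas hf.memLp).toLp _) -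
        inner ℝ (tmul (pairProj ν u).snd (pairProj ν w).fst)
          ((memLp_checkK hf.meas hf.memLp).toLp _) +
        inner ℝ (tmul (pairProj ν u).snd (pairProj ν w).snd)
          ((memLp_hatK hf.meas hf.memLp).toLp _) := by
  refine (congrArg (inner ℝ (tmul u w)) (toLp_hatK_pairKernel hf)).trans ?_
  rw [inner_add_right, inner_sub_right, inner_add_right, inner_neg_right]
  exact congrArg₂ _ (congrArg₂ _ (congrArg₂ _ (congrArg _ (inner_tmul_pull _ _ _ _ _))
    (inner_tmul_pull _ _ _ _ _)) (inner_tmul_pull _ _ _ _ _)) (inner_tmul_pull _ _ _ _ _)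

/-- The operator of the symmetrized pair kernel factors as projection, `altOp`, lift; the 2
compensates the factor one half in `altOp`. -/
theorem inner_integralOp_pairKernel (hf : IsDegenerate ν f)
    (u w : Lp ℝ 2 ((ν.prod ν).prod (volume : Measure unitInterval))) :
    inner ℝ u (integralOp ((ν.prod ν).prod volume) (hatK (pairKernel f)) w) =
      2 * inner ℝ (pairProj ν u) (altOp ν f (pairProj ν w)) := by
  have hh := memLp_hatK hf.meas hf.memLp
  have hc := memLp_checkK hf.meas hf.memLp
  refine ((inner_integralOp_real hf.pairKernel.hatK.memLp u w).trans
    (inner_tmul_hatK_pairKernel hf u w)).trans ?_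
  rw [inner_altOp, inner_integralOp_real hh, inner_integralOp_real hh, inner_integralOp_real hc,
    inner_integralOp_real hc]
  ring

end PairOperator


/-! ### Self-adjointness and compactness of the block operator; centred eigenfunctions -/

section AltOp

variable {S : Type*} [MeasurableSpace S] {ν : Measure S} [IsProbabilityMeasure ν] {f : S → S → ℝ}

theorem integralOp_neg {𝕜 Y : Type*} [RCLike 𝕜] [MeasurableSpace Y] {κ : Measure Y}
    [IsProbabilityMeasure κ] {g : Y → Y → 𝕜}
    (hg : MemLp (fun p : Y × Y => g p.1 p.2) 2 (κ.prod κ)) :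
    integralOp κ (fun x y => -g x y) = -integralOp κ g := by
  rw [integralOp_eq_kerOp hg, integralOp_eq_kerOp (g := fun x y => -g x y) hg.neg, ← map_neg,
    ← MemLp.toLp_neg]
  rfl

theorem integralOp_congr {𝕜 Y : Type*} [RCLike 𝕜] [MeasurableSpace Y] {κ : Measure Y}
    [IsProbabilityMeasure κ] {g h : Y → Y → 𝕜}
    (hg : MemLp (fun p : Y × Y => g p.1 p.2) 2 (κ.prod κ))
    (hgh : ∀ᵐ p ∂(κ.prod κ), g p.1 p.2 = h p.1 p.2) : integralOp κ g = integralOp κ h := by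
  have hh : MemLp (fun p : Y × Y => h p.1 p.2) 2 (κ.prod κ) := (memLp_congr_ae hgh).1 hg
  rw [integralOp_eq_kerOp hg, integralOp_eq_kerOp hh]
  exact congrArg _ (MemLp.toLp_congr _ _ hgh)

theorem inner_integralOp_hatK (hf : IsDegenerate ν f)
    (u v : Lp ℝ 2 (ν.prod (volume : Measure unitInterval))) :
    inner ℝ (integralOp (ν.prod volume) (hatK f) u) v =
      inner ℝ u (integralOp (ν.prod volume) (hatK f) v) := by
  have h := inner_integralOp_left (memLp_hatK hf.meas hf.memLp) u v
  simp only [conj_trivial] at h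
  rw [← h]
  congr 3
  funext x y
  exact hatK_symm f x y

theorem inner_integralOp_checkK (hf : IsDegenerate ν f)
    (u v : Lp ℝ 2 (ν.prod (volume : Measure unitInterval))) :
    inner ℝ (integralOp (ν.prod volume) (checkK f) u) v =
      -inner ℝ u (integralOp (ν.prod volume) (checkK f) v) := by
  have hc := memLp_checkK hf.meas hf.memLp
  have h := inner_integralOp_left hc u v
  simp only [conj_trivial] at h
  have e : (fun x y : S × unitInterval => checkK f y x) = fun x y => -checkK f x y := by
    funext x y
    exact checkK_symm f y x
  rw [e, integralOp_neg hc, neg_apply, inner_neg_left] at h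
  rw [← h, neg_neg]

/-- The diagonal blocks have symmetric kernels; the off-diagonal blocks are opposite to each other
with antisymmetric kernels, so each is the adjoint of the other. -/
theorem isSymmetric_altOp (hf : IsDegenerate ν f) : (altOp ν f).toLinearMap.IsSymmetric := by
  intro v w
  change inner ℝ (altOp ν f v) w = inner ℝ v (altOp ν f w)
  rw [← real_inner_comm, inner_altOp, inner_altOp]
  rw [(real_inner_comm _ w.fst).trans (inner_integralOp_hatK hf v.fst w.fst),
    (real_inner_comm _ w.snd).trans (inner_integralOp_hatK hf v.snd w.snd),
    (real_inner_comm _ w.fst).trans (inner_integralOp_checkK hf v.snd w.fst),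
    (real_inner_comm _ w.snd).trans (inner_integralOp_checkK hf v.fst w.snd)]
  ring

theorem isSelfAdjoint_altOp (hf : IsDegenerate ν f) : IsSelfAdjoint (altOp ν f) :=
  (isSymmetric_altOp hf).isSelfAdjoint

theorem isCompactOperator_blockOp {H : Type*} [NormedAddCommGroup H] [InnerProductSpace ℝ H]
    {A B C D : H →L[ℝ] H} (hA : IsCompactOperator A) (hB : IsCompactOperator B)
    (hC : IsCompactOperator C) (hD : IsCompactOperator D) :
    IsCompactOperator (blockOp A B C D) := by
  let e := WithLp.prodContinuousLinearEquiv 2 ℝ H H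
  let i₁ : H →L[ℝ] WithLp 2 (H × H) :=
    (e.symm : H × H →L[ℝ] WithLp 2 (H × H)) ∘L ContinuousLinearMap.inl ℝ H H
  let i₂ : H →L[ℝ] WithLp 2 (H × H) :=
    (e.symm : H × H →L[ℝ] WithLp 2 (H × H)) ∘L ContinuousLinearMap.inr ℝ H H
  let p₁ : WithLp 2 (H × H) →L[ℝ] H :=
    ContinuousLinearMap.fst ℝ H H ∘L (e : WithLp 2 (H × H) →L[ℝ] H × H)
  let p₂ : WithLp 2 (H × H) →L[ℝ] H :=
    ContinuousLinearMap.snd ℝ H H ∘L (e : WithLp 2 (H × H) →L[ℝ] H × H)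
  have h : (blockOp A B C D : WithLp 2 (H × H) → WithLp 2 (H × H)) =
      (i₁ ∘ A ∘ p₁ + i₁ ∘ B ∘ p₂) + (i₂ ∘ C ∘ p₁ + i₂ ∘ D ∘ p₂) := by
    funext v
    refine e.injective (Prod.ext ?_ ?_)
    · simp [blockOp, i₁, i₂, p₁, p₂, e]
    · simp [blockOp, i₁, i₂, p₁, p₂, e]
  rw [h]
  exact (((hA.comp_clm p₁).clm_comp i₁).add ((hB.comp_clm p₂).clm_comp i₁)).add
    (((hC.comp_clm p₁).clm_comp i₂).add ((hD.comp_clm p₂).clm_comp i₂))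

theorem isCompactOperator_altOp (hf : IsDegenerate ν f) : IsCompactOperator (altOp ν f) := by
  have hh := isCompactOperator_integralOp (memLp_hatK hf.meas hf.memLp)
  have hc := isCompactOperator_integralOp (memLp_checkK hf.meas hf.memLp)
  exact (isCompactOperator_blockOp hh.neg hc hc.neg hh).smul (1 / 2 : ℝ)

/-! ### Centring of the eigenfunctions -/

/-- Functions of `(x, t)` orthogonal to all functions of `t`. -/
def IsCentred (ν : Measure S) [IsProbabilityMeasure ν]
    (a : Lp ℝ 2 (ν.prod (volume : Measure unitInterval))) : Prop :=
  ∀ ψ : Lp ℝ 2 (volume : Measure unitInterval),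
    inner ℝ (pull (measurePreserving_snd (μ := ν)) ψ) a = 0

theorem IsCentred.add {a b} (ha : IsCentred ν a) (hb : IsCentred ν b) : IsCentred ν (a + b) :=
  fun ψ => by rw [inner_add_right, ha, hb, add_zero]

theorem IsCentred.neg {a} (ha : IsCentred ν a) : IsCentred ν (-a) :=
  fun ψ => by rw [inner_neg_right, ha, neg_zero]

theorem IsCentred.smul {a} (ha : IsCentred ν a) (c : ℝ) : IsCentred ν (c • a) :=
  fun ψ => by rw [inner_smul_right, ha, mul_zero]

/-- A function of time alone factors out of the integral over the space variable, where the kernel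
integrates to zero. -/
theorem integralOp_pull_snd {k : S × unitInterval → S × unitInterval → ℝ}
    (hk : MemLp (fun p : (S × unitInterval) × (S × unitInterval) => k p.1 p.2) 2
      ((ν.prod volume).prod (ν.prod volume)))
    (h0 : ∀ᵐ p ∂(ν.prod (volume : Measure unitInterval)), ∀ u, ∫ y, k p (y, u) ∂ν = 0)
    (ψ : Lp ℝ 2 (volume : Measure unitInterval)) :
    integralOp (ν.prod volume) k (pull (measurePreserving_snd (μ := ν)) ψ) = 0 := by
  refine Lp.ext ((integralOp_apply _ hk _).trans ?_)
  filter_upwards [h0, ae_integrable_mul _ hk (Lp.memLp (pull (measurePreserving_snd (μ := ν)) ψ)),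
    Lp.coeFn_zero ℝ 2 (ν.prod (volume : Measure unitInterval))] with p h1 h2 h3
  rw [h3, Pi.zero_apply]
  have e := coeFn_pull (measurePreserving_snd (μ := ν)) ψ
  have e' : (fun q => k p q * pull (measurePreserving_snd (μ := ν)) ψ q) =ᵐ[ν.prod volume]
      fun q => k p q * ψ q.2 := by
    filter_upwards [e] with q hq
    rw [hq]
  rw [integral_congr_ae e', integral_prod_symm _ (h2.congr e')]
  refine integral_eq_zero_of_ae (ae_of_all _ fun u => ?_)
  simp only [integral_mul_const, h1, zero_mul, Pi.zero_apply]

theorem IsDegenerate.integral_hatK (hf : IsDegenerate ν f) :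
    ∀ᵐ p ∂(ν.prod (volume : Measure unitInterval)), ∀ u, ∫ y, AltU.hatK f p (y, u) ∂ν = 0 := by
  filter_upwards [Measure.quasiMeasurePreserving_fst.ae hf.left,
    Measure.quasiMeasurePreserving_fst.ae hf.right] with p h1 h2 u
  unfold AltU.hatK
  dsimp only
  split_ifs
  · exact h2
  · exact h1
  · simp

theorem IsDegenerate.integral_checkK (hf : IsDegenerate ν f) :
    ∀ᵐ p ∂(ν.prod (volume : Measure unitInterval)), ∀ u, ∫ y, AltU.checkK f p (y, u) ∂ν = 0 := by
  filter_upwards [Measure.quasiMeasurePreserving_fst.ae hf.left,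
    Measure.quasiMeasurePreserving_fst.ae hf.right] with p h1 h2 u
  unfold AltU.checkK
  dsimp only
  split_ifs
  · exact h2
  · rw [integral_neg, h1, neg_zero]
  · simp

/-- By symmetry the operator moves onto the function of time, which it annihilates. -/
theorem isCentred_hatK (hf : IsDegenerate ν f) (c) :
    IsCentred ν (integralOp (ν.prod volume) (hatK f) c) := fun ψ => by
  rw [← inner_integralOp_hatK hf, integralOp_pull_snd (memLp_hatK hf.meas hf.memLp)
    hf.integral_hatK, inner_zero_left]

theorem isCentred_checkK (hf : IsDegenerate ν f) (c) :
    IsCentred ν (integralOp (ν.prod volume) (checkK f) c) := fun ψ => by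
  rw [← neg_eq_iff_eq_neg.2 (inner_integralOp_checkK hf _ c),
    integralOp_pull_snd (memLp_checkK hf.meas hf.memLp) hf.integral_checkK, inner_zero_left,
    neg_zero]

/-- An eigenvector with nonzero eigenvalue lies in the range of `altOp`, and both components of that
range are centred. -/
theorem isCentred_of_eigenvector (hf : IsDegenerate ν f) {c : ℝ} (hc : c ≠ 0) {v}
    (hv : altOp ν f v = c • v) : IsCentred ν v.fst ∧ IsCentred ν v.snd := by
  have h1 : c • v.fst = (altOp ν f v).fst := by rw [hv]; rfl
  have h2 : c • v.snd = (altOp ν f v).snd := by rw [hv]; rfl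
  have e1 : v.fst = c⁻¹ • (altOp ν f v).fst := by rw [← h1, smul_smul, inv_mul_cancel₀ hc, one_smul]
  have e2 : v.snd = c⁻¹ • (altOp ν f v).snd := by rw [← h2, smul_smul, inv_mul_cancel₀ hc, one_smul]
  constructor
  · rw [e1, altOp_fst]
    exact (((isCentred_hatK hf _).neg.add (isCentred_checkK hf _)).smul _).smul _
  · rw [e2, altOp_snd]
    exact (((isCentred_checkK hf _).neg.add (isCentred_hatK hf _)).smul _).smul _

theorem inner_pull_snd {A : Type*} [MeasurableSpace A] {α : Measure A} [IsProbabilityMeasure α]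
    (ψ : Lp ℝ 2 (volume : Measure unitInterval))
    (a : Lp ℝ 2 (α.prod (volume : Measure unitInterval))) :
    inner ℝ (pull (measurePreserving_snd (μ := α)) ψ) a = ∫ p, ψ p.2 * a p ∂(α.prod volume) := by
  rw [L2.inner_def]
  refine integral_congr_ae ?_
  filter_upwards [coeFn_pull (measurePreserving_snd (μ := α)) ψ] with p hp
  rw [hp]
  simp [mul_comm]

/-- At a fixed time the two coordinates are independent, so the inner product is the integral of `u`
times `⟨ψ, b⟩`, which vanishes. The maps `q₁` and `q₂` stand for the two coordinates in either
order. -/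
theorem inner_pull_tmul_pull {q₁ q₂ : S × S → S} (h₁ : MeasurePreserving q₁ (ν.prod ν) ν)
    (h₂ : MeasurePreserving q₂ (ν.prod ν) ν) (hind : ∀ F G : S → ℝ,
      ∫ x, F (q₁ x) * G (q₂ x) ∂(ν.prod ν) = (∫ x, F x ∂ν) * ∫ x, G x ∂ν)
    {b} (hb : IsCentred ν b) (u : Lp ℝ 2 ν) (ψ : Lp ℝ 2 (volume : Measure unitInterval)) :
    inner ℝ (pull (h₁.prod (MeasurePreserving.id _)) (tmul u ψ))
      (pull (h₂.prod (MeasurePreserving.id _)) b) = 0 := by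
  have hi := L2.integrable_inner (𝕜 := ℝ) (pull (h₁.prod (MeasurePreserving.id _)) (tmul u ψ))
    (pull (h₂.prod (MeasurePreserving.id _)) b)
  have e : (fun p => inner ℝ (pull (h₁.prod (MeasurePreserving.id _)) (tmul u ψ) p)
      (pull (h₂.prod (MeasurePreserving.id _)) b p)) =ᵐ[(ν.prod ν).prod volume]
      fun p => u (q₁ p.1) * (ψ p.2 * b (q₂ p.1, p.2)) := by
    filter_upwards [coeFn_pull (h₁.prod (MeasurePreserving.id _)) (tmul u ψ),
      coeFn_pull (h₂.prod (MeasurePreserving.id _)) b,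
      (h₁.prod (MeasurePreserving.id volume)).quasiMeasurePreserving.ae (coeFn_tmul u ψ)] with p h1 h2 h3
    rw [h1, h2, h3]
    simp [Prod.map]
    ring
  have hb' := hb ψ
  rw [inner_pull_snd] at hb'
  have hi2 : Integrable (fun p : S × unitInterval => ψ p.2 * b p) (ν.prod volume) := by
    refine (L2.integrable_inner (𝕜 := ℝ) (pull (measurePreserving_snd (μ := ν)) ψ) b).congr ?_
    filter_upwards [coeFn_pull (measurePreserving_snd (μ := ν)) ψ] with p hp
    rw [hp]
    simp [mul_comm]
  rw [L2.inner_def, integral_congr_ae e, integral_prod_symm _ (hi.congr e)]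
  have h4 : ∀ t, ∫ x : S × S, u (q₁ x) * (ψ t * b (q₂ x, t)) ∂(ν.prod ν) =
      (∫ x, u x ∂ν) * ∫ x, ψ t * b (x, t) ∂ν := fun t =>
    hind (fun x => u x) fun x => ψ t * b (x, t)
  simp only [h4]
  rw [integral_const_mul]
  rw [integral_prod_symm _ hi2] at hb'
  rw [hb', mul_zero]

theorem adjoint_pairFst_pairSnd {b} (hb : IsCentred ν b) :
    ContinuousLinearMap.adjoint (pull (measurePreserving_pairFst ν))
      (pull (measurePreserving_pairSnd ν) b) = 0 :=
  eq_zero_of_forall_inner_tmul _ fun u ψ => by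
    rw [ContinuousLinearMap.adjoint_inner_right]
    exact inner_pull_tmul_pull measurePreserving_fst measurePreserving_snd
      (fun F G => integral_prod_mul F G) hb u ψ

theorem adjoint_pairSnd_pairFst {b} (hb : IsCentred ν b) :
    ContinuousLinearMap.adjoint (pull (measurePreserving_pairSnd ν))
      (pull (measurePreserving_pairFst ν) b) = 0 :=
  eq_zero_of_forall_inner_tmul _ fun u ψ => by
    rw [ContinuousLinearMap.adjoint_inner_right]
    refine inner_pull_tmul_pull measurePreserving_snd measurePreserving_fst
      (fun F G => ?_) hb u ψ
    simp only [mul_comm (F _)]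
    rw [integral_prod_mul G F, mul_comm]

theorem adjoint_pull_self {E Y : Type*} [MeasurableSpace E] [MeasurableSpace Y] {π : Measure E}
    {κ : Measure Y} [IsProbabilityMeasure π] [IsProbabilityMeasure κ] {q : E → Y}
    (hq : MeasurePreserving q π κ) (a : Lp ℝ 2 κ) :
    ContinuousLinearMap.adjoint (pull hq) (pull hq a) = a := by
  refine ext_inner_left ℝ fun b => ?_
  rw [ContinuousLinearMap.adjoint_inner_right, inner_pull_pull]

/-- Centred functions lifted through different coordinates are orthogonal, so no cross terms
survive. Hence the lift preserves inner products of pairs with centred components. -/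
theorem pairProj_pairLift {v} (h1 : IsCentred ν v.fst) (h2 : IsCentred ν v.snd) :
    pairProj ν (pairLift ν v) = v := by
  rw [pairProj, pairLift, map_add, map_add, adjoint_pull_self, adjoint_pull_self,
    adjoint_pairFst_pairSnd h2, adjoint_pairSnd_pairFst h1, add_zero, zero_add]
  rfl

theorem integral_pull {E Y : Type*} [MeasurableSpace E] [MeasurableSpace Y] {π : Measure E}
    {κ : Measure Y} [IsProbabilityMeasure π] [IsProbabilityMeasure κ] {q : E → Y}
    (hq : MeasurePreserving q π κ) (a : Lp ℝ 2 κ) : ∫ x, pull hq a x ∂π = ∫ y, a y ∂κ := by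
  rw [integral_congr_ae (coeFn_pull hq a)]
  have h := integral_map (f := fun y => a y) hq.measurable.aemeasurable
    (by rw [hq.map_eq]; exact (Lp.memLp a).1)
  rw [← h, hq.map_eq]

theorem IsCentred.integral_eq_zero {a} (ha : IsCentred ν a) :
    ∫ p, a p ∂(ν.prod (volume : Measure unitInterval)) = 0 := by
  have h := ha ((memLp_const (1 : ℝ)).toLp _)
  rw [inner_pull_snd] at h
  rw [← h]
  refine integral_congr_ae ?_
  filter_upwards [Measure.quasiMeasurePreserving_snd.ae
    (MemLp.coeFn_toLp (memLp_const (μ := (volume : Measure unitInterval)) (p := 2) (1 : ℝ)))]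
    with p hp
  rw [hp, one_mul]

theorem integral_pairLift {v} (h1 : IsCentred ν v.fst) (h2 : IsCentred ν v.snd) :
    ∫ x, pairLift ν v x ∂((ν.prod ν).prod volume) = 0 := by
  rw [pairLift, integral_congr_ae (Lp.coeFn_add _ _)]
  simp only [Pi.add_apply]
  rw [integral_add ((Lp.memLp _).integrable (by norm_num)) ((Lp.memLp _).integrable (by norm_num)),
    integral_pull, integral_pull, h1.integral_eq_zero, h2.integral_eq_zero, add_zero]

end AltOp


/-! ### Expansion of the symmetrized pair kernel -/

section Expansion

variable {S : Type*} [MeasurableSpace S] {ν : Measure S} [IsProbabilityMeasure ν] {f : S → S → ℝ}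

theorem norm_sq_toLp_hatK_pairKernel (hf : IsDegenerate ν f) :
    ‖hf.pairKernel.hatK.memLp.toLp _‖ ^ 2 = 4 * kernelNormSq ν f := by
  rw [← kernelNormSq_eq_norm_sq hf.pairKernel.hatK.memLp, kernelNormSq_hatK hf.pairKernel,
    kernelNormSq_pairKernel hf]

variable {ι : Type*} {lam : ι → ℝ}
  {v : ι → WithLp 2 (Lp ℝ 2 (ν.prod (volume : Measure unitInterval)) ×
    Lp ℝ 2 (ν.prod (volume : Measure unitInterval)))}

theorem pairProj_pairLift_eigenvector (hf : IsDegenerate ν f)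
    (hl : ∀ r, altOp ν f (v r) = lam r • v r) (h0 : ∀ r, lam r ≠ 0) (r : ι) :
    pairProj ν (pairLift ν (v r)) = v r :=
  pairProj_pairLift (isCentred_of_eigenvector hf (h0 r) (hl r)).1
    (isCentred_of_eigenvector hf (h0 r) (hl r)).2

theorem orthonormal_pairLift (hf : IsDegenerate ν f) (hv : Orthonormal ℝ v)
    (hl : ∀ r, altOp ν f (v r) = lam r • v r) (h0 : ∀ r, lam r ≠ 0) :
    Orthonormal ℝ fun r => pairLift ν (v r) := by
  classical
  rw [orthonormal_iff_ite] at hv ⊢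
  intro r s
  rw [inner_pairLift, pairProj_pairLift_eigenvector hf hl h0, hv]

/-- The coefficients of the kernel along the lifted tensors are `2 * lam r`, and by `hsum` their
squares exhaust its squared norm: equality in Bessel's inequality. Completeness of the eigenvectors
enters only through this numerical condition, which also suits explicit eigenvectors. -/
theorem hasSum_tmul_pairLift (hf : IsDegenerate ν f) (hv : Orthonormal ℝ v)
    (hl : ∀ r, altOp ν f (v r) = lam r • v r) (h0 : ∀ r, lam r ≠ 0)
    (hsum : HasSum (fun r => lam r ^ 2) (kernelNormSq ν f)) :
    HasSum (fun r => (2 * lam r) • tmul (pairLift ν (v r)) (pairLift ν (v r)))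
      (hf.pairKernel.hatK.memLp.toLp _) := by
  have hort := orthonormal_tmul_star (orthonormal_pairLift hf hv hl h0)
  simp only [star_trivial] at hort
  have hin : ∀ r, inner ℝ (tmul (pairLift ν (v r)) (pairLift ν (v r)))
      (hf.pairKernel.hatK.memLp.toLp _) = 2 * lam r := by
    intro r
    rw [← inner_integralOp_real hf.pairKernel.hatK.memLp, inner_integralOp_pairKernel hf,
      pairProj_pairLift_eigenvector hf hl h0, hl, inner_smul_right, real_inner_self_eq_norm_sq,
      hv.1 r]
    ring
  have h := hasSum_of_hasSum_norm_sq hort (hf.pairKernel.hatK.memLp.toLp _) (by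
    simp only [hin]
    rw [norm_sq_toLp_hatK_pairKernel hf]
    refine (hsum.mul_left 4).congr_fun ?_
    intro r
    rw [Real.norm_eq_abs, sq_abs]
    ring)
  simpa only [hin] using h

/-- The lifts are eigenvectors of the symmetrized pair operator with eigenvalues `2 * lam r`, and
this operator annihilates what is orthogonal to them. Comparing norms in the kernel expansion, the
factor 4 appears on both sides. -/
theorem hasSum_sq_eigenvalues (hf : IsDegenerate ν f) (hv : Orthonormal ℝ v)
    (hl : ∀ r, altOp ν f (v r) = lam r • v r) (h0 : ∀ r, lam r ≠ 0)
    (hc : ∀ w, (∀ r, inner ℝ (v r) w = 0) → altOp ν f w = 0) :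
    HasSum (fun r => lam r ^ 2) (kernelNormSq ν f) := by
  have hort := orthonormal_pairLift hf hv hl h0
  have h := hasSum_kernel hort (hf.pairKernel.hatK.memLp.toLp _) (fun r => 2 * lam r)
    (fun r => by
      rw [← integralOp_eq_kerOp]
      refine ext_inner_left ℝ fun w => ?_
      rw [inner_integralOp_pairKernel hf, pairProj_pairLift_eigenvector hf hl h0, hl,
        inner_smul_right, inner_smul_right, real_inner_comm, ← inner_pairLift, real_inner_comm]
      ring)
    (fun w hw => by
      rw [← integralOp_eq_kerOp]
      refine ext_inner_left ℝ fun u => ?_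
      rw [inner_integralOp_pairKernel hf, hc _ fun r => by rw [← inner_pairLift, hw],
        inner_zero_right, inner_zero_right, mul_zero])
  have h2 := hasSum_norm_sq_of_orthonormal (orthonormal_tmul_star hort) h
  rw [norm_sq_toLp_hatK_pairKernel hf] at h2
  have h3 := h2.mul_left (1 / 4)
  rw [show 1 / 4 * (4 * kernelNormSq ν f) = kernelNormSq ν f by ring] at h3
  refine h3.congr_fun fun r => ?_
  rw [Real.norm_eq_abs, sq_abs]
  ring

end Expansion

/-! ### The alternating statistic -/

section Statistic

theorem sum_range_two_mul {M : Type*} [AddCommMonoid M] (F : ℕ → M) (m : ℕ) :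
    ∑ i ∈ Finset.range (2 * m), F i = ∑ k ∈ Finset.range m, (F (2 * k) + F (2 * k + 1)) := by
  induction m with
  | zero => simp
  | succ m ih =>
    rw [Finset.sum_range_succ, ← ih, show 2 * (m + 1) = 2 * m + 1 + 1 by ring,
      Finset.sum_range_succ, Finset.sum_range_succ, add_assoc]

theorem Upm_succ {S : Type*} (f : S → S → ℝ) (x : ℕ → S) (n : ℕ) :
    Upm f x (n + 1) = Upm f x n + ∑ i ∈ Finset.range n, (-1 : ℝ) ^ (n + 1) * f (x i) (x n) := by
  rw [Upm, Finset.sum_range_succ]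
  rfl

/-- With indices counted from 0, the second argument carries the sign `-1` at even and `+1` at odd
positions, as in `pairKernel`. The last sum collects the terms within a pair. -/
theorem Upm_two_mul {S : Type*} (f : S → S → ℝ) (x : ℕ → S) (m : ℕ) :
    Upm f x (2 * m) =
      ∑ p ∈ ltPairs m, pairKernel f (x (2 * p.1), x (2 * p.1 + 1)) (x (2 * p.2), x (2 * p.2 + 1)) +
        ∑ k ∈ Finset.range m, f (x (2 * k)) (x (2 * k + 1)) := by
  rw [sum_ltPairs m fun i j => pairKernel f (x (2 * i), x (2 * i + 1)) (x (2 * j), x (2 * j + 1))]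
  induction m with
  | zero => simp [Upm]
  | succ m ih =>
    have hp : (-1 : ℝ) ^ (2 * m + 1) = -1 := by rw [pow_succ, pow_mul]; simp
    rw [show 2 * (m + 1) = 2 * m + 1 + 1 by ring, Upm_succ, Upm_succ, ih, Finset.sum_range_succ,
      Finset.sum_range_succ (fun k => f (x (2 * k)) (x (2 * k + 1))),
      Finset.sum_range_succ _ m, pow_succ _ (2 * m + 1), hp, sum_range_two_mul,
      sum_range_two_mul]
    have e : ∑ i ∈ Finset.range m, pairKernel f (x (2 * i), x (2 * i + 1))
          (x (2 * m), x (2 * m + 1)) =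
        ∑ k ∈ Finset.range m, (-1 * f (x (2 * k)) (x (2 * m)) +
          -1 * f (x (2 * k + 1)) (x (2 * m))) +
        ∑ k ∈ Finset.range m, (-1 * -1 * f (x (2 * k)) (x (2 * m + 1)) +
          -1 * -1 * f (x (2 * k + 1)) (x (2 * m + 1))) := by
      rw [← Finset.sum_add_distrib]
      refine Finset.sum_congr rfl fun k _ => ?_
      simp only [pairKernel]
      ring
    rw [e]
    ring

variable {Ω S : Type*} [MeasurableSpace Ω] [MeasurableSpace S] {P : Measure Ω}
  [IsProbabilityMeasure P] {ν : Measure S} [IsProbabilityMeasure ν] {X : ℕ → Ω → S} {f : S → S → ℝ}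

theorem Upm_eq_sum_ltPairs {S : Type*} (f : S → S → ℝ) (x : ℕ → S) (n : ℕ) :
    Upm f x n = ∑ p ∈ ltPairs n, (-1 : ℝ) ^ (p.2 + 1) * f (x p.1) (x p.2) :=
  (sum_ltPairs n fun i j => (-1 : ℝ) ^ (j + 1) * f (x i) (x j)).symm

theorem IsIID.memLp_Upm (hX : IsIID P ν X)
    (hf : MemLp (fun p : S × S => f p.1 p.2) 2 (ν.prod ν)) (n : ℕ) :
    MemLp (fun ω => Upm f (fun i => X i ω) n) 2 P := by
  simp only [Upm_eq_sum_ltPairs]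
  exact memLp_finsetSum _ fun p hp => (hX.memLp_pair (lt_of_mem_ltPairs hp).ne hf).const_mul _

theorem IsIID.integral_sq_Upm (hX : IsIID P ν X) (hf : IsDegenerate ν f) (n : ℕ) :
    ∫ ω, Upm f (fun i => X i ω) n ^ 2 ∂P = n * (n - 1) / 2 * kernelNormSq ν f := by
  simp only [Upm_eq_sum_ltPairs]
  rw [hX.integral_sq_sum hf _ fun p hp => lt_of_mem_ltPairs hp]
  congr 1
  rw [← card_ltPairs, Finset.card_eq_sum_ones]
  push_cast
  refine Finset.sum_congr rfl fun p _ => ?_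
  rw [← pow_mul, mul_comm, pow_mul]
  simp

theorem IsIID.integral_sq_sum_image (hX : IsIID P ν X) (hf : IsDegenerate ν f) (m : ℕ)
    (p : ℕ → ℕ × ℕ) (hp : Set.InjOn p (Finset.range m)) (hlt : ∀ i < m, (p i).1 < (p i).2)
    (c : ℝ) :
    ∫ ω, (∑ i ∈ Finset.range m, c * f (X (p i).1 ω) (X (p i).2 ω)) ^ 2 ∂P =
      m * c ^ 2 * kernelNormSq ν f := by
  classical
  have h := hX.integral_sq_sum hf ((Finset.range m).image p) (fun q hq => by
    obtain ⟨i, hi, rfl⟩ := Finset.mem_image.1 hq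
    exact hlt i (Finset.mem_range.1 hi)) fun _ => c
  simp only [Finset.sum_image hp] at h
  rw [h]
  simp

/-- The `m` terms within pairs are orthogonal, so after division by `2 m` their sum has second
moment of order `1 / m`. -/
theorem IsIID.tendsto_charFun_Upm_two_mul (hX : IsIID P ν X) (hf : IsDegenerate ν f) {t : ℝ} {L : ℂ}
    (h : Tendsto (fun m : ℕ => charFun (P.map fun ω => ((2 * m : ℕ) : ℝ)⁻¹ * ∑ p ∈ ltPairs m,
        pairKernel f (X (2 * p.1) ω, X (2 * p.1 + 1) ω) (X (2 * p.2) ω, X (2 * p.2 + 1) ω)) t)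
      atTop (𝓝 L)) :
    Tendsto (fun m : ℕ => charFun (P.map fun ω =>
      ((2 * m : ℕ) : ℝ)⁻¹ * Upm f (fun i => X i ω) (2 * m)) t) atTop (𝓝 L) := by
  refine tendsto_charFun_of_sub (fun m => (hX.memLp_Upm hf.memLp _).const_mul _)
    (fun m => (memLp_finsetSum _ fun p hp => hX.pairs.memLp_pair (lt_of_mem_ltPairs hp).ne
      hf.pairKernel.memLp).const_mul _) ?_ h
  have e : ∀ (m : ℕ), ∫ ω, (((2 * m : ℕ) : ℝ)⁻¹ * Upm f (fun i => X i ω) (2 * m) -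
      ((2 * m : ℕ) : ℝ)⁻¹ * ∑ p ∈ ltPairs m, pairKernel f (X (2 * p.1) ω, X (2 * p.1 + 1) ω)
        (X (2 * p.2) ω, X (2 * p.2 + 1) ω)) ^ 2 ∂P =
      m * ((2 * m : ℕ) : ℝ)⁻¹ ^ 2 * kernelNormSq ν f := by
    intro m
    rw [← hX.integral_sq_sum_image hf m (fun k => (2 * k, 2 * k + 1))
      (fun a _ b _ hab => by simp only [Prod.mk.injEq] at hab; omega) (fun i _ => by simp)]
    refine integral_congr_ae (ae_of_all _ fun ω => ?_)
    simp only [Upm_two_mul, ← Finset.mul_sum]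
    ring
  simp only [e]
  have h1 : Tendsto (fun m : ℕ => (1 / 4) * (m : ℝ)⁻¹ * kernelNormSq ν f) atTop (𝓝 0) := by
    have := ((tendsto_inv_atTop_nhds_zero_nat (𝕜 := ℝ)).const_mul (1 / 4)).mul_const
      (kernelNormSq ν f)
    simpa using this
  refine h1.congr fun m => ?_
  rcases Nat.eq_zero_or_pos m with rfl | hm
  · simp
  · have : (m : ℝ) ≠ 0 := by positivity
    push_cast
    field_simp
    ring

/-- Passing from `2 m` to `2 m + 1` variables adds one row and changes the normalization; either
effect has second moment of order `1 / m`. -/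
theorem IsIID.tendsto_charFun_Upm_of_even (hX : IsIID P ν X) (hf : IsDegenerate ν f) {t : ℝ} {L : ℂ}
    (h : Tendsto (fun m : ℕ => charFun (P.map fun ω =>
      ((2 * m : ℕ) : ℝ)⁻¹ * Upm f (fun i => X i ω) (2 * m)) t) atTop (𝓝 L)) :
    Tendsto (fun n : ℕ => charFun (P.map fun ω => (n : ℝ)⁻¹ * Upm f (fun i => X i ω) n) t)
      atTop (𝓝 L) := by
  have hodd : Tendsto (fun m : ℕ => charFun (P.map fun ω =>
      ((2 * m + 1 : ℕ) : ℝ)⁻¹ * Upm f (fun i => X i ω) (2 * m + 1)) t) atTop (𝓝 L) := by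
    refine tendsto_charFun_of_sub (fun m => (hX.memLp_Upm hf.memLp _).const_mul _)
      (fun m => (hX.memLp_Upm hf.memLp _).const_mul _) ?_ h
    let a : ℕ → ℝ := fun m => ((2 * m + 1 : ℕ) : ℝ)⁻¹
    let b : ℕ → ℝ := fun m => ((2 * m : ℕ) : ℝ)⁻¹
    have hb : ∀ (m : ℕ), ∫ ω, (a m * Upm f (fun i => X i ω) (2 * m + 1) -
        b m * Upm f (fun i => X i ω) (2 * m)) ^ 2 ∂P ≤ (m : ℝ)⁻¹ * (2 * kernelNormSq ν f) := by
      intro m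
      have hU := hX.memLp_Upm hf.memLp (2 * m)
      have hR : MemLp (fun ω => ∑ i ∈ Finset.range (2 * m),
          ((-1 : ℝ) ^ (2 * m + 1) * a m) * f (X i ω) (X (2 * m) ω)) 2 P :=
        memLp_finsetSum _ fun i hi => (hX.memLp_pair (Finset.mem_range.1 hi).ne hf.memLp).const_mul _
      have e1 : ∀ ω, (a m * Upm f (fun i => X i ω) (2 * m + 1) -
          b m * Upm f (fun i => X i ω) (2 * m)) ^ 2 ≤
          2 * (a m - b m) ^ 2 * Upm f (fun i => X i ω) (2 * m) ^ 2 +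
          2 * (∑ i ∈ Finset.range (2 * m),
            ((-1 : ℝ) ^ (2 * m + 1) * a m) * f (X i ω) (X (2 * m) ω)) ^ 2 := by
        intro ω
        have : ∑ i ∈ Finset.range (2 * m),
            ((-1 : ℝ) ^ (2 * m + 1) * a m) * f (X i ω) (X (2 * m) ω) =
            a m * ∑ i ∈ Finset.range (2 * m), (-1 : ℝ) ^ (2 * m + 1) * f (X i ω) (X (2 * m) ω) := by
          rw [Finset.mul_sum]
          exact Finset.sum_congr rfl fun i _ => by ring
        rw [Upm_succ, this]
        generalize Upm f (fun i => X i ω) (2 * m) = u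
        generalize ∑ i ∈ Finset.range (2 * m), (-1 : ℝ) ^ (2 * m + 1) * f (X i ω) (X (2 * m) ω) = w
        nlinarith [sq_nonneg ((a m - b m) * u - a m * w)]
      have i1 := hU.integrable_sq.const_mul (2 * (a m - b m) ^ 2)
      have i2 := hR.integrable_sq.const_mul 2
      refine (integral_mono ((((hX.memLp_Upm hf.memLp _).const_mul _).sub
        (hU.const_mul _)).integrable_sq) (i1.add i2) e1).trans ?_
      have h3 := hX.integral_sq_sum_image hf (2 * m) (fun i => (i, 2 * m))
        (fun i _ j _ hij => (Prod.mk.inj hij).1) (fun i hi => hi) ((-1 : ℝ) ^ (2 * m + 1) * a m)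
      have h4 := integral_add i1 i2
      simp only [Pi.add_apply] at h4 ⊢
      rw [h4, integral_const_mul, integral_const_mul, hX.integral_sq_Upm hf, h3, mul_pow, ← pow_mul,
        mul_comm (2 * m + 1) 2, pow_mul]
      have hk := kernelNormSq_nonneg ν f
      rcases Nat.eq_zero_or_pos m with rfl | hm
      · simp
      · have hm' : (1 : ℝ) ≤ m := by exact_mod_cast hm
        have e5 : 2 * (a m - b m) ^ 2 * (((2 * m : ℕ) : ℝ) * (((2 * m : ℕ) : ℝ) - 1) / 2) +
            2 * (((2 * m : ℕ) : ℝ) * a m ^ 2) ≤ (m : ℝ)⁻¹ * 2 := by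
          simp only [a, b]
          push_cast
          have e6 : 2 * ((2 * (m : ℝ) + 1)⁻¹ - (2 * (m : ℝ))⁻¹) ^ 2 *
              (2 * m * (2 * m - 1) / 2) + 2 * (2 * m * (2 * (m : ℝ) + 1)⁻¹ ^ 2) =
              (4 * m ^ 2 + (2 * m - 1) / 2) / (m * (2 * m + 1) ^ 2) := by
            field_simp
            ring
          rw [e6, ← div_eq_inv_mul, div_le_div_iff₀ (by positivity) (by positivity)]
          nlinarith [mul_nonneg (by linarith : (0 : ℝ) ≤ m) (by linarith : (0 : ℝ) ≤ m),
            mul_nonneg (by linarith : (0 : ℝ) ≤ m) (mul_nonneg (by linarith : (0 : ℝ) ≤ m)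
              (by linarith : (0 : ℝ) ≤ m))]
        have e7 := mul_le_mul_of_nonneg_right e5 hk
        simp only [even_two, Even.neg_pow, one_pow, one_mul]
        calc _ = _ := by ring
          _ ≤ _ := e7
          _ = _ := by ring
    refine squeeze_zero (fun m => integral_nonneg fun _ => sq_nonneg _) hb ?_
    simpa using (tendsto_inv_atTop_nhds_zero_nat (𝕜 := ℝ)).mul_const (2 * kernelNormSq ν f)
  -- The even and odd subsequences have the same limit and together cover all indices.
  rw [tendsto_iff_forall_eventually_mem] at h hodd ⊢
  intro s hs
  obtain ⟨M, hM⟩ := eventually_atTop.1 ((h s hs).and (hodd s hs))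
  filter_upwards [eventually_ge_atTop (2 * M + 1)] with n hn
  rcases Nat.even_or_odd' n with ⟨m, rfl | rfl⟩
  · exact (hM m (by omega)).1
  · exact (hM m (by omega)).2

/-- The limit law of the alternating statistic with a degenerate kernel, in terms of a complete
orthonormal family of eigenvectors of `altOp`. -/
theorem IsIID.tendsto_charFun_Upm (hX : IsIID P ν X) (hf : IsDegenerate ν f) {ι : Type}
    {lam : ι → ℝ} {v : ι → WithLp 2 (Lp ℝ 2 (ν.prod (volume : Measure unitInterval)) ×
      Lp ℝ 2 (ν.prod (volume : Measure unitInterval)))} (hv : Orthonormal ℝ v)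
    (hl : ∀ r, altOp ν f (v r) = lam r • v r) (h0 : ∀ r, lam r ≠ 0)
    (hsum : HasSum (fun r => lam r ^ 2) (kernelNormSq ν f)) (t : ℝ) :
    ∃ L, HasProd (fun r => charFun chiLaw (lam r * t)) L ∧
      Tendsto (fun n : ℕ => charFun (P.map fun ω => (n : ℝ)⁻¹ * Upm f (fun i => X i ω) n) t)
        atTop (𝓝 L) := by
  -- Evaluation at `t / 2` turns the normalization `1 / m` into `1 / (2 m)` and cancels the doubling
  -- of the eigenvalues.
  obtain ⟨L, hL, hlim⟩ := hX.pairs.tendsto_charFun_asymmetric hf.pairKernel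
    (orthonormal_pairLift hf hv hl h0) (fun r => integral_pairLift
      (isCentred_of_eigenvector hf (h0 r) (hl r)).1 (isCentred_of_eigenvector hf (h0 r) (hl r)).2)
    (hasSum_tmul_pairLift hf hv hl h0 hsum) (t / 2)
  refine ⟨L, ?_, hX.tendsto_charFun_Upm_of_even hf (hX.tendsto_charFun_Upm_two_mul hf ?_)⟩
  · convert hL using 3
    ring
  · refine hlim.congr fun m => ?_
    have hm : Measurable fun ω => ∑ p ∈ ltPairs m,
        pairKernel f (X (2 * p.1) ω, X (2 * p.1 + 1) ω) (X (2 * p.2) ω, X (2 * p.2 + 1) ω) :=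
      Finset.measurable_fun_sum _ fun p _ => hf.pairKernel.meas.comp
        (f := fun ω => ((X (2 * p.1) ω, X (2 * p.1 + 1) ω), (X (2 * p.2) ω, X (2 * p.2 + 1) ω)))
        (((hX.meas _).prodMk (hX.meas _)).prodMk ((hX.meas _).prodMk (hX.meas _)))
    rw [charFun_map_eq (hm.const_mul _).aemeasurable, charFun_map_eq (hm.const_mul _).aemeasurable]
    refine integral_congr_ae (ae_of_all _ fun ω => ?_)
    simp only
    congr 2
    rw [← Complex.ofReal_mul, ← Complex.ofReal_mul]
    congr 1
    push_cast
    rw [mul_inv]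
    ring

end Statistic


/-! ### The frequencies `(k + 1/2) π` and the stochastic area laws -/

section Frequencies

/-- The zeros of the cosine. -/
noncomputable def freq (k : ℤ) : ℝ := (k + 1 / 2) * Real.pi

theorem freq_ne_zero (k : ℤ) : freq k ≠ 0 := by
  refine mul_ne_zero (fun h => ?_) Real.pi_ne_zero
  have h1 : (2 * k + 1 : ℝ) = 0 := by linarith
  have h2 : 2 * k + 1 = 0 := by exact_mod_cast h1
  omega

/-- The reflection `k ↦ -(k + 1)` pairs the frequencies with their opposites. -/
theorem freq_neg (k : ℤ) : freq (-(k + 1)) = -freq k := by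
  simp only [freq]
  push_cast
  ring

theorem cos_freq (k : ℤ) : Real.cos (freq k) = 0 :=
  Real.cos_eq_zero_iff.2 ⟨k, by rw [freq]; ring⟩

/-- The sum of all inverse squares, `π² / 6`, minus its even part, which is a quarter of it. -/
theorem hasSum_inv_odd_sq :
    HasSum (fun k : ℕ => 1 / ((2 * k + 1 : ℕ) : ℝ) ^ 2) (Real.pi ^ 2 / 8) := by
  have he : HasSum (fun k : ℕ => 1 / ((2 * k : ℕ) : ℝ) ^ 2) (Real.pi ^ 2 / 24) := by
    have h := hasSum_zeta_two.mul_left (1 / 4)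
    rw [show 1 / 4 * (Real.pi ^ 2 / 6) = Real.pi ^ 2 / 24 by ring] at h
    refine h.congr_fun fun k => ?_
    push_cast
    rw [mul_pow]
    ring
  have ho : Summable fun k : ℕ => 1 / ((2 * k + 1 : ℕ) : ℝ) ^ 2 :=
    hasSum_zeta_two.summable.comp_injective fun a b (h : 2 * a + 1 = 2 * b + 1) => by omega
  have h := (he.even_add_odd (f := fun n : ℕ => 1 / (n : ℝ) ^ 2) ho.hasSum).unique hasSum_zeta_two
  have e : ∑' k : ℕ, 1 / ((2 * k + 1 : ℕ) : ℝ) ^ 2 = Real.pi ^ 2 / 8 := by linarith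
  rw [← e]
  exact ho.hasSum

/-- The total 1 is what lets the trigonometric eigenvectors exhaust the Hilbert–Schmidt norm. -/
theorem hasSum_inv_freq_sq : HasSum (fun k : ℤ => (1 / freq k) ^ 2) 1 := by
  have hpi := Real.pi_ne_zero
  have h : HasSum (fun k : ℕ => (1 / freq (k : ℤ)) ^ 2) (1 / 2) := by
    have h := hasSum_inv_odd_sq.mul_left (4 / Real.pi ^ 2)
    rw [show 4 / Real.pi ^ 2 * (Real.pi ^ 2 / 8) = 1 / 2 by field_simp; norm_num] at h
    refine h.congr_fun fun k => ?_
    simp only [freq]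
    push_cast
    have : (2 * k + 1 : ℝ) ≠ 0 := by positivity
    have : (k + 1 / 2 : ℝ) ≠ 0 := by positivity
    field_simp
    ring
  have h2 := h.of_nat_of_neg_add_one (f := fun k : ℤ => (1 / freq k) ^ 2) (by
    simpa only [freq_neg, div_neg, neg_sq] using h)
  rwa [show (1 / 2 + 1 / 2 : ℝ) = 1 by norm_num] at h2

theorem prod_range_two_mul {M : Type*} [CommMonoid M] (F : ℕ → M) (m : ℕ) :
    ∏ i ∈ Finset.range (2 * m), F i = ∏ k ∈ Finset.range m, (F (2 * k) * F (2 * k + 1)) := by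
  induction m with
  | zero => simp
  | succ m ih =>
    rw [Finset.prod_range_succ, ← ih, show 2 * (m + 1) = 2 * m + 1 + 1 by ring,
      Finset.prod_range_succ, Finset.prod_range_succ, mul_assoc]

/-- Since `cosh x = sinh (2 x) / (2 sinh x)`, this is a quotient of Euler products: in the product
for `sinh (2 x)` the factors at even multiples of `π` are those of `sinh x`, and the odd ones
remain. -/
theorem tendsto_prod_cosh (x : ℝ) :
    Tendsto (fun n : ℕ => ∏ k ∈ Finset.range n, (1 + (x / freq (k : ℤ)) ^ 2)) atTop
      (𝓝 (Real.cosh x)) := by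
  rcases eq_or_ne x 0 with rfl | hx
  · simp
  have hpi := Real.pi_ne_zero
  have hpic : (Real.pi : ℂ) ≠ 0 := by exact_mod_cast hpi
  have hxc : (x : ℂ) ≠ 0 := by exact_mod_cast hx
  -- the Euler product of `sinh`
  have hs : ∀ y : ℝ, Tendsto (fun n : ℕ =>
      y * ∏ j ∈ Finset.range n, (1 + y ^ 2 / (Real.pi ^ 2 * (j + 1) ^ 2))) atTop
      (𝓝 (Real.sinh y)) := by
    intro y
    have h := Complex.tendsto_euler_sin_prod (Complex.I * y / Real.pi)
    have h2 := h.const_mul (-Complex.I)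
    rw [mul_div_cancel₀ _ hpic, mul_comm Complex.I (y : ℂ), Complex.sin_mul_I] at h2
    rw [show -Complex.I * (Complex.sinh y * Complex.I) = ((Real.sinh y : ℝ) : ℂ) by
      push_cast; linear_combination (-Complex.sinh y) * Complex.I_mul_I] at h2
    have h3 := (Complex.continuous_re.tendsto _).comp h2
    rw [Complex.ofReal_re] at h3
    refine h3.congr fun n => ?_
    rw [← Complex.ofReal_re (y * ∏ j ∈ Finset.range n, (1 + y ^ 2 / (Real.pi ^ 2 * (j + 1) ^ 2)))]
    simp only [Function.comp_apply]
    congr 1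
    push_cast
    have e : ∀ j : ℕ, (1 - (y * Complex.I / Real.pi) ^ 2 / ((j : ℂ) + 1) ^ 2) =
        1 + (y : ℂ) ^ 2 / (Real.pi ^ 2 * (j + 1) ^ 2) := by
      intro j
      rw [div_pow, mul_pow, Complex.I_sq, div_div]
      ring
    simp only [e]
    linear_combination (-(y : ℂ) * ∏ j ∈ Finset.range n,
      (1 + (y : ℂ) ^ 2 / (Real.pi ^ 2 * (j + 1) ^ 2))) * Complex.I_mul_I
  have h1 := hs x
  have h2 := (hs (2 * x)).comp (tendsto_id.const_mul_atTop' (by norm_num : 0 < 2))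
  have hsx : 2 * Real.sinh x ≠ 0 := mul_ne_zero two_ne_zero (by rwa [Ne, Real.sinh_eq_zero])
  have h3 := h2.div (h1.const_mul 2) hsx
  rw [Real.sinh_two_mul, mul_div_cancel_left₀ _ hsx] at h3
  refine h3.congr fun n => ?_
  simp only [Pi.div_apply, Function.comp_apply, id]
  rw [prod_range_two_mul, Finset.prod_mul_distrib]
  have e1 : ∀ k : ℕ, 1 + (2 * x) ^ 2 / (Real.pi ^ 2 * (((2 * k : ℕ) : ℝ) + 1) ^ 2) =
      1 + (x / freq (k : ℤ)) ^ 2 := by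
    intro k
    simp only [freq]
    push_cast
    have : (2 * k + 1 : ℝ) ≠ 0 := by positivity
    have : (k + 1 / 2 : ℝ) ≠ 0 := by positivity
    field_simp
  have e2 : ∀ k : ℕ, 1 + (2 * x) ^ 2 / (Real.pi ^ 2 * (((2 * k + 1 : ℕ) : ℝ) + 1) ^ 2) =
      1 + x ^ 2 / (Real.pi ^ 2 * ((k : ℝ) + 1) ^ 2) := by
    intro k
    push_cast
    have : (k + 1 : ℝ) ≠ 0 := by positivity
    have : (2 * k + 1 + 1 : ℝ) ≠ 0 := by positivity
    field_simp
    ring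
  simp only [e1, e2]
  have hne : ∏ k ∈ Finset.range n, (1 + x ^ 2 / (Real.pi ^ 2 * ((k : ℝ) + 1) ^ 2)) ≠ 0 :=
    (Finset.prod_pos fun k _ => by positivity).ne'
  field_simp

theorem hasSum_mul_inv_freq_sq {ι : Type*} {s : ι → ℝ} {c : ℝ} (hs : HasSum (fun r => s r ^ 2) c) :
    HasSum (fun p : ι × ℤ => (s p.1 / freq p.2) ^ 2) c := by
  have h := hs.mul hasSum_inv_freq_sq (hs.summable.mul_of_nonneg hasSum_inv_freq_sq.summable
    (fun _ => sq_nonneg _) fun _ => sq_nonneg _)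
  rw [mul_one] at h
  exact h.congr_fun fun p => by rw [← mul_pow, mul_one_div]

/-- Unconditional convergence comes from the Gaussian sum. The value may then be found along any
exhaustion: pairing `k` with `-(k + 1)` leaves the partial products of `1 / √(cosh s)`. -/
theorem hasProd_charFun_chiLaw (s : ℝ) :
    HasProd (fun k : ℤ => charFun chiLaw (s / freq k)) ((1 / √(Real.cosh s) : ℝ) : ℂ) := by
  obtain ⟨Ω', _, P', _, ζ, W, -, -, -, -, h⟩ := exists_gaussian_l2Sum ℤ hasSum_inv_freq_sq
  have h1 : HasProd (fun k : ℤ => charFun chiLaw (s / freq k)) (charFun (P'.map W) s) :=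
    (h s).congr_fun fun k => by rw [one_div_mul_eq_div]
  have h2 := h1.nat_mul_neg_add_one.tendsto_prod_nat
  have h3 : Tendsto (fun n : ℕ => ((1 / √(∏ k ∈ Finset.range n,
      (1 + (s / freq (k : ℤ)) ^ 2)) : ℝ) : ℂ)) atTop (𝓝 ((1 / √(Real.cosh s) : ℝ) : ℂ)) :=
    (Complex.continuous_ofReal.tendsto _).comp (tendsto_const_nhds.div
      (tendsto_prod_cosh s).sqrt (Real.sqrt_pos.2 (Real.cosh_pos s)).ne')
  have e : ∀ n : ℕ, ∏ k ∈ Finset.range n, (charFun chiLaw (s / freq (k : ℤ)) *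
      charFun chiLaw (s / freq (-((k : ℤ) + 1)))) =
      ((1 / √(∏ k ∈ Finset.range n, (1 + (s / freq (k : ℤ)) ^ 2)) : ℝ) : ℂ) := by
    intro n
    simp only [freq_neg, div_neg, charFun_chiLaw_mul_neg]
    rw [← Complex.ofReal_prod, Real.sqrt_prod _ fun k _ => by positivity]
    simp only [one_div, Finset.prod_inv_distrib]
  rw [tendsto_nhds_unique h3 (h2.congr e)]
  exact h1

/-- The product of the characteristic functions along the frequencies. -/
theorem hasProd_of_hasProd_freq {ι : Type*} {s : ι → ℝ} {t : ℝ} {L : ℂ}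
    (h : HasProd (fun p : ι × ℤ => charFun chiLaw (s p.1 / freq p.2 * t)) L) :
    HasProd (fun r => ((1 / √(Real.cosh (s r * t)) : ℝ) : ℂ)) L :=
  h.prod_fiberwise fun r => (hasProd_charFun_chiLaw (s r * t)).congr_fun fun k => by
    rw [div_mul_eq_mul_div]

/-- The law of the sum of `(ζ² - 1) / (2 freq k)` with `card ι` independent copies: one copy gives
the half stochastic area, two copies the stochastic area. -/
theorem exists_law_of_freq (ι : Type) [Fintype ι] :
    ∃ ρ : Measure ℝ, IsProbabilityMeasure ρ ∧ MemLp id 2 ρ ∧ ∫ x, x ∂ρ = 0 ∧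
      ∫ x, x ^ 2 ∂ρ = (1 / 2) * Fintype.card ι ∧
      ∀ t : ℝ, charFun ρ t = ((1 / √(Real.cosh t) : ℝ) : ℂ) ^ Fintype.card ι := by
  have h1 : HasSum (fun _ : ι => (1 : ℝ) ^ 2) (Fintype.card ι) := by
    have h := hasSum_fintype fun _ : ι => (1 : ℝ) ^ 2
    rwa [show ∑ _ : ι, (1 : ℝ) ^ 2 = Fintype.card ι by simp] at h
  obtain ⟨Ω', _, P', _, ζ, W, -, -, hW, hvar, h⟩ :=
    exists_gaussian_l2Sum (ι × ℤ) (hasSum_mul_inv_freq_sq (s := fun _ => 1) h1)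
  have hWm := hW.2.1.1.aemeasurable
  have hch : ∀ t : ℝ, charFun (P'.map W) t =
      ((1 / √(Real.cosh t) : ℝ) : ℂ) ^ Fintype.card ι := by
    intro t
    have h2 := hasProd_of_hasProd_freq (s := fun _ : ι => 1) (h t)
    rw [one_mul] at h2
    generalize ((1 / √(Real.cosh t) : ℝ) : ℂ) = y at h2
    have h3 := h2.unique (hasProd_fintype fun _ : ι => y)
    rw [h3, Finset.prod_const, Finset.card_univ]
  have hP : IsProbabilityMeasure (P'.map W) := Measure.isProbabilityMeasure_map hWm
  have hid : MemLp id 2 (P'.map W) :=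
    (memLp_map_measure_iff aestronglyMeasurable_id hWm).2 hW.2.1
  -- The characteristic function is even, so the law is symmetric and its mean is zero.
  have hsymm : (P'.map W).map (fun x => -x) = P'.map W := by
    have : IsProbabilityMeasure ((P'.map W).map fun x => -x) :=
      Measure.isProbabilityMeasure_map (by fun_prop)
    refine Measure.ext_of_charFun (funext fun t => ?_)
    have e : charFun ((P'.map W).map fun x => -x) t = charFun (P'.map W) (-t) := by
      rw [charFun_apply_real, charFun_apply_real, integral_map (by fun_prop) (by fun_prop)]
      simp
    rw [e, hch, hch, Real.cosh_neg]
  have h0 : ∫ x, x ∂(P'.map W) = 0 := by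
    have e : ∫ x, x ∂(P'.map W) = -∫ x, x ∂(P'.map W) := by
      conv_lhs => rw [← hsymm]
      rw [integral_map (by fun_prop) (by fun_prop), integral_neg]
    linarith
  refine ⟨P'.map W, hP, hid, h0, ?_, hch⟩
  have e0 : ∫ ω, W ω ∂P' = 0 := by
    rwa [integral_map hWm (by fun_prop)] at h0
  rw [integral_map hWm (by fun_prop), ← hvar, variance_eq_sub hW.2.1, e0]
  simp

/-- The law of Lévy's stochastic area, for one pair of Brownian motions. -/
theorem exists_halfArea_l2Sum (ι : Type) {lam : ι → ℝ} {c : ℝ}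
    (hl : HasSum (fun r => lam r ^ 2) c) :
    ∃ (Ω' : Type) (_ : MeasurableSpace Ω') (P' : Measure Ω') (_ : IsProbabilityMeasure P')
      (ξ : ι → Ω' → ℝ) (W : Ω' → ℝ), iIndepFun ξ P' ∧ (∀ r, IsHalfStochasticArea P' (ξ r)) ∧
      IsL2Sum P' (fun r ω => lam r * ξ r ω) W ∧ Var[W; P'] = (1 / 2) * c ∧
      ∀ t : ℝ, HasProd (fun r => ((1 / √(Real.cosh (lam r * t)) : ℝ) : ℂ))
        (charFun (P'.map W) t) := by
  obtain ⟨ρ, _, h1, h2, h3, h4⟩ := exists_law_of_freq Unit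
  simp only [Fintype.card_unit, Nat.cast_one, mul_one, pow_one] at h3 h4
  obtain ⟨Ω', m, P', hP, Z, W, hlaw, hind, hsum, hvar, hprod⟩ :=
    exists_l2Sum_of_law ι ρ h1 h2 (by norm_num) h3 hl
  refine ⟨Ω', m, P', hP, Z, W, hind, fun r => ⟨(hlaw r).aemeasurable, fun t => ?_⟩, hsum, hvar, ?_⟩
  · rw [(hlaw r).map_eq, h4]
  · simpa only [h4] using hprod

theorem exists_area_l2Sum (ι : Type) {lam : ι → ℝ} {c : ℝ} (hl : HasSum (fun r => lam r ^ 2) c) :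
    ∃ (Ω' : Type) (_ : MeasurableSpace Ω') (P' : Measure Ω') (_ : IsProbabilityMeasure P')
      (η : ι → Ω' → ℝ) (W : Ω' → ℝ), iIndepFun η P' ∧ (∀ r, IsStochasticArea P' (η r)) ∧
      IsL2Sum P' (fun r ω => lam r * η r ω) W ∧ Var[W; P'] = c ∧
      ∀ t : ℝ, HasProd (fun r => ((1 / √(Real.cosh (lam r * t)) : ℝ) : ℂ) ^ 2)
        (charFun (P'.map W) t) := by
  obtain ⟨ρ, _, h1, h2, h3, h4⟩ := exists_law_of_freq Bool
  simp only [Fintype.card_bool] at h3 h4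
  obtain ⟨Ω', m, P', hP, Z, W, hlaw, hind, hsum, hvar, hprod⟩ :=
    exists_l2Sum_of_law ι ρ h1 h2 (v := 1) (by norm_num) (h3.trans (by norm_num)) hl
  refine ⟨Ω', m, P', hP, Z, W, hind, fun r => ⟨(hlaw r).aemeasurable, fun t => ?_⟩, hsum,
    hvar.trans (one_mul c), ?_⟩
  · rw [(hlaw r).map_eq, h4, ← Complex.ofReal_pow, div_pow, one_pow,
      Real.sq_sqrt (Real.cosh_pos t).le]
  · simpa only [h4] using hprod

end Frequencies


/-! ### Eigenvectors of `altOp` from singular vectors of the kernel -/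

section Tmul

variable {Y Y' : Type*} [MeasurableSpace Y] [MeasurableSpace Y'] {κ : Measure Y} {κ' : Measure Y'}
  [IsProbabilityMeasure κ] [IsProbabilityMeasure κ']

theorem tmul_smul_left (c : ℝ) (u : Lp ℝ 2 κ) (v : Lp ℝ 2 κ') :
    tmul (c • u) v = c • tmul u v := by
  refine Lp.ext ?_
  filter_upwards [coeFn_tmul (c • u) v, coeFn_tmul u v, Lp.coeFn_smul c (tmul u v),
    Measure.quasiMeasurePreserving_fst.ae (Lp.coeFn_smul c u)] with p h1 h2 h3 h4
  rw [h1, h3, Pi.smul_apply, h2, h4, Pi.smul_apply, smul_eq_mul, smul_eq_mul, mul_assoc]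

theorem tmul_smul_right (c : ℝ) (u : Lp ℝ 2 κ) (v : Lp ℝ 2 κ') :
    tmul u (c • v) = c • tmul u v := by
  refine Lp.ext ?_
  filter_upwards [coeFn_tmul u (c • v), coeFn_tmul u v, Lp.coeFn_smul c (tmul u v),
    Measure.quasiMeasurePreserving_snd.ae (Lp.coeFn_smul c v)] with p h1 h2 h3 h4
  rw [h1, h3, Pi.smul_apply, h2, h4, Pi.smul_apply, smul_eq_mul, smul_eq_mul]
  ring

theorem integralOp_add {g h : Y → Y → ℝ}
    (hg : MemLp (fun p : Y × Y => g p.1 p.2) 2 (κ.prod κ))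
    (hh : MemLp (fun p : Y × Y => h p.1 p.2) 2 (κ.prod κ)) :
    integralOp κ (fun x y => g x y + h x y) = integralOp κ g + integralOp κ h := by
  rw [integralOp_eq_kerOp hg, integralOp_eq_kerOp hh, ← map_add, ← MemLp.toLp_add,
    integralOp_eq_kerOp (g := fun x y => g x y + h x y) (hg.add hh)]
  rfl

theorem integralOp_sub {g h : Y → Y → ℝ}
    (hg : MemLp (fun p : Y × Y => g p.1 p.2) 2 (κ.prod κ))
    (hh : MemLp (fun p : Y × Y => h p.1 p.2) 2 (κ.prod κ)) :
    integralOp κ (fun x y => g x y - h x y) = integralOp κ g - integralOp κ h := by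
  rw [integralOp_eq_kerOp hg, integralOp_eq_kerOp hh, ← map_sub, ← MemLp.toLp_sub,
    integralOp_eq_kerOp (g := fun x y => g x y - h x y) (hg.sub hh)]
  rfl

end Tmul

/-! ### Trigonometric functions in `L²[0,1]` -/

section Trigonometric

theorem integral_unitInterval (F : ℝ → ℝ) :
    ∫ u : unitInterval, F u = ∫ x in (0 : ℝ)..1, F x := by
  rw [intervalIntegral.integral_of_le zero_le_one, ← integral_Icc_eq_integral_Ioc]
  exact integral_subtype_comap measurableSet_Icc F

theorem integral_unitInterval_gt (F : ℝ → ℝ) (t : unitInterval) :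
    ∫ u : unitInterval, (if t < u then F u else 0) = ∫ x in (t : ℝ)..1, F x := by
  have h := integral_unitInterval fun x => (Set.Ioi (t : ℝ)).indicator F x
  rw [intervalIntegral.integral_of_le zero_le_one, setIntegral_indicator measurableSet_Ioi] at h
  rw [intervalIntegral.integral_of_le t.2.2]
  have e : Set.Ioc (0 : ℝ) 1 ∩ Set.Ioi (t : ℝ) = Set.Ioc (t : ℝ) 1 := by
    ext x
    have := t.2.1
    simp only [Set.mem_inter_iff, Set.mem_Ioc, Set.mem_Ioi]
    constructor
    · rintro ⟨⟨h1, h2⟩, h3⟩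
      exact ⟨h3, h2⟩
    · rintro ⟨h1, h2⟩
      exact ⟨⟨by linarith, h2⟩, h1⟩
  rw [e] at h
  rw [← h]
  refine integral_congr_ae (ae_of_all _ fun u => ?_)
  simp only [Set.indicator, Set.mem_Ioi, Subtype.coe_lt_coe]

theorem integral_unitInterval_lt (F : ℝ → ℝ) (t : unitInterval) :
    ∫ u : unitInterval, (if u < t then F u else 0) = ∫ x in (0 : ℝ)..t, F x := by
  have h := integral_unitInterval fun x => (Set.Iio (t : ℝ)).indicator F x
  rw [intervalIntegral.integral_of_le zero_le_one, setIntegral_indicator measurableSet_Iio] at h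
  rw [intervalIntegral.integral_of_le t.2.1, integral_Ioc_eq_integral_Ioo]
  have e : Set.Ioc (0 : ℝ) 1 ∩ Set.Iio (t : ℝ) = Set.Ioo (0 : ℝ) t := by
    ext x
    have := t.2.2
    simp only [Set.mem_inter_iff, Set.mem_Ioc, Set.mem_Iio, Set.mem_Ioo]
    constructor
    · rintro ⟨⟨h1, h2⟩, h3⟩
      exact ⟨h1, h3⟩
    · rintro ⟨h1, h2⟩
      exact ⟨⟨h1, by linarith⟩, h2⟩
  rw [e] at h
  rw [← h]
  refine integral_congr_ae (ae_of_all _ fun u => ?_)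
  simp only [Set.indicator, Set.mem_Iio, Subtype.coe_lt_coe]

theorem memLp_cos (w : ℝ) :
    MemLp (fun u : unitInterval => Real.cos (w * u)) 2 (volume : Measure unitInterval) :=
  MemLp.of_bound (by fun_prop) 1 (ae_of_all _ fun u => Real.abs_cos_le_one _)

theorem memLp_sin (w : ℝ) :
    MemLp (fun u : unitInterval => Real.sin (w * u)) 2 (volume : Measure unitInterval) :=
  MemLp.of_bound (by fun_prop) 1 (ae_of_all _ fun u => Real.abs_sin_le_one _)

/-- `cos (w t)` in `L²[0,1]`. -/
noncomputable def cosL (w : ℝ) : Lp ℝ 2 (volume : Measure unitInterval) := (memLp_cos w).toLp _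

/-- `sin (w t)` in `L²[0,1]`. -/
noncomputable def sinL (w : ℝ) : Lp ℝ 2 (volume : Measure unitInterval) := (memLp_sin w).toLp _

theorem coeFn_cosL (w : ℝ) : cosL w =ᵐ[volume] fun u : unitInterval => Real.cos (w * u) :=
  MemLp.coeFn_toLp _

theorem coeFn_sinL (w : ℝ) : sinL w =ᵐ[volume] fun u : unitInterval => Real.sin (w * u) :=
  MemLp.coeFn_toLp _

/-- By the addition formula the sum is the integral of `cos ((k - l) π u)`. Over `k ∈ ℤ` neither
family alone is orthogonal, because opposite frequencies give the same cosine and opposite sines. -/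
theorem inner_cosL_add_inner_sinL (k l : ℤ) :
    inner ℝ (cosL (freq k)) (cosL (freq l)) + inner ℝ (sinL (freq k)) (sinL (freq l)) =
      if k = l then (1 : ℝ) else 0 := by
  rw [L2.inner_def, L2.inner_def, ← integral_add (L2.integrable_inner _ _)
    (L2.integrable_inner _ _)]
  have e : (fun u => inner ℝ (cosL (freq k) u) (cosL (freq l) u) +
      inner ℝ (sinL (freq k) u) (sinL (freq l) u)) =ᵐ[volume]
      fun u : unitInterval => Real.cos ((k - l) * Real.pi * u) := by
    filter_upwards [coeFn_cosL (freq k), coeFn_cosL (freq l), coeFn_sinL (freq k),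
      coeFn_sinL (freq l)] with u h1 h2 h3 h4
    rw [h1, h2, h3, h4]
    have : (k - l : ℝ) * Real.pi * u = freq k * u - freq l * u := by
      simp only [freq]
      ring
    rw [this, Real.cos_sub]
    simp [mul_comm]
  rw [integral_congr_ae e, integral_unitInterval fun x => Real.cos ((k - l) * Real.pi * x)]
  split_ifs with h
  · simp [h]
  · have hne : (k - l : ℝ) * Real.pi ≠ 0 :=
      mul_ne_zero (sub_ne_zero.2 (by exact_mod_cast h)) Real.pi_ne_zero
    rw [intervalIntegral.integral_comp_mul_left _ hne, integral_cos]
    have := Real.sin_int_mul_pi (k - l)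
    push_cast at this
    simp [this]

end Trigonometric

/-! ### Trigonometric eigenvectors from singular vectors -/

section Singular

variable {S : Type*} [MeasurableSpace S] {ν : Measure S} [IsProbabilityMeasure ν] {f : S → S → ℝ}

/-- The part of the kernel above the diagonal. -/
noncomputable def upK {S : Type*} (f : S → S → ℝ) (p q : S × unitInterval) : ℝ :=
  if p.2 < q.2 then f p.1 q.1 else 0

/-- The part of the kernel below the diagonal. -/
noncomputable def downK {S : Type*} (f : S → S → ℝ) (p q : S × unitInterval) : ℝ :=
  if q.2 < p.2 then f q.1 p.1 else 0

theorem hatK_eq (f : S → S → ℝ) : hatK f = fun p q => upK f p q + downK f p q := by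
  funext p q
  simp only [hatK, upK, downK]
  rcases lt_trichotomy p.2 q.2 with h | h | h
  · simp [h, h.not_gt]
  · simp [h]
  · simp [h, h.not_gt]

theorem checkK_eq (f : S → S → ℝ) : checkK f = fun p q => upK f p q - downK f p q := by
  funext p q
  simp only [checkK, upK, downK]
  rcases lt_trichotomy p.2 q.2 with h | h | h
  · simp [h, h.not_gt]
  · simp [h]
  · simp [h, h.not_gt]

theorem memLp_upK (hf : IsDegenerate ν f) :
    MemLp (fun p : (S × unitInterval) × (S × unitInterval) => upK f p.1 p.2) 2
      ((ν.prod volume).prod (ν.prod volume)) := by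
  refine (hf.memLp.comp_measurePreserving (measurePreserving_fst_fst ν)).mono
    (Measurable.ite (measurableSet_lt (by fun_prop) (by fun_prop))
      (hf.meas.comp measurable_fst_fst) measurable_const).aestronglyMeasurable
    (ae_of_all _ fun p => ?_)
  simp only [upK, Function.comp_apply]
  split_ifs <;> simp

theorem memLp_downK (hf : IsDegenerate ν f) :
    MemLp (fun p : (S × unitInterval) × (S × unitInterval) => downK f p.1 p.2) 2
      ((ν.prod volume).prod (ν.prod volume)) := by
  refine (hf.flip.memLp.comp_measurePreserving (measurePreserving_fst_fst ν)).mono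
    (Measurable.ite (measurableSet_lt (by fun_prop) (by fun_prop))
      (hf.flip.meas.comp measurable_fst_fst) measurable_const).aestronglyMeasurable
    (ae_of_all _ fun p => ?_)
  simp only [downK, Function.comp_apply]
  split_ifs <;> simp

/-- The kernel is `f` times the indicator of `t < u`, so by Fubini the operator acts on space and
time separately. -/
theorem integralOp_upK_tmul (hf : IsDegenerate ν f) (h : Lp ℝ 2 ν)
    (ψ ψ' : Lp ℝ 2 (volume : Measure unitInterval))
    (hψ : ∀ᵐ t, ∫ u, (if t < u then ψ u else 0) = ψ' t) :
    integralOp (ν.prod volume) (upK f) (tmul h ψ) = tmul (integralOp ν f h) ψ' := by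
  refine Lp.ext ?_
  filter_upwards [integralOp_apply _ (memLp_upK hf) (tmul h ψ),
    coeFn_tmul (integralOp ν f h) ψ',
    Measure.quasiMeasurePreserving_fst.ae (integralOp_apply ν hf.memLp h),
    Measure.quasiMeasurePreserving_snd.ae hψ] with p h1 h2 h3 h4
  have e : (fun q => upK f p q * tmul h ψ q) =ᵐ[ν.prod volume]
      fun q => f p.1 q.1 * h q.1 * (if p.2 < q.2 then ψ q.2 else 0) := by
    filter_upwards [coeFn_tmul h ψ] with q hq
    rw [hq, upK]
    split_ifs <;> ring
  rw [h1, h2, h3, ← h4, integral_congr_ae e]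
  exact integral_prod_mul (fun y => f p.1 y * h y) fun u => if p.2 < u then ψ u else 0

theorem integralOp_downK_tmul (hf : IsDegenerate ν f) (h : Lp ℝ 2 ν)
    (ψ ψ' : Lp ℝ 2 (volume : Measure unitInterval))
    (hψ : ∀ᵐ t, ∫ u, (if u < t then ψ u else 0) = ψ' t) :
    integralOp (ν.prod volume) (downK f) (tmul h ψ) =
      tmul (integralOp ν (fun x y => f y x) h) ψ' := by
  refine Lp.ext ?_
  filter_upwards [integralOp_apply _ (memLp_downK hf) (tmul h ψ),
    coeFn_tmul (integralOp ν (fun x y => f y x) h) ψ',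
    Measure.quasiMeasurePreserving_fst.ae (integralOp_apply ν (g := fun x y => f y x) hf.flip.memLp h),
    Measure.quasiMeasurePreserving_snd.ae hψ] with p h1 h2 h3 h4
  have e : (fun q => downK f p q * tmul h ψ q) =ᵐ[ν.prod volume]
      fun q => f q.1 p.1 * h q.1 * (if q.2 < p.2 then ψ q.2 else 0) := by
    filter_upwards [coeFn_tmul h ψ] with q hq
    rw [hq, downK]
    split_ifs <;> ring
  rw [h1, h2, h3, ← h4, integral_congr_ae e]
  exact integral_prod_mul (fun y => f y p.1 * h y) fun u => if u < p.2 then ψ u else 0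

/-- The integral of `sin (w u)` over `[t, 1]` is `cos (w t) / w` exactly because `cos w = 0`; this
boundary condition selects the frequencies. -/
theorem integralOp_upK_sin (hf : IsDegenerate ν f) (h : Lp ℝ 2 ν) (k : ℤ) :
    integralOp (ν.prod volume) (upK f) (tmul h (sinL (freq k))) =
      (freq k)⁻¹ • tmul (integralOp ν f h) (cosL (freq k)) := by
  rw [← tmul_smul_right]
  refine integralOp_upK_tmul hf h _ _ ?_
  filter_upwards [coeFn_cosL (freq k), Lp.coeFn_smul (freq k)⁻¹ (cosL (freq k))] with t h1 h2
  rw [h2, Pi.smul_apply, h1]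
  have e : (fun u => if t < u then sinL (freq k) u else 0) =ᵐ[volume]
      fun u : unitInterval => if t < u then Real.sin (freq k * u) else 0 := by
    filter_upwards [coeFn_sinL (freq k)] with u hu
    rw [hu]
  rw [integral_congr_ae e, integral_unitInterval_gt fun x => Real.sin (freq k * x),
    intervalIntegral.integral_comp_mul_left _ (freq_ne_zero k), integral_sin, mul_one, cos_freq,
    sub_zero]

theorem integralOp_downK_cos (hf : IsDegenerate ν f) (h : Lp ℝ 2 ν) (k : ℤ) :
    integralOp (ν.prod volume) (downK f) (tmul h (cosL (freq k))) =
      (freq k)⁻¹ • tmul (integralOp ν (fun x y => f y x) h) (sinL (freq k)) := by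
  rw [← tmul_smul_right]
  refine integralOp_downK_tmul hf h _ _ ?_
  filter_upwards [coeFn_sinL (freq k), Lp.coeFn_smul (freq k)⁻¹ (sinL (freq k))] with t h1 h2
  rw [h2, Pi.smul_apply, h1]
  have e : (fun u => if u < t then cosL (freq k) u else 0) =ᵐ[volume]
      fun u : unitInterval => if u < t then Real.cos (freq k * u) else 0 := by
    filter_upwards [coeFn_cosL (freq k)] with u hu
    rw [hu]
  rw [integral_congr_ae e, integral_unitInterval_lt fun x => Real.cos (freq k * x),
    intervalIntegral.integral_comp_mul_left _ (freq_ne_zero k), integral_cos, mul_zero,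
    Real.sin_zero, sub_zero]

/-- The eigenvector of `altOp` attached to a pair of singular vectors and a frequency. -/
noncomputable def singularVec (e e' : Lp ℝ 2 ν) (k : ℤ) :
    WithLp 2 (Lp ℝ 2 (ν.prod (volume : Measure unitInterval)) ×
      Lp ℝ 2 (ν.prod (volume : Measure unitInterval))) :=
  (√2)⁻¹ • WithLp.toLp 2 (tmul e (cosL (freq k)) - tmul e' (sinL (freq k)),
    tmul e (cosL (freq k)) + tmul e' (sinL (freq k)))

theorem singularVec_fst (e e' : Lp ℝ 2 ν) (k : ℤ) : (singularVec e e' k).fst =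
    (√2)⁻¹ • (tmul e (cosL (freq k)) - tmul e' (sinL (freq k))) := rfl

theorem singularVec_snd (e e' : Lp ℝ 2 ν) (k : ℤ) : (singularVec e e' k).snd =
    (√2)⁻¹ • (tmul e (cosL (freq k)) + tmul e' (sinL (freq k))) := rfl

/-- Put `C = e ⊗ cos` and `D = e' ⊗ sin`. On the components `C - D` and `C + D` the blocks apply
`upK` only to the difference `2 D` and `downK` only to the sum `2 C`; each is mapped to a multiple
of the other tensor. -/
theorem altOp_singularVec (hf : IsDegenerate ν f) {e e' : Lp ℝ 2 ν} {s : ℝ}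
    (h1 : integralOp ν f e' = s • e) (h2 : integralOp ν (fun x y => f y x) e = s • e') (k : ℤ) :
    altOp ν f (singularVec e e' k) = (s / freq k) • singularVec e e' k := by
  have hu := integralOp_upK_sin hf e' k
  have hd := integralOp_downK_cos hf e k
  rw [h1, tmul_smul_left] at hu
  rw [h2, tmul_smul_left] at hd
  have e1 : integralOp (ν.prod volume) (hatK f) =
      integralOp (ν.prod volume) (upK f) + integralOp (ν.prod volume) (downK f) := by
    rw [hatK_eq]
    exact integralOp_add (memLp_upK hf) (memLp_downK hf)
  have e2 : integralOp (ν.prod volume) (checkK f) =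
      integralOp (ν.prod volume) (upK f) - integralOp (ν.prod volume) (downK f) := by
    rw [checkK_eq]
    exact integralOp_sub (memLp_upK hf) (memLp_downK hf)
  have key1 : (altOp ν f (singularVec e e' k)).fst =
      (s / freq k) • (singularVec e e' k).fst := by
    rw [altOp_fst, singularVec_fst, singularVec_snd, e1, e2]
    simp only [add_apply, sub_apply, map_smul, map_add, map_sub, hu, hd]
    module
  have key2 : (altOp ν f (singularVec e e' k)).snd =
      (s / freq k) • (singularVec e e' k).snd := by
    rw [altOp_snd, singularVec_fst, singularVec_snd, e1, e2]
    simp only [add_apply, sub_apply, map_smul, map_add, map_sub, hu, hd]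
    module
  exact (WithLp.equiv 2 _).injective (Prod.ext key1 key2)

/-- The mixed terms of the two components cancel, so no relation between `e` and `e'` is needed;
what remains is the sum of the cosine and sine inner products. -/
theorem orthonormal_singularVec {ι : Type*} {e e' : ι → Lp ℝ 2 ν} (he : Orthonormal ℝ e)
    (he' : Orthonormal ℝ e') :
    Orthonormal ℝ fun p : ι × ℤ => singularVec (e p.1) (e' p.1) p.2 := by
  classical
  rw [orthonormal_iff_ite] at he he' ⊢
  rintro ⟨r, k⟩ ⟨q, l⟩
  rw [inner_prod_eq]
  simp only [singularVec_fst, singularVec_snd, inner_smul_left, inner_smul_right, inner_add_left,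
    inner_add_right, inner_sub_left, inner_sub_right, inner_tmul, he, he', conj_trivial,
    Prod.mk.injEq]
  have h := inner_cosL_add_inner_sinL k l
  have h2 : (√2)⁻¹ * (√2)⁻¹ = (1 / 2 : ℝ) := by
    rw [← mul_inv, Real.mul_self_sqrt (by norm_num)]
    norm_num
  have h3 : (if r = q ∧ k = l then (1 : ℝ) else 0) =
      (if r = q then 1 else 0) * (if k = l then 1 else 0) := by
    split_ifs <;> simp_all
  rw [h3, ← h]
  linear_combination (2 * (if r = q then (1 : ℝ) else 0) *
    (inner ℝ (cosL (freq k)) (cosL (freq l)) + inner ℝ (sinL (freq k)) (sinL (freq l)))) * h2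

/-- The limit law of the alternating statistic in terms of singular vectors of the kernel. -/
theorem IsIID.tendsto_charFun_Upm_singular {Ω : Type*} [MeasurableSpace Ω] {P : Measure Ω}
    [IsProbabilityMeasure P] {X : ℕ → Ω → S} (hX : IsIID P ν X) (hf : IsDegenerate ν f)
    {ι : Type} {e e' : ι → Lp ℝ 2 ν} (he : Orthonormal ℝ e) (he' : Orthonormal ℝ e') {s : ι → ℝ}
    (h1 : ∀ r, integralOp ν f (e' r) = s r • e r)
    (h2 : ∀ r, integralOp ν (fun x y => f y x) (e r) = s r • e' r) (h0 : ∀ r, s r ≠ 0)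
    (hsum : HasSum (fun r => s r ^ 2) (kernelNormSq ν f)) (t : ℝ) :
    ∃ L, HasProd (fun r => ((1 / √(Real.cosh (s r * t)) : ℝ) : ℂ)) L ∧
      Tendsto (fun n : ℕ => charFun (P.map fun ω => (n : ℝ)⁻¹ * Upm f (fun i => X i ω) n) t)
        atTop (𝓝 L) := by
  have hl : ∀ p : ι × ℤ, altOp ν f (singularVec (e p.1) (e' p.1) p.2) =
      (s p.1 / freq p.2) • singularVec (e p.1) (e' p.1) p.2 :=
    fun p => altOp_singularVec hf (h1 p.1) (h2 p.1) p.2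
  have hs : HasSum (fun p : ι × ℤ => (s p.1 / freq p.2) ^ 2) (kernelNormSq ν f) :=
    hasSum_mul_inv_freq_sq hsum
  have hne : ∀ p : ι × ℤ, s p.1 / freq p.2 ≠ 0 := fun p => div_ne_zero (h0 p.1) (freq_ne_zero p.2)
  obtain ⟨L, hL, hlim⟩ := hX.tendsto_charFun_Upm hf (orthonormal_singularVec he he') hl hne hs t
  exact ⟨L, hasProd_of_hasProd_freq hL, hlim⟩

end Singular


/-! ### The Hoeffding decomposition -/

section Hoeffding

variable {S : Type*} [MeasurableSpace S] {ν : Measure S} [IsProbabilityMeasure ν] {f : S → S → ℝ}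

theorem measurable_f1 (hf : Measurable fun p : S × S => f p.1 p.2) : Measurable (f1 ν f) :=
  ((hf.stronglyMeasurable.integral_prod_right' (ν := ν)).measurable).sub_const _

theorem measurable_f2 (hf : Measurable fun p : S × S => f p.1 p.2) : Measurable (f2 ν f) :=
  ((hf.stronglyMeasurable.integral_prod_left' (μ := ν)).measurable).sub_const _

theorem memLp_f1 (hf : MemLp (fun p : S × S => f p.1 p.2) 2 (ν.prod ν)) : MemLp (f1 ν f) 2 ν := by
  have h := memLp_integral ν hf (memLp_const (1 : ℝ))
  simp only [mul_one] at h
  exact h.sub (memLp_const _)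

theorem memLp_f2 (hf : MemLp (fun p : S × S => f p.1 p.2) 2 (ν.prod ν)) : MemLp (f2 ν f) 2 ν := by
  have h := memLp_integral ν (g := fun x y => f y x) (memLp_swap hf) (memLp_const (1 : ℝ))
  simp only [mul_one] at h
  exact h.sub (memLp_const _)

theorem integral_f1 (hf : MemLp (fun p : S × S => f p.1 p.2) 2 (ν.prod ν)) :
    ∫ x, f1 ν f x ∂ν = 0 := by
  have hi := hf.integrable (by norm_num : (1 : ℝ≥0∞) ≤ 2)
  simp only [f1]
  rw [integral_sub hi.integral_prod_left (integrable_const _), mean, integral_prod _ hi]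
  simp

theorem integral_f2 (hf : MemLp (fun p : S × S => f p.1 p.2) 2 (ν.prod ν)) :
    ∫ y, f2 ν f y ∂ν = 0 := by
  have hi := hf.integrable (by norm_num : (1 : ℝ≥0∞) ≤ 2)
  simp only [f2]
  rw [integral_sub hi.integral_prod_right (integrable_const _), mean, integral_prod_symm _ hi]
  simp

theorem isDegenerate_f12 (hm : Measurable fun p : S × S => f p.1 p.2)
    (hf : MemLp (fun p : S × S => f p.1 p.2) 2 (ν.prod ν)) : IsDegenerate ν (f12 ν f) := by
  have hi := hf.integrable (by norm_num : (1 : ℝ≥0∞) ≤ 2)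
  have h1 := memLp_f1 hf
  have h2 := memLp_f2 hf
  have i1 := h1.integrable (by norm_num : (1 : ℝ≥0∞) ≤ 2)
  have i2 := h2.integrable (by norm_num : (1 : ℝ≥0∞) ≤ 2)
  refine ⟨?_, ?_, ?_, ?_⟩
  · exact ((hm.sub ((measurable_f1 hm).comp measurable_fst)).sub
      ((measurable_f2 hm).comp measurable_snd)).sub_const _
  · exact ((hf.sub (h1.comp_fst ν)).sub (h2.comp_snd ν)).sub (memLp_const _)
  · filter_upwards [hi.prod_left_ae] with y hy
    have a1 : Integrable (fun x => f x y - f1 ν f x) ν := hy.sub i1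
    have a2 : Integrable (fun x => f x y - f1 ν f x - f2 ν f y) ν := a1.sub (integrable_const _)
    simp only [f12]
    rw [integral_sub a2 (integrable_const _), integral_sub a1 (integrable_const _),
      integral_sub hy i1, integral_f1 hf]
    simp [f2]
  · filter_upwards [hi.prod_right_ae] with x hx
    have a1 : Integrable (fun y => f x y - f1 ν f x) ν := hx.sub (integrable_const _)
    have a2 : Integrable (fun y => f x y - f1 ν f x - f2 ν f y) ν := a1.sub i2
    simp only [f12]
    rw [integral_sub a2 (integrable_const _), integral_sub a1 i2,
      integral_sub hx (integrable_const _), integral_f2 hf]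
    simp [f1]

theorem IsDegenerate.integral_eq_zero (hf : IsDegenerate ν f) :
    ∫ p, f p.1 p.2 ∂(ν.prod ν) = 0 := by
  rw [integral_prod _ (hf.memLp.integrable (by norm_num))]
  exact integral_eq_zero_of_ae hf.right

theorem varF12_eq (hm : Measurable fun p : S × S => f p.1 p.2)
    (hf : MemLp (fun p : S × S => f p.1 p.2) 2 (ν.prod ν)) :
    varF12 ν f = kernelNormSq ν (f12 ν f) := by
  have h := isDegenerate_f12 hm hf
  rw [varF12, variance_eq_sub h.memLp, h.integral_eq_zero, kernelNormSq]
  simp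

theorem variance_f1 (hf : MemLp (fun p : S × S => f p.1 p.2) 2 (ν.prod ν)) :
    Var[f1 ν f; ν] = ∫ x, f1 ν f x ^ 2 ∂ν := by
  rw [variance_eq_sub (memLp_f1 hf), integral_f1 hf]
  simp

end Hoeffding

/-! ### The coefficients -/

section Coefficients

/-- The coefficient of `f₁(X i)` in the statistic. -/
noncomputable def coeff1 (n i : ℕ) : ℝ := ((-1) ^ n + (-1) ^ i) / 2

/-- The coefficient of `f₂(X j)` in the statistic. -/
noncomputable def coeff2 (j : ℕ) : ℝ := (-1) ^ (j + 1) * j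

theorem coeff1_self (n : ℕ) : coeff1 (n + 1) n = 0 := by
  rw [coeff1, pow_succ]
  ring

theorem coeff1_succ (n i : ℕ) : coeff1 (n + 1) i = coeff1 n i + (-1) ^ (n + 1) := by
  simp only [coeff1, pow_succ]
  ring

/-- Induction on `n`: the new row adds the same sign to all earlier coefficients of `f1`, which
therefore stay bounded, whereas the new variable enters as second argument `n` times. -/
theorem Upm_eq {S : Type*} [MeasurableSpace S] (ν : Measure S) (f : S → S → ℝ) (x : ℕ → S)
    (n : ℕ) : Upm f x n = Upm (f12 ν f) x n +
      ∑ i ∈ Finset.range n, (coeff1 n i * f1 ν f (x i) + coeff2 i * f2 ν f (x i)) +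
      (∑ j ∈ Finset.range n, coeff2 j) * mean ν f := by
  induction n with
  | zero => simp [Upm]
  | succ n ih =>
    rw [Upm_succ, Upm_succ, ih, Finset.sum_range_succ, coeff1_self, Finset.sum_range_succ coeff2]
    have e1 : ∑ i ∈ Finset.range n, (-1 : ℝ) ^ (n + 1) * f (x i) (x n) =
        ∑ i ∈ Finset.range n, (-1 : ℝ) ^ (n + 1) * f12 ν f (x i) (x n) +
        ∑ i ∈ Finset.range n, (-1 : ℝ) ^ (n + 1) * f1 ν f (x i) +
        (-1 : ℝ) ^ (n + 1) * n * (f2 ν f (x n) + mean ν f) := by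
      have : (-1 : ℝ) ^ (n + 1) * n * (f2 ν f (x n) + mean ν f) =
          ∑ i ∈ Finset.range n, (-1 : ℝ) ^ (n + 1) * (f2 ν f (x n) + mean ν f) := by
        rw [Finset.sum_const, Finset.card_range, nsmul_eq_mul]
        ring
      rw [this, ← Finset.sum_add_distrib, ← Finset.sum_add_distrib]
      refine Finset.sum_congr rfl fun i _ => ?_
      rw [f12]
      ring
    have e2 : ∑ i ∈ Finset.range n, (coeff1 (n + 1) i * f1 ν f (x i) + coeff2 i * f2 ν f (x i)) =
        ∑ i ∈ Finset.range n, (coeff1 n i * f1 ν f (x i) + coeff2 i * f2 ν f (x i)) +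
        ∑ i ∈ Finset.range n, (-1 : ℝ) ^ (n + 1) * f1 ν f (x i) := by
      rw [← Finset.sum_add_distrib]
      refine Finset.sum_congr rfl fun i _ => ?_
      rw [coeff1_succ]
      ring
    rw [e1, e2, coeff2]
    ring

theorem sum_coeff2 (n : ℕ) :
    ∑ j ∈ Finset.range n, coeff2 j = (-1 : ℝ) ^ n * ((n / 2 : ℕ) : ℝ) := by
  induction n with
  | zero => simp
  | succ n ih =>
    rw [Finset.sum_range_succ, ih, coeff2]
    rcases Nat.even_or_odd' n with ⟨m, rfl | rfl⟩
    · rw [show 2 * m / 2 = m by omega, show (2 * m + 1) / 2 = m by omega, pow_succ]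
      push_cast
      ring
    · rw [show (2 * m + 1) / 2 = m by omega, show (2 * m + 1 + 1) / 2 = m + 1 by omega,
        pow_succ _ (2 * m + 1)]
      push_cast
      ring

theorem sum_coeff1_sq (n : ℕ) :
    ∑ i ∈ Finset.range n, coeff1 n i ^ 2 = ((n / 2 : ℕ) : ℝ) := by
  -- The length of the sum is separated from the `n` inside the coefficients, so that induction on
  -- the length is possible.
  have h : ∀ m n : ℕ, ∑ i ∈ Finset.range m, coeff1 n i ^ 2 =
      m / 2 + (-1) ^ n * (1 - (-1) ^ m) / 4 := by
    intro m n
    have hn : ((-1 : ℝ) ^ n) ^ 2 = 1 := by rw [← pow_mul, mul_comm, pow_mul]; simp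
    induction m with
    | zero => simp
    | succ m ih =>
      have hm : ((-1 : ℝ) ^ m) ^ 2 = 1 := by rw [← pow_mul, mul_comm, pow_mul]; simp
      rw [Finset.sum_range_succ, ih, coeff1, pow_succ]
      push_cast
      linear_combination (1 / 4) * hn + (1 / 4) * hm
  rw [h]
  rcases Nat.even_or_odd' n with ⟨m, rfl | rfl⟩
  · rw [show 2 * m / 2 = m by omega, pow_mul]
    push_cast
    norm_num
  · rw [show (2 * m + 1) / 2 = m by omega, pow_succ, pow_mul]
    push_cast
    norm_num
    ring

theorem abs_coeff1_le (n i : ℕ) : |coeff1 n i| ≤ 1 := by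
  rw [coeff1]
  rcases neg_one_pow_eq_or ℝ n with h | h <;> rcases neg_one_pow_eq_or ℝ i with h' | h' <;>
    rw [h, h'] <;> norm_num

theorem abs_coeff2 (j : ℕ) : |coeff2 j| = j := by
  rw [coeff2, abs_mul, abs_pow, abs_neg, abs_one, one_pow, one_mul, Nat.abs_cast]

theorem sum_coeff2_sq (n : ℕ) :
    ∑ j ∈ Finset.range n, coeff2 j ^ 2 = n * (n - 1) * (2 * n - 1) / 6 := by
  simp only [← sq_abs (coeff2 _), abs_coeff2]
  induction n with
  | zero => simp
  | succ n ih =>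
    rw [Finset.sum_range_succ, ih]
    push_cast
    ring

end Coefficients

/-! ### Mean and second moments of the full statistic -/

section Moments

variable {Ω S : Type*} [MeasurableSpace Ω] [MeasurableSpace S] {P : Measure Ω}
  [IsProbabilityMeasure P] {ν : Measure S} [IsProbabilityMeasure ν] {X : ℕ → Ω → S} {f : S → S → ℝ}

theorem IsIID.memLp_comp (hX : IsIID P ν X) {g : S → ℝ} (hg : MemLp g 2 ν) (i : ℕ) :
    MemLp (fun ω => g (X i ω)) 2 P :=
  hg.comp_measurePreserving (hX.measurePreserving i)

theorem IsIID.integral_comp (hX : IsIID P ν X) {g : S → ℝ} (hg : Measurable g) (i : ℕ) :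
    ∫ ω, g (X i ω) ∂P = ∫ x, g x ∂ν := by
  rw [← hX.law i, integral_map (hX.meas i).aemeasurable hg.aestronglyMeasurable]

theorem IsIID.integral_Upm (hX : IsIID P ν X) (hf : IsDegenerate ν f) (n : ℕ) :
    ∫ ω, Upm f (fun i => X i ω) n ∂P = 0 := by
  simp only [Upm_eq_sum_ltPairs]
  rw [integral_finsetSum _ fun p hp => ((hX.memLp_pair (lt_of_mem_ltPairs hp).ne
    hf.memLp).integrable (by norm_num)).const_mul _]
  refine Finset.sum_eq_zero fun p hp => ?_
  rw [integral_const_mul, hX.integral_pair (lt_of_mem_ltPairs hp).ne hf.memLp.1,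
    hf.integral_eq_zero, mul_zero]

theorem IsIID.integral_sq_sum_comp (hX : IsIID P ν X) (n : ℕ) (g : ℕ → S → ℝ)
    (hg : ∀ i, Measurable (g i)) (hg2 : ∀ i, MemLp (g i) 2 ν) (h0 : ∀ i, ∫ x, g i x ∂ν = 0) :
    ∫ ω, (∑ i ∈ Finset.range n, g i (X i ω)) ^ 2 ∂P =
      ∑ i ∈ Finset.range n, ∫ x, g i x ^ 2 ∂ν := by
  rw [integral_sq_sum_of_orthogonal (Finset.range n) (fun i ω => g i (X i ω))
    (fun i _ => hX.memLp_comp (hg2 i) i)]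
  · exact Finset.sum_congr rfl fun i _ => hX.integral_comp ((hg i).pow_const 2) i
  · intro i _ j _ hij
    have h := (hX.indep.indepFun hij).comp (hg i) (hg j)
    have h2 := h.integral_mul_eq_mul_integral
      (hX.memLp_comp (hg2 i) i).1 (hX.memLp_comp (hg2 j) j).1
    refine Eq.trans ?_ (h2.trans ?_)
    · rfl
    · simp only [Function.comp_apply]
      rw [hX.integral_comp (hg i), h0, zero_mul]

/-- The second moment of a degenerate statistic plus a sum of independent variables. -/
theorem IsIID.integral_sq_Upm_add (hX : IsIID P ν X) (hf : IsDegenerate ν f) (n : ℕ)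
    (g : ℕ → S → ℝ) (hg : ∀ i, Measurable (g i)) (hg2 : ∀ i, MemLp (g i) 2 ν)
    (h0 : ∀ i, ∫ x, g i x ∂ν = 0) :
    ∫ ω, (Upm f (fun i => X i ω) n + ∑ i ∈ Finset.range n, g i (X i ω)) ^ 2 ∂P =
      n * (n - 1) / 2 * kernelNormSq ν f + ∑ i ∈ Finset.range n, ∫ x, g i x ^ 2 ∂ν := by
  have hU := hX.memLp_Upm hf.memLp n
  have hG : MemLp (fun ω => ∑ i ∈ Finset.range n, g i (X i ω)) 2 P :=
    memLp_finsetSum _ fun i _ => hX.memLp_comp (hg2 i) i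
  -- A degenerate kernel at two variables is orthogonal to every square integrable function of a
  -- single variable.
  have hcross : ∫ ω, Upm f (fun i => X i ω) n * ∑ i ∈ Finset.range n, g i (X i ω) ∂P = 0 := by
    simp only [Upm_eq_sum_ltPairs, Finset.sum_mul_sum]
    have hterm : ∀ p ∈ ltPairs n, ∀ i, Integrable (fun ω =>
        (-1 : ℝ) ^ (p.2 + 1) * f (X p.1 ω) (X p.2 ω) * g i (X i ω)) P := fun p hp i =>
      ((hX.memLp_pair (lt_of_mem_ltPairs hp).ne hf.memLp).const_mul _).integrable_mul
        (hX.memLp_comp (hg2 i) i)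
    rw [integral_finsetSum _ fun p hp => integrable_finsetSum _ fun i _ => hterm p hp i]
    refine Finset.sum_eq_zero fun p hp => ?_
    rw [integral_finsetSum _ fun i _ => hterm p hp i]
    refine Finset.sum_eq_zero fun i _ => ?_
    simp only [mul_assoc]
    rw [integral_const_mul, hX.integral_mul_single hf (lt_of_mem_ltPairs hp).ne i (hg i) (hg2 i),
      mul_zero]
  have hsq := hX.integral_sq_sum_comp n g hg hg2 h0
  have e : ∀ ω, (Upm f (fun i => X i ω) n + ∑ i ∈ Finset.range n, g i (X i ω)) ^ 2 =
      Upm f (fun i => X i ω) n ^ 2 +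
      2 * (Upm f (fun i => X i ω) n * ∑ i ∈ Finset.range n, g i (X i ω)) +
      (∑ i ∈ Finset.range n, g i (X i ω)) ^ 2 := fun ω => by ring
  have i1 := hU.integrable_sq
  have i2 : Integrable (fun ω => 2 * (Upm f (fun i => X i ω) n *
      ∑ i ∈ Finset.range n, g i (X i ω))) P := (hU.integrable_mul hG).const_mul 2
  have i3 := hG.integrable_sq
  have i12 : Integrable (fun ω => Upm f (fun i => X i ω) n ^ 2 +
      2 * (Upm f (fun i => X i ω) n * ∑ i ∈ Finset.range n, g i (X i ω))) P := i1.add i2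
  simp only [e]
  rw [integral_add i12 i3, integral_add i1 i2, integral_const_mul, hcross, hsq,
    hX.integral_sq_Upm hf]
  ring

/-- The mean of the statistic. -/
theorem IsIID.integral_Upm_eq (hX : IsIID P ν X) (hm : Measurable fun p : S × S => f p.1 p.2)
    (hf : MemLp (fun p : S × S => f p.1 p.2) 2 (ν.prod ν)) (n : ℕ) :
    ∫ ω, Upm f (fun i => X i ω) n ∂P = (-1 : ℝ) ^ n * ((n / 2 : ℕ) : ℝ) * mean ν f := by
  have hd := isDegenerate_f12 hm hf
  have hi1 := (hX.memLp_Upm hd.memLp n).integrable (by norm_num : (1 : ℝ≥0∞) ≤ 2)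
  have hg : ∀ i, MemLp (fun x => coeff1 n i * f1 ν f x + coeff2 i * f2 ν f x) 2 ν := fun i =>
    ((memLp_f1 hf).const_mul _).add ((memLp_f2 hf).const_mul _)
  have hgi : ∀ i, Integrable (fun ω => coeff1 n i * f1 ν f (X i ω) + coeff2 i * f2 ν f (X i ω)) P :=
    fun i => (hX.memLp_comp (hg i) i).integrable (by norm_num)
  have hi2 : Integrable (fun ω => ∑ i ∈ Finset.range n,
      (coeff1 n i * f1 ν f (X i ω) + coeff2 i * f2 ν f (X i ω))) P :=
    integrable_finsetSum _ fun i _ => hgi i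
  have hi12 : Integrable (fun ω => Upm (f12 ν f) (fun i => X i ω) n + ∑ i ∈ Finset.range n,
      (coeff1 n i * f1 ν f (X i ω) + coeff2 i * f2 ν f (X i ω))) P := hi1.add hi2
  simp only [Upm_eq ν f]
  rw [integral_add hi12 (integrable_const _), integral_add hi1 hi2, hX.integral_Upm hd,
    integral_finsetSum _ fun i _ => hgi i, Finset.sum_eq_zero, sum_coeff2]
  · simp
  · intro i _
    have m1 := measurable_f1 (ν := ν) hm
    have m2 := measurable_f2 (ν := ν) hm
    rw [hX.integral_comp (g := fun x => coeff1 n i * f1 ν f x + coeff2 i * f2 ν f x)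
      ((m1.const_mul _).add (m2.const_mul _)) i,
      integral_add (((memLp_f1 hf).integrable (by norm_num)).const_mul _)
        (((memLp_f2 hf).integrable (by norm_num)).const_mul _), integral_const_mul,
      integral_const_mul, integral_f1 hf, integral_f2 hf]
    simp

end Moments


/-! ### Moments and Gaussian limits of the statistic -/

section Rates

theorem tendsto_of_abs_le_inv {u : ℕ → ℝ} (C : ℝ) (h : ∀ n : ℕ, 0 < n → |u n| ≤ C * (n : ℝ)⁻¹) :
    Tendsto u atTop (𝓝 0) := by
  refine squeeze_zero_norm' (a := fun n : ℕ => C * (n : ℝ)⁻¹)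
    (eventually_atTop.2 ⟨1, fun n hn => h n hn⟩) ?_
  simpa using tendsto_inv_atTop_nhds_zero_nat (𝕜 := ℝ).const_mul C

theorem half_le (n : ℕ) : ((n / 2 : ℕ) : ℝ) ≤ n / 2 := by
  simpa using Nat.cast_div_le (α := ℝ) (m := n) (n := 2)

theorem le_half (n : ℕ) : ((n : ℝ) - 1) / 2 ≤ ((n / 2 : ℕ) : ℝ) := by
  have : n ≤ 2 * (n / 2) + 1 := by omega
  have h : (n : ℝ) ≤ 2 * ((n / 2 : ℕ) : ℝ) + 1 := by exact_mod_cast this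
  linarith

theorem tendsto_sum_coeff2_sq :
    Tendsto (fun n : ℕ => (n : ℝ) ^ (-3 : ℤ) * ∑ j ∈ Finset.range n, coeff2 j ^ 2) atTop
      (𝓝 (1 / 3)) := by
  have h := tendsto_inv_atTop_nhds_zero_nat (𝕜 := ℝ)
  have h2 : Tendsto (fun n : ℕ => (1 - (n : ℝ)⁻¹) * (2 - (n : ℝ)⁻¹) / 6) atTop
      (𝓝 ((1 - 0) * (2 - 0) / 6)) := ((h.const_sub 1).mul (h.const_sub 2)).div_const 6
  norm_num at h2
  norm_num
  refine h2.congr' (eventually_atTop.2 ⟨1, fun n hn => ?_⟩)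
  have hn : (n : ℝ) ≠ 0 := by positivity
  dsimp only
  rw [sum_coeff2_sq]
  field_simp

/-- The crude bound `n²` suffices, as the coefficients of `f1` are at most 1. -/
theorem tendsto_sum_coeff1_mul_coeff2 :
    Tendsto (fun n : ℕ => (n : ℝ) ^ (-3 : ℤ) * ∑ i ∈ Finset.range n, coeff1 n i * coeff2 i) atTop
      (𝓝 0) := by
  refine tendsto_of_abs_le_inv 1 fun n hn => ?_
  have hn' : (0 : ℝ) < n := by positivity
  have h : |∑ i ∈ Finset.range n, coeff1 n i * coeff2 i| ≤ n * n := by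
    refine (Finset.abs_sum_le_sum_abs _ _).trans ?_
    refine (Finset.sum_le_card_nsmul _ _ (n : ℝ) fun i hi => ?_).trans (by simp)
    rw [abs_mul, abs_coeff2]
    have h1 := abs_coeff1_le n i
    have h2 : (i : ℝ) ≤ n := by exact_mod_cast (Finset.mem_range.1 hi).le
    calc |coeff1 n i| * i ≤ 1 * i := by gcongr
      _ ≤ n := by linarith
  rw [abs_mul, abs_of_nonneg (by positivity)]
  calc (n : ℝ) ^ (-3 : ℤ) * |∑ i ∈ Finset.range n, coeff1 n i * coeff2 i|
      ≤ (n : ℝ) ^ (-3 : ℤ) * (n * n) := by gcongr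
    _ = 1 * (n : ℝ)⁻¹ := by
      rw [zpow_neg]; norm_cast; push_cast; field_simp

/-- The parts of the variance from `f12` and `f1` are of order at most `n²`, against the
normalization `n³`. -/
theorem tendsto_remainder (K V : ℝ) :
    Tendsto (fun n : ℕ => (n : ℝ) ^ (-3 : ℤ) * (n * (n - 1) / 2 * K + ((n / 2 : ℕ) : ℝ) * V)) atTop
      (𝓝 0) := by
  refine tendsto_of_abs_le_inv (|K| + |V|) fun n hn => ?_
  have hn' : (1 : ℝ) ≤ n := by exact_mod_cast hn
  have h : |(n : ℝ) * (n - 1) / 2 * K + ((n / 2 : ℕ) : ℝ) * V| ≤ n * n * (|K| + |V|) := by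
    refine (abs_add_le _ _).trans ?_
    rw [abs_mul, abs_mul, abs_of_nonneg (by nlinarith : (0 : ℝ) ≤ n * (n - 1) / 2), Nat.abs_cast,
      mul_add]
    have := half_le n
    gcongr
    · nlinarith
    · nlinarith
  rw [abs_mul, abs_of_nonneg (by positivity)]
  calc (n : ℝ) ^ (-3 : ℤ) * |(n : ℝ) * (n - 1) / 2 * K + ((n / 2 : ℕ) : ℝ) * V|
      ≤ (n : ℝ) ^ (-3 : ℤ) * (n * n * (|K| + |V|)) := by gcongr
    _ = (|K| + |V|) * (n : ℝ)⁻¹ := by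
      rw [zpow_neg]; norm_cast; push_cast; field_simp

end Rates

section Statistic

variable {Ω S : Type*} [MeasurableSpace Ω] [MeasurableSpace S] {P : Measure Ω}
  [IsProbabilityMeasure P] {ν : Measure S} [IsProbabilityMeasure ν] {X : ℕ → Ω → S} {f : S → S → ℝ}

/-- A Gaussian limit for statistics close to weighted sums of independent variables. -/
theorem IsIID.tendstoInDistribution_gaussian (hX : IsIID P ν X) {g : S → ℝ} (hg : Measurable g)
    (hg2 : MemLp g 2 ν) (h0 : ∫ x, g x ∂ν = 0) (a : ℕ → ℕ → ℝ) (b : ℕ → ℝ)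
    (hab : ∀ n, ∀ i < n, |a n i| ≤ b n) (hb : Tendsto b atTop (𝓝 0)) {A : ℝ}
    (hA : Tendsto (fun n => ∑ i ∈ Finset.range n, a n i ^ 2) atTop (𝓝 A)) {Z : ℕ → Ω → ℝ}
    (hZ : ∀ n, MemLp (Z n) 2 P)
    (hd : Tendsto (fun n => ∫ ω, (Z n ω - ∑ i ∈ Finset.range n, a n i * g (X i ω)) ^ 2 ∂P) atTop
      (𝓝 0)) :
    TendstoInDistribution Z atTop (id : ℝ → ℝ) (fun _ => P)
      (gaussianReal 0 (A * ∫ x, g x ^ 2 ∂ν).toNNReal) := by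
  have hA0 : 0 ≤ A := ge_of_tendsto' hA fun n => Finset.sum_nonneg fun i _ => sq_nonneg _
  have hv : 0 ≤ ∫ x, g x ^ 2 ∂ν := integral_nonneg fun _ => sq_nonneg _
  refine tendstoInDistribution_of_charFun (fun n => (hZ n).1.aemeasurable) aemeasurable_id fun t => ?_
  have h := tendsto_charFun_of_sub hZ
    (fun n => memLp_finsetSum _ fun i _ => (hX.memLp_comp hg2 i).const_mul (a n i)) hd
    (hX.tendsto_charFun_weighted_sum hg hg2 h0 a b hab hb hA t)
  convert h using 2
  rw [Measure.map_id, charFun_gaussianReal, Real.coe_toNNReal _ (mul_nonneg hA0 hv)]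
  push_cast
  congr 1
  ring

theorem IsIID.sub_integral_Upm (hX : IsIID P ν X) (hm : Measurable fun p : S × S => f p.1 p.2)
    (hf : MemLp (fun p : S × S => f p.1 p.2) 2 (ν.prod ν)) (n : ℕ) (ω : Ω) :
    Upm f (fun i => X i ω) n - ∫ ω, Upm f (fun i => X i ω) n ∂P =
      Upm (f12 ν f) (fun i => X i ω) n +
        ∑ i ∈ Finset.range n, (coeff1 n i * f1 ν f (X i ω) + coeff2 i * f2 ν f (X i ω)) := by
  rw [hX.integral_Upm_eq hm hf, Upm_eq ν f, sum_coeff2]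
  ring

/-- The functions `f1` and `f2` of one variable may be correlated, whence the mixed term. With
arbitrary weights the identity serves both for the variance and for the error left after removing
one of the linear sums. -/
theorem IsIID.integral_sq_f12_add_linear (hX : IsIID P ν X) (hm : Measurable fun p : S × S => f p.1 p.2)
    (hf : MemLp (fun p : S × S => f p.1 p.2) 2 (ν.prod ν)) (n : ℕ) (a b : ℕ → ℝ) :
    ∫ ω, (Upm (f12 ν f) (fun i => X i ω) n +
      ∑ i ∈ Finset.range n, (a i * f1 ν f (X i ω) + b i * f2 ν f (X i ω))) ^ 2 ∂P =
    n * (n - 1) / 2 * varF12 ν f + ((∑ i ∈ Finset.range n, a i ^ 2) * ∫ x, f1 ν f x ^ 2 ∂ν +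
      2 * (∑ i ∈ Finset.range n, a i * b i) * ∫ x, f1 ν f x * f2 ν f x ∂ν +
      (∑ i ∈ Finset.range n, b i ^ 2) * ∫ x, f2 ν f x ^ 2 ∂ν) := by
  have h1 := memLp_f1 hf
  have h2 := memLp_f2 hf
  have hi1 := h1.integrable (by norm_num : (1 : ℝ≥0∞) ≤ 2)
  have hi2 := h2.integrable (by norm_num : (1 : ℝ≥0∞) ≤ 2)
  rw [hX.integral_sq_Upm_add (isDegenerate_f12 hm hf) n
    (fun i x => a i * f1 ν f x + b i * f2 ν f x)
    (fun i => ((measurable_f1 hm).const_mul _).add ((measurable_f2 hm).const_mul _))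
    (fun i => (h1.const_mul _).add (h2.const_mul _)) (fun i => by
      rw [integral_add (hi1.const_mul _) (hi2.const_mul _), integral_const_mul, integral_const_mul,
        integral_f1 hf, integral_f2 hf]
      simp), varF12_eq hm hf]
  congr 1
  rw [Finset.sum_mul, Finset.mul_sum, Finset.sum_mul, Finset.sum_mul, ← Finset.sum_add_distrib,
    ← Finset.sum_add_distrib]
  refine Finset.sum_congr rfl fun i _ => ?_
  have e : ∀ x, (a i * f1 ν f x + b i * f2 ν f x) ^ 2 = a i ^ 2 * f1 ν f x ^ 2 +
      2 * (a i * b i) * (f1 ν f x * f2 ν f x) + b i ^ 2 * f2 ν f x ^ 2 := fun x => by ring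
  have j1 : Integrable (fun x => a i ^ 2 * f1 ν f x ^ 2) ν := h1.integrable_sq.const_mul _
  have j2 : Integrable (fun x => 2 * (a i * b i) * (f1 ν f x * f2 ν f x)) ν :=
    (h1.integrable_mul h2).const_mul _
  have j3 : Integrable (fun x => b i ^ 2 * f2 ν f x ^ 2) ν := h2.integrable_sq.const_mul _
  have j12 : Integrable (fun x => a i ^ 2 * f1 ν f x ^ 2 +
    2 * (a i * b i) * (f1 ν f x * f2 ν f x)) ν := j1.add j2
  simp only [e]
  rw [integral_add j12 j3, integral_add j1 j2, integral_const_mul, integral_const_mul,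
    integral_const_mul]

theorem IsIID.variance_Upm (hX : IsIID P ν X) (hm : Measurable fun p : S × S => f p.1 p.2)
    (hf : MemLp (fun p : S × S => f p.1 p.2) 2 (ν.prod ν)) (n : ℕ) :
    Var[fun ω => Upm f (fun i => X i ω) n; P] =
    n * (n - 1) / 2 * varF12 ν f + (((n / 2 : ℕ) : ℝ) * ∫ x, f1 ν f x ^ 2 ∂ν +
      2 * (∑ i ∈ Finset.range n, coeff1 n i * coeff2 i) * ∫ x, f1 ν f x * f2 ν f x ∂ν +
      (∑ i ∈ Finset.range n, coeff2 i ^ 2) * ∫ x, f2 ν f x ^ 2 ∂ν) := by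
  rw [variance_eq_integral (hX.memLp_Upm hf n).1.aemeasurable]
  simp only [hX.sub_integral_Upm hm hf n]
  rw [hX.integral_sq_f12_add_linear hm hf n (coeff1 n) coeff2, sum_coeff1_sq]

theorem IsIID.memLp_sub_integral (hX : IsIID P ν X)
    (hf : MemLp (fun p : S × S => f p.1 p.2) 2 (ν.prod ν)) (n : ℕ) :
    MemLp (fun ω => Upm f (fun i => X i ω) n - ∫ ω, Upm f (fun i => X i ω) n ∂P) 2 P :=
  (hX.memLp_Upm hf n).sub (memLp_const _)

theorem IsIID.tendsto_variance_Upm (hX : IsIID P ν X) (hm : Measurable fun p : S × S => f p.1 p.2)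
    (hf : MemLp (fun p : S × S => f p.1 p.2) 2 (ν.prod ν)) :
    Tendsto (fun n : ℕ => (n : ℝ) ^ (-3 : ℤ) * Var[fun ω => Upm f (fun i => X i ω) n; P]) atTop
      (𝓝 ((1 / 3) * ∫ x, f2 ν f x ^ 2 ∂ν)) := by
  have h1 := tendsto_remainder (varF12 ν f) (∫ x, f1 ν f x ^ 2 ∂ν)
  have h2 := (tendsto_sum_coeff1_mul_coeff2.mul_const (2 * ∫ x, f1 ν f x * f2 ν f x ∂ν))
  have h3 := tendsto_sum_coeff2_sq.mul_const (∫ x, f2 ν f x ^ 2 ∂ν)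
  have h := (h1.add h2).add h3
  rw [zero_mul, zero_add, zero_add] at h
  refine h.congr fun n => ?_
  rw [hX.variance_Upm hm hf]
  ring

/-- The Gaussian limit in the general case. -/
theorem IsIID.tendstoInDistribution_Upm (hX : IsIID P ν X)
    (hm : Measurable fun p : S × S => f p.1 p.2)
    (hf : MemLp (fun p : S × S => f p.1 p.2) 2 (ν.prod ν)) :
    TendstoInDistribution (fun (n : ℕ) ω => (n : ℝ) ^ (-(3 / 2) : ℝ) *
        (Upm f (fun i => X i ω) n - ∫ ω, Upm f (fun i => X i ω) n ∂P))
      atTop (id : ℝ → ℝ) (fun _ => P)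
      (gaussianReal 0 ((1 / 3) * ∫ x, f2 ν f x ^ 2 ∂ν).toNNReal) := by
  have hs : ∀ n : ℕ, ((n : ℝ) ^ (-(3 / 2) : ℝ)) ^ 2 = (n : ℝ) ^ (-3 : ℤ) := fun n => by
    rw [← Real.rpow_mul_natCast (Nat.cast_nonneg n), ← Real.rpow_intCast]
    norm_num
  refine hX.tendstoInDistribution_gaussian (measurable_f2 hm) (memLp_f2 hf) (integral_f2 hf)
    (fun n i => (n : ℝ) ^ (-(3 / 2) : ℝ) * coeff2 i) (fun n => (n : ℝ) ^ (-(1 / 2) : ℝ)) ?_ ?_ ?_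
    (fun n => (hX.memLp_sub_integral hf n).const_mul _) ?_
  · intro n i hi
    have hn : (0 : ℝ) < n := by exact_mod_cast (Nat.zero_le i).trans_lt hi
    rw [abs_mul, abs_coeff2, abs_of_nonneg (by positivity)]
    calc (n : ℝ) ^ (-(3 / 2) : ℝ) * i ≤ (n : ℝ) ^ (-(3 / 2) : ℝ) * n := by gcongr
      _ = (n : ℝ) ^ (-(1 / 2) : ℝ) := by
        rw [← Real.rpow_add_one hn.ne']
        norm_num
  · exact (tendsto_rpow_neg_atTop (by norm_num : (0 : ℝ) < 1 / 2)).comp tendsto_natCast_atTop_atTop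
  · refine tendsto_sum_coeff2_sq.congr fun n => ?_
    rw [Finset.mul_sum]
    exact Finset.sum_congr rfl fun i _ => by rw [mul_pow, hs]
  · refine (tendsto_remainder (varF12 ν f) (∫ x, f1 ν f x ^ 2 ∂ν)).congr fun n => ?_
    -- Subtracting the weighted sum of `f2` leaves the case of zero weights `b`.
    have e := hX.integral_sq_f12_add_linear hm hf n (coeff1 n) 0
    simp only [Pi.zero_apply, zero_mul, add_zero, mul_zero, Finset.sum_const_zero, sum_coeff1_sq,
      ne_eq, OfNat.ofNat_ne_zero, not_false_eq_true, zero_pow] at e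
    rw [← e, ← hs, ← integral_const_mul]
    refine integral_congr_ae (ae_of_all _ fun ω => ?_)
    simp only [hX.sub_integral_Upm hm hf n ω, Finset.sum_add_distrib, mul_assoc, ← Finset.mul_sum]
    ring

/-- Without the linear term `f₂`, the statistic differs little from that of `f₁₂`. -/
theorem IsIID.tendsto_charFun_of_f12 (hX : IsIID P ν X)
    (hm : Measurable fun p : S × S => f p.1 p.2)
    (hf : MemLp (fun p : S × S => f p.1 p.2) 2 (ν.prod ν)) (h2 : ∀ᵐ y ∂ν, f2 ν f y = 0) {t : ℝ}
    {L : ℂ} (hL : Tendsto (fun n : ℕ => charFun (P.map fun ω => (n : ℝ)⁻¹ *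
      Upm (f12 ν f) (fun i => X i ω) n) t) atTop (𝓝 L)) :
    Tendsto (fun n : ℕ => charFun (P.map fun ω => (n : ℝ)⁻¹ *
      (Upm f (fun i => X i ω) n - ∫ ω, Upm f (fun i => X i ω) n ∂P)) t) atTop (𝓝 L) := by
  refine tendsto_charFun_of_sub (fun n => (hX.memLp_sub_integral hf n).const_mul _)
    (fun n => (hX.memLp_Upm (isDegenerate_f12 hm hf).memLp n).const_mul _) ?_ hL
  have hd := fun n => hX.integral_sq_sum_comp n
    (fun i x => coeff1 n i * f1 ν f x + coeff2 i * f2 ν f x)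
    (fun i => ((measurable_f1 hm).const_mul _).add ((measurable_f2 hm).const_mul _))
    (fun i => ((memLp_f1 hf).const_mul _).add ((memLp_f2 hf).const_mul _)) (fun i => by
      rw [integral_add (((memLp_f1 hf).integrable (by norm_num)).const_mul _)
        (((memLp_f2 hf).integrable (by norm_num)).const_mul _), integral_const_mul,
        integral_const_mul, integral_f1 hf, integral_f2 hf]
      simp)
  have e : ∀ n i, ∫ x, (coeff1 n i * f1 ν f x + coeff2 i * f2 ν f x) ^ 2 ∂ν =
      coeff1 n i ^ 2 * ∫ x, f1 ν f x ^ 2 ∂ν := fun n i => by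
    rw [← integral_const_mul]
    refine integral_congr_ae ?_
    filter_upwards [h2] with x hx
    rw [hx]
    ring
  simp only [e, ← Finset.sum_mul, sum_coeff1_sq] at hd
  refine tendsto_of_abs_le_inv (∫ x, f1 ν f x ^ 2 ∂ν) fun n hn => ?_
  have hn' : (0 : ℝ) < n := by exact_mod_cast hn
  have hv : 0 ≤ ∫ x, f1 ν f x ^ 2 ∂ν := integral_nonneg fun _ => sq_nonneg _
  have e2 : ∫ ω, ((n : ℝ)⁻¹ * (Upm f (fun i => X i ω) n - ∫ ω, Upm f (fun i => X i ω) n ∂P) -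
      (n : ℝ)⁻¹ * Upm (f12 ν f) (fun i => X i ω) n) ^ 2 ∂P =
      (n : ℝ)⁻¹ ^ 2 * (((n / 2 : ℕ) : ℝ) * ∫ x, f1 ν f x ^ 2 ∂ν) := by
    rw [← hd, ← integral_const_mul]
    refine integral_congr_ae (ae_of_all _ fun ω => ?_)
    simp only [hX.sub_integral_Upm hm hf n ω]
    ring
  rw [e2, abs_of_nonneg (by positivity)]
  have := half_le n
  calc (n : ℝ)⁻¹ ^ 2 * (((n / 2 : ℕ) : ℝ) * ∫ x, f1 ν f x ^ 2 ∂ν)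
      ≤ (n : ℝ)⁻¹ ^ 2 * (n * ∫ x, f1 ν f x ^ 2 ∂ν) := by gcongr; exact Nat.div_le_self _ _
    _ = (∫ x, f1 ν f x ^ 2 ∂ν) * (n : ℝ)⁻¹ := by field_simp

theorem IsIID.variance_Upm_of_f2 (hX : IsIID P ν X) (hm : Measurable fun p : S × S => f p.1 p.2)
    (hf : MemLp (fun p : S × S => f p.1 p.2) 2 (ν.prod ν)) (h2 : ∀ᵐ y ∂ν, f2 ν f y = 0) (n : ℕ) :
    Var[fun ω => Upm f (fun i => X i ω) n; P] =
    n * (n - 1) / 2 * varF12 ν f + ((n / 2 : ℕ) : ℝ) * Var[f1 ν f; ν] := by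
  have e1 : ∫ x, f1 ν f x * f2 ν f x ∂ν = 0 :=
    integral_eq_zero_of_ae (by filter_upwards [h2] with x hx; simp [hx])
  have e2 : ∫ x, f2 ν f x ^ 2 ∂ν = 0 :=
    integral_eq_zero_of_ae (by filter_upwards [h2] with x hx; simp [hx])
  rw [hX.variance_Upm hm hf, e1, e2, variance_f1 hf]
  ring

theorem IsIID.variance_Upm_isBigO (hX : IsIID P ν X) (hm : Measurable fun p : S × S => f p.1 p.2)
    (hf : MemLp (fun p : S × S => f p.1 p.2) 2 (ν.prod ν)) (h2 : ∀ᵐ y ∂ν, f2 ν f y = 0) :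
    (fun n : ℕ => Var[fun ω => Upm f (fun i => X i ω) n; P] - (1 / 2) * (n : ℝ) ^ 2 * varF12 ν f)
      =O[atTop] (fun n : ℕ => (n : ℝ)) := by
  have hV : 0 ≤ Var[f1 ν f; ν] := variance_nonneg _ _
  have hK : 0 ≤ varF12 ν f := variance_nonneg _ _
  refine Asymptotics.IsBigO.of_bound (varF12 ν f + Var[f1 ν f; ν]) (Eventually.of_forall fun n => ?_)
  have h1 := half_le n
  have h0 : (0 : ℝ) ≤ n := Nat.cast_nonneg n
  have h3 : (0 : ℝ) ≤ ((n / 2 : ℕ) : ℝ) := Nat.cast_nonneg _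
  have h4 : ((n / 2 : ℕ) : ℝ) * Var[f1 ν f; ν] ≤ n / 2 * Var[f1 ν f; ν] := by gcongr
  have h5 := mul_nonneg h3 hV
  have h6 := mul_nonneg h0 hK
  have h7 := mul_nonneg h0 hV
  rw [hX.variance_Upm_of_f2 hm hf h2, Real.norm_eq_abs, Real.norm_eq_abs, abs_of_nonneg h0, abs_le]
  constructor <;> linarith

/-- If `f₁₂` vanishes too, the variance is linear in `n`. -/
theorem IsIID.variance_Upm_isBigO_one (hX : IsIID P ν X)
    (hm : Measurable fun p : S × S => f p.1 p.2)
    (hf : MemLp (fun p : S × S => f p.1 p.2) 2 (ν.prod ν)) (h2 : ∀ᵐ y ∂ν, f2 ν f y = 0)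
    (h12 : varF12 ν f = 0) :
    (fun n : ℕ => Var[fun ω => Upm f (fun i => X i ω) n; P] - (n : ℝ) * ((1 / 2) * Var[f1 ν f; ν]))
      =O[atTop] (fun _ => (1 : ℝ)) := by
  have hV : 0 ≤ Var[f1 ν f; ν] := variance_nonneg _ _
  refine Asymptotics.IsBigO.of_bound (Var[f1 ν f; ν]) (Eventually.of_forall fun n => ?_)
  have h1 := half_le n
  have h3 := le_half n
  rw [hX.variance_Upm_of_f2 hm hf h2, h12, Real.norm_eq_abs, norm_one, abs_le]
  constructor <;> nlinarith

/-- The Gaussian limit in the completely degenerate case. -/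
theorem IsIID.tendstoInDistribution_Upm_of_f12 (hX : IsIID P ν X)
    (hm : Measurable fun p : S × S => f p.1 p.2)
    (hf : MemLp (fun p : S × S => f p.1 p.2) 2 (ν.prod ν)) (h2 : ∀ᵐ y ∂ν, f2 ν f y = 0)
    (h12 : varF12 ν f = 0) :
    TendstoInDistribution (fun (n : ℕ) ω => (n : ℝ) ^ (-(1 / 2) : ℝ) *
        (Upm f (fun i => X i ω) n - ∫ ω, Upm f (fun i => X i ω) n ∂P))
      atTop (id : ℝ → ℝ) (fun _ => P)
      (gaussianReal 0 ((1 / 2) * Var[f1 ν f; ν]).toNNReal) := by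
  have hs : ∀ n : ℕ, ((n : ℝ) ^ (-(1 / 2) : ℝ)) ^ 2 = (n : ℝ)⁻¹ := fun n => by
    rw [← Real.rpow_mul_natCast (Nat.cast_nonneg n), ← Real.rpow_neg_one]
    norm_num
  rw [variance_f1 hf]
  refine hX.tendstoInDistribution_gaussian (measurable_f1 hm) (memLp_f1 hf) (integral_f1 hf)
    (fun n i => (n : ℝ) ^ (-(1 / 2) : ℝ) * coeff1 n i) (fun n => (n : ℝ) ^ (-(1 / 2) : ℝ)) ?_ ?_ ?_
    (fun n => (hX.memLp_sub_integral hf n).const_mul _) ?_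
  · intro n i _
    rw [abs_mul, abs_of_nonneg (by positivity)]
    exact mul_le_of_le_one_right (by positivity) (abs_coeff1_le n i)
  · exact (tendsto_rpow_neg_atTop (by norm_num : (0 : ℝ) < 1 / 2)).comp tendsto_natCast_atTop_atTop
  · have h : Tendsto (fun n : ℕ => (n : ℝ)⁻¹ * ((n / 2 : ℕ) : ℝ) - 1 / 2) atTop (𝓝 0) := by
      refine tendsto_of_abs_le_inv 1 fun n hn => ?_
      have hn' : (0 : ℝ) < n := by exact_mod_cast hn
      have h1 := half_le n
      have h3 := le_half n
      have e : (n : ℝ)⁻¹ * ((n / 2 : ℕ) : ℝ) - 1 / 2 = (((n / 2 : ℕ) : ℝ) - n / 2) * (n : ℝ)⁻¹ := by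
        field_simp
      rw [e, abs_mul, abs_of_pos (inv_pos.2 hn')]
      gcongr
      rw [abs_le]
      constructor <;> linarith
    have h' := h.add_const (1 / 2)
    rw [zero_add] at h'
    refine h'.congr fun n => ?_
    simp only [mul_pow, hs, ← Finset.mul_sum, sum_coeff1_sq]
    ring
  · have e2 : ∫ x, f2 ν f x ^ 2 ∂ν = 0 :=
      integral_eq_zero_of_ae (by filter_upwards [h2] with x hx; simp [hx])
    refine tendsto_const_nhds.congr fun n => ?_
    -- After subtracting the sum of `f1`, what is left has second moment zero, since both `f2` and
    -- `f12` vanish.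
    have e := hX.integral_sq_f12_add_linear hm hf n 0 coeff2
    simp only [Pi.zero_apply, zero_mul, zero_add, mul_zero, Finset.sum_const_zero, h12, e2,
      ne_eq, OfNat.ofNat_ne_zero, not_false_eq_true, zero_pow] at e
    rw [← mul_zero ((n : ℝ)⁻¹), ← e, ← hs, ← integral_const_mul]
    refine integral_congr_ae (ae_of_all _ fun ω => ?_)
    simp only [hX.sub_integral_Upm hm hf n ω, Finset.sum_add_distrib, mul_assoc, ← Finset.mul_sum]
    ring

end Statistic


/-! ### Limit laws for degenerate kernels -/

/-- The eigenvectors of a compact symmetric operator with square summable eigenvalues, as a finite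
or infinite sequence. -/
theorem exists_orthonormal_eigenvectors_idx {𝕜 H : Type*} [RCLike 𝕜] [NormedAddCommGroup H]
    [InnerProductSpace 𝕜 H] [CompleteSpace H] (T : H →L[𝕜] H)
    (hc : IsCompactOperator T) (hs : T.toLinearMap.IsSymmetric) {c : ℝ}
    (hsum : ∀ (ι : Type) (lam : ι → ℝ) (v : ι → H), Orthonormal 𝕜 v →
      (∀ r, T (v r) = (lam r : 𝕜) • v r) → (∀ r, lam r ≠ 0) →
      (∀ w, (∀ r, inner 𝕜 (v r) w = 0) → T w = 0) → HasSum (fun r => lam r ^ 2) c) :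
    ∃ (R : ℕ∞) (lam : Idx R → ℝ) (v : Idx R → H), Orthonormal 𝕜 v ∧
      (∀ r, T (v r) = (lam r : 𝕜) • v r) ∧ (∀ w, (∀ r, inner 𝕜 (v r) w = 0) → T w = 0) ∧
      ListsEigenvalues T.toLinearMap lam ∧ HasSum (fun r => lam r ^ 2) c := by
  obtain ⟨ι, lam, v, hv, hl, h0, hli⟩ := exists_orthonormal_eigenvectors T hc hs
  have hS := hsum ι lam v hv hl hli.1 h0
  -- A summable family has countable support, and no eigenvalue in the list is zero.
  have : Countable ι := by
    have h := hS.summable.countable_support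
    rw [show Function.support (fun r => lam r ^ 2) = Set.univ by
      ext r; simpa using hli.1 r] at h
    exact Set.countable_univ_iff.1 h
  obtain ⟨R, ⟨e⟩⟩ := exists_equiv_idx ι
  refine ⟨R, lam ∘ e, v ∘ e, hv.comp e e.injective, fun r => hl (e r), fun w hw => h0 w fun r => ?_,
    ⟨fun r => hli.1 (e r), fun c hc0 => ?_⟩, e.hasSum_iff.2 hS⟩
  · simpa using hw (e.symm r)
  · rw [← hli.2 c hc0]
    exact encard_setOf_comp_equiv e fun r => lam r = c

section Degenerate

variable {S : Type*} [MeasurableSpace S] {ν : Measure S} [IsProbabilityMeasure ν]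

theorem hasSum_sq_of_symmetric {g : S → S → ℝ}
    (hg : MemLp (fun p : S × S => g p.1 p.2) 2 (ν.prod ν)) {ι : Type} {lam : ι → ℝ}
    {v : ι → Lp ℝ 2 ν} (hv : Orthonormal ℝ v) (hl : ∀ r, integralOp ν g (v r) = lam r • v r)
    (h0 : ∀ w, (∀ r, inner ℝ (v r) w = 0) → integralOp ν g w = 0) :
    HasSum (fun r => lam r ^ 2) (kernelNormSq ν g) := by
  rw [integralOp_eq_kerOp hg] at hl h0
  have h := hasSum_norm_sq_of_orthonormal (orthonormal_tmul_star hv)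
    (hasSum_kernel hv (hg.toLp _) lam hl h0)
  rw [kernelNormSq_eq_norm_sq hg]
  simpa using h

theorem exists_eigenvectors_of_symmetric {g : S → S → ℝ}
    (hg : MemLp (fun p : S × S => g p.1 p.2) 2 (ν.prod ν))
    (hs : ∀ᵐ p ∂(ν.prod ν), g p.1 p.2 = g p.2 p.1) :
    ∃ (R : ℕ∞) (lam : Idx R → ℝ) (v : Idx R → Lp ℝ 2 ν), Orthonormal ℝ v ∧
      (∀ r, integralOp ν g (v r) = lam r • v r) ∧
      ListsEigenvalues (integralOp ν g).toLinearMap lam ∧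
      HasSum (fun r => lam r ^ 2) (kernelNormSq ν g) := by
  have hsymm : (integralOp ν g).toLinearMap.IsSymmetric := by
    intro u v
    change inner ℝ (integralOp ν g u) v = inner ℝ u (integralOp ν g v)
    rw [← inner_integralOp_left hg, integralOp_congr hg (h := fun x y => (starRingEnd ℝ) (g y x))]
    simpa using hs
  obtain ⟨R, lam, v, hv, hl, -, hli, hsum⟩ := exists_orthonormal_eigenvectors_idx (integralOp ν g)
    (isCompactOperator_integralOp hg) hsymm
    fun ι lam v hv hl _ h0 => hasSum_sq_of_symmetric hg hv hl h0
  exact ⟨R, lam, v, hv, hl, hli, hsum⟩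

variable {Ω : Type*} [MeasurableSpace Ω] {P : Measure Ω} [IsProbabilityMeasure P] {X : ℕ → Ω → S}
  {f : S → S → ℝ}

/-- The limit law in the degenerate case. -/
theorem IsIID.exists_limit_degenerate (hX : IsIID P ν X)
    (hm : Measurable fun p : S × S => f p.1 p.2)
    (hf : MemLp (fun p : S × S => f p.1 p.2) 2 (ν.prod ν)) (h2 : ∀ᵐ y ∂ν, f2 ν f y = 0) :
    ∃ (R : ℕ∞) (lam : Idx R → ℝ),
      ListsNonzeroEigenvalues (altOp ν (f12 ν f)).toLinearMap lam ∧
      HasSum (fun r => lam r ^ 2) (varF12 ν f) ∧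
      ∃ (Ω' : Type) (_ : MeasurableSpace Ω') (P' : Measure Ω') (_ : IsProbabilityMeasure P')
        (ζ : Idx R → Ω' → ℝ) (W : Ω' → ℝ),
        iIndepFun ζ P' ∧ (∀ r, HasLaw (ζ r) (gaussianReal 0 1) P') ∧
        IsL2Sum P' (fun r ω => (1 / 2) * lam r * (ζ r ω ^ 2 - 1)) W ∧
        Var[W; P'] = (1 / 2) * varF12 ν f ∧
        TendstoInDistribution (fun (n : ℕ) ω => (n : ℝ)⁻¹ *
            (Upm f (fun i => X i ω) n - ∫ ω, Upm f (fun i => X i ω) n ∂P))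
          atTop W (fun _ => P) P' := by
  have hd := isDegenerate_f12 hm hf
  rw [varF12_eq hm hf]
  obtain ⟨R, lam, v, hv, hl, -, hli, hsum⟩ := exists_orthonormal_eigenvectors_idx
    (altOp ν (f12 ν f)) (isCompactOperator_altOp hd) (isSymmetric_altOp hd)
    fun ι lam v hv hl h0 hc => hasSum_sq_eigenvalues hd hv hl h0 hc
  obtain ⟨Ω', m, P', hP, ζ, W, h1, h3, h4, h5, h6⟩ := exists_gaussian_l2Sum (Idx R) hsum
  refine ⟨R, lam, hli, hsum, Ω', m, P', hP, ζ, W, h1, h3, h4, h5,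
    tendstoInDistribution_of_charFun
      (fun n => ((hX.memLp_sub_integral hf n).const_mul _).1.aemeasurable) h4.2.1.1.aemeasurable
      fun t => ?_⟩
  obtain ⟨L, hL, hlim⟩ := hX.tendsto_charFun_Upm hd hv hl hli.1 hsum t
  -- The limit and the characteristic function of `W` are values of the same infinite product.
  rw [hL.unique (h6 t)] at hlim
  exact hX.tendsto_charFun_of_f12 hm hf h2 hlim

theorem f1_ae_eq_f2 (hs : ∀ᵐ p ∂(ν.prod ν), f p.1 p.2 = f p.2 p.1) :
    ∀ᵐ x ∂ν, f1 ν f x = f2 ν f x := by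
  filter_upwards [Measure.ae_ae_of_ae_prod hs] with x hx
  rw [f1, f2, integral_congr_ae hx]

theorem f12_ae_eq (h1 : ∀ᵐ x ∂ν, f1 ν f x = 0) (h2 : ∀ᵐ x ∂ν, f2 ν f x = 0) :
    ∀ᵐ p ∂(ν.prod ν), f12 ν f p.1 p.2 = f p.1 p.2 - mean ν f := by
  filter_upwards [Measure.quasiMeasurePreserving_fst.ae h1,
    Measure.quasiMeasurePreserving_snd.ae h2] with p hp1 hp2
  rw [f12, hp1, hp2, sub_zero, sub_zero]

/-- The limit law for a symmetric kernel. -/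
theorem IsIID.exists_limit_symmetric (hX : IsIID P ν X)
    (hm : Measurable fun p : S × S => f p.1 p.2)
    (hf : MemLp (fun p : S × S => f p.1 p.2) 2 (ν.prod ν)) (h2 : ∀ᵐ y ∂ν, f2 ν f y = 0)
    (hs : ∀ᵐ p ∂(ν.prod ν), f p.1 p.2 = f p.2 p.1) :
    ∃ (R : ℕ∞) (lam : Idx R → ℝ),
      ListsNonzeroEigenvalues (integralOp ν (fun x y => f x y - mean ν f)).toLinearMap lam ∧
      HasSum (fun r => lam r ^ 2) (varF12 ν f) ∧
      ∃ (Ω' : Type) (_ : MeasurableSpace Ω') (P' : Measure Ω') (_ : IsProbabilityMeasure P')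
        (ξ : Idx R → Ω' → ℝ) (W : Ω' → ℝ),
        iIndepFun ξ P' ∧ (∀ r, IsHalfStochasticArea P' (ξ r)) ∧
        IsL2Sum P' (fun r ω => lam r * ξ r ω) W ∧
        Var[W; P'] = (1 / 2) * varF12 ν f ∧
        TendstoInDistribution (fun (n : ℕ) ω => (n : ℝ)⁻¹ *
            (Upm f (fun i => X i ω) n - ∫ ω, Upm f (fun i => X i ω) n ∂P))
          atTop W (fun _ => P) P' := by
  have hd := isDegenerate_f12 hm hf
  have h1 : ∀ᵐ x ∂ν, f1 ν f x = 0 := by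
    filter_upwards [f1_ae_eq_f2 hs, h2] with x hx hx2
    rw [hx, hx2]
  have he := f12_ae_eq h1 h2
  have hs' : ∀ᵐ p ∂(ν.prod ν), f12 ν f p.1 p.2 = f12 ν f p.2 p.1 := by
    filter_upwards [he, Measure.measurePreserving_swap.quasiMeasurePreserving.ae he, hs]
      with p hp1 hp2 hp3
    simp only [Prod.fst_swap, Prod.snd_swap] at hp2
    rw [hp1, hp2, hp3]
  rw [varF12_eq hm hf, ← integralOp_congr hd.memLp he]
  obtain ⟨R, lam, v, hv, hl, hli, hsum⟩ := exists_eigenvectors_of_symmetric hd.memLp hs'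
  obtain ⟨Ω', m, P', hP, ξ, W, k1, k3, k4, k5, k6⟩ := exists_halfArea_l2Sum (Idx R) hsum
  refine ⟨R, lam, hli, hsum, Ω', m, P', hP, ξ, W, k1, k3, k4, k5,
    tendstoInDistribution_of_charFun
      (fun n => ((hX.memLp_sub_integral hf n).const_mul _).1.aemeasurable) k4.2.1.1.aemeasurable
      fun t => ?_⟩
  -- For a symmetric kernel an eigenvector serves as both singular vectors; the numbers `s` may be
  -- negative.
  obtain ⟨L, hL, hlim⟩ := hX.tendsto_charFun_Upm_singular hd hv hv hl
    (fun r => by rw [← integralOp_congr hd.memLp hs']; exact hl r) hli.1 hsum t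
  rw [hL.unique (k6 t)] at hlim
  exact hX.tendsto_charFun_of_f12 hm hf h2 hlim

end Degenerate


/-! ### Antisymmetric kernels -/

section RealImaginary

variable {Y : Type*} [MeasurableSpace Y] {κ : Measure Y} [IsProbabilityMeasure κ]

/-- The real part of a complex square integrable function. -/
noncomputable def reL (w : Lp ℂ 2 κ) : Lp ℝ 2 κ := Complex.reCLM.compLp w

/-- The imaginary part of a complex square integrable function. -/
noncomputable def imL (w : Lp ℂ 2 κ) : Lp ℝ 2 κ := Complex.imCLM.compLp w

theorem coeFn_reL (w : Lp ℂ 2 κ) : reL w =ᵐ[κ] fun x => (w x).re :=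
  Complex.reCLM.coeFn_compLp w

theorem coeFn_imL (w : Lp ℂ 2 κ) : imL w =ᵐ[κ] fun x => (w x).im :=
  Complex.imCLM.coeFn_compLp w

theorem ext_reL_imL {u w : Lp ℂ 2 κ} (h1 : reL u = reL w) (h2 : imL u = imL w) : u = w := by
  refine Lp.ext ?_
  have e1 := coeFn_reL u
  have e2 := coeFn_imL u
  rw [h1] at e1
  rw [h2] at e2
  filter_upwards [e1, e2, coeFn_reL w, coeFn_imL w] with x k1 k2 k3 k4
  exact Complex.ext (k1.symm.trans k3) (k2.symm.trans k4)

theorem reL_star (w : Lp ℂ 2 κ) : reL (star w) = reL w := by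
  refine Lp.ext ?_
  filter_upwards [coeFn_reL w, coeFn_reL (star w), Lp.coeFn_star w] with x h1 h2 h3
  rw [h1, h2, h3]
  simp

theorem imL_star (w : Lp ℂ 2 κ) : imL (star w) = -imL w := by
  refine Lp.ext ?_
  filter_upwards [coeFn_imL w, coeFn_imL (star w), Lp.coeFn_star w, Lp.coeFn_neg (imL w)]
    with x h1 h2 h3 h4
  rw [h2, h3, h4, Pi.neg_apply, h1]
  simp

theorem reL_I_smul (c : ℝ) (w : Lp ℂ 2 κ) : reL ((Complex.I * (c : ℂ)) • w) = -(c • imL w) := by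
  refine Lp.ext ?_
  filter_upwards [coeFn_imL w, coeFn_reL ((Complex.I * (c : ℂ)) • w),
    Lp.coeFn_smul (Complex.I * (c : ℂ)) w, Lp.coeFn_neg (c • imL w), Lp.coeFn_smul c (imL w)]
    with x h1 h2 h3 h4 h5
  rw [h2, h3, h4, Pi.neg_apply, h5, Pi.smul_apply, Pi.smul_apply, h1]
  simp

theorem imL_I_smul (c : ℝ) (w : Lp ℂ 2 κ) : imL ((Complex.I * (c : ℂ)) • w) = c • reL w := by
  refine Lp.ext ?_
  filter_upwards [coeFn_reL w, coeFn_imL ((Complex.I * (c : ℂ)) • w),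
    Lp.coeFn_smul (Complex.I * (c : ℂ)) w, Lp.coeFn_smul c (reL w)] with x h1 h2 h3 h5
  rw [h2, h3, h5, Pi.smul_apply, Pi.smul_apply, h1]
  simp

theorem integrable_mul_Lp (u v : Lp ℝ 2 κ) : Integrable (fun x => u x * v x) κ :=
  (Lp.memLp u).integrable_mul (Lp.memLp v)

theorem integrable_inner_Lp (u w : Lp ℂ 2 κ) :
    Integrable (fun x => w x * (starRingEnd ℂ) (u x)) κ :=
  (Lp.memLp w).integrable_mul (Lp.memLp u).star

theorem re_inner_eq (u w : Lp ℂ 2 κ) :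
    (inner ℂ u w).re = inner ℝ (reL u) (reL w) + inner ℝ (imL u) (imL w) := by
  rw [L2.inner_def, L2.inner_def, L2.inner_def]
  simp only [RCLike.inner_apply, conj_trivial]
  rw [← integral_add (integrable_mul_Lp _ _) (integrable_mul_Lp _ _), ← Complex.reCLM_apply,
    ← Complex.reCLM.integral_comp_comm (integrable_inner_Lp u w)]
  refine integral_congr_ae ?_
  filter_upwards [coeFn_reL u, coeFn_imL u, coeFn_reL w, coeFn_imL w] with x h1 h2 h3 h4
  rw [h1, h2, h3, h4]
  simp

theorem im_inner_eq (u w : Lp ℂ 2 κ) :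
    (inner ℂ u w).im = inner ℝ (reL u) (imL w) - inner ℝ (imL u) (reL w) := by
  rw [L2.inner_def, L2.inner_def, L2.inner_def]
  simp only [RCLike.inner_apply, conj_trivial]
  rw [← integral_sub (integrable_mul_Lp _ _) (integrable_mul_Lp _ _), ← Complex.imCLM_apply,
    ← Complex.imCLM.integral_comp_comm (integrable_inner_Lp u w)]
  refine integral_congr_ae ?_
  filter_upwards [coeFn_reL u, coeFn_imL u, coeFn_reL w, coeFn_imL w] with x h1 h2 h3 h4
  rw [h1, h2, h3, h4]
  simp
  ring

variable {g : Y → Y → ℝ}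

theorem memLp_ofReal_kernel (hg : MemLp (fun p : Y × Y => g p.1 p.2) 2 (κ.prod κ)) :
    MemLp (fun p : Y × Y => (g p.1 p.2 : ℂ)) 2 (κ.prod κ) := hg.ofReal

theorem reL_integralOp (hg : MemLp (fun p : Y × Y => g p.1 p.2) 2 (κ.prod κ)) (w : Lp ℂ 2 κ) :
    reL (integralOp κ (fun x y => (g x y : ℂ)) w) = integralOp κ g (reL w) := by
  have hg' := memLp_ofReal_kernel hg
  refine Lp.ext ?_
  filter_upwards [coeFn_reL (integralOp κ (fun x y => (g x y : ℂ)) w),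
    integralOp_apply κ (g := fun x y => (g x y : ℂ)) hg' w, integralOp_apply κ hg (reL w),
    ae_integrable_mul κ (g := fun x y => (g x y : ℂ)) hg' (Lp.memLp w)] with x h1 h2 h3 h4
  rw [h1, h2, h3, ← Complex.reCLM_apply, ← Complex.reCLM.integral_comp_comm h4]
  refine integral_congr_ae ?_
  filter_upwards [coeFn_reL w] with y hy
  rw [hy]
  simp

theorem imL_integralOp (hg : MemLp (fun p : Y × Y => g p.1 p.2) 2 (κ.prod κ)) (w : Lp ℂ 2 κ) :
    imL (integralOp κ (fun x y => (g x y : ℂ)) w) = integralOp κ g (imL w) := by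
  have hg' := memLp_ofReal_kernel hg
  refine Lp.ext ?_
  filter_upwards [coeFn_imL (integralOp κ (fun x y => (g x y : ℂ)) w),
    integralOp_apply κ (g := fun x y => (g x y : ℂ)) hg' w, integralOp_apply κ hg (imL w),
    ae_integrable_mul κ (g := fun x y => (g x y : ℂ)) hg' (Lp.memLp w)] with x h1 h2 h3 h4
  rw [h1, h2, h3, ← Complex.imCLM_apply, ← Complex.imCLM.integral_comp_comm h4]
  refine integral_congr_ae ?_
  filter_upwards [coeFn_imL w] with y hy
  rw [hy]
  simp

theorem integralOp_star (hg : MemLp (fun p : Y × Y => g p.1 p.2) 2 (κ.prod κ)) (w : Lp ℂ 2 κ) :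
    integralOp κ (fun x y => (g x y : ℂ)) (star w) =
      star (integralOp κ (fun x y => (g x y : ℂ)) w) := by
  refine ext_reL_imL ?_ ?_
  · rw [reL_integralOp hg, reL_star, reL_star, reL_integralOp hg]
  · rw [imL_integralOp hg, imL_star, imL_star, imL_integralOp hg, map_neg]

theorem norm_toLp_ofReal_kernel (hg : MemLp (fun p : Y × Y => g p.1 p.2) 2 (κ.prod κ)) :
    ‖(memLp_ofReal_kernel hg).toLp _‖ ^ 2 = kernelNormSq κ g := by
  rw [kernelNormSq_eq_norm_sq hg, Lp.norm_toLp, Lp.norm_toLp]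
  congr 2
  exact eLpNorm_congr_norm_ae (ae_of_all _ fun p => by simp)

theorem adjoint_integralOp_antisymmetric
    (hg : MemLp (fun p : Y × Y => g p.1 p.2) 2 (κ.prod κ))
    (hs : ∀ᵐ p ∂(κ.prod κ), g p.1 p.2 = -g p.2 p.1) :
    ContinuousLinearMap.adjoint (integralOp κ (fun x y => (g x y : ℂ))) =
      -integralOp κ (fun x y => (g x y : ℂ)) := by
  have hg' := memLp_ofReal_kernel hg
  rw [adjoint_integralOp hg', ← integralOp_neg hg']
  symm
  refine integralOp_congr hg'.neg ?_
  filter_upwards [hs] with p hp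
  simp [hp]

end RealImaginary

/-! ### Spectral theory of real antisymmetric kernels -/

section Antisymmetric

variable {Y : Type*} [MeasurableSpace Y] {κ : Measure Y} [IsProbabilityMeasure κ] {g : Y → Y → ℝ}

/-- The self-adjoint operator `-i T` for an antisymmetric kernel. -/
noncomputable def rotOp (κ : Measure Y) [IsProbabilityMeasure κ] (g : Y → Y → ℝ) :
    Lp ℂ 2 κ →L[ℂ] Lp ℂ 2 κ := (-Complex.I) • integralOp κ (fun x y => (g x y : ℂ))

theorem rotOp_eq_smul_iff (c : ℂ) (w : Lp ℂ 2 κ) :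
    rotOp κ g w = c • w ↔ integralOp κ (fun x y => (g x y : ℂ)) w = (Complex.I * c) • w := by
  rw [rotOp, smul_apply]
  constructor
  · intro h
    rw [mul_smul, ← h, smul_smul]
    simp
  · intro h
    rw [h, smul_smul, ← mul_assoc]
    simp

theorem eigenspace_rotOp (c : ℂ) : Module.End.eigenspace (rotOp κ g).toLinearMap c =
    Module.End.eigenspace (integralOp κ (fun x y => (g x y : ℂ))).toLinearMap (Complex.I * c) := by
  ext w
  rw [Module.End.mem_eigenspace_iff, Module.End.mem_eigenspace_iff]
  exact rotOp_eq_smul_iff c w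

theorem isSymmetric_rotOp (hg : MemLp (fun p : Y × Y => g p.1 p.2) 2 (κ.prod κ))
    (hs : ∀ᵐ p ∂(κ.prod κ), g p.1 p.2 = -g p.2 p.1) : (rotOp κ g).toLinearMap.IsSymmetric := by
  intro u v
  change inner ℂ (rotOp κ g u) v = inner ℂ u (rotOp κ g v)
  rw [rotOp, smul_apply, smul_apply, inner_smul_left, inner_smul_right,
    ← ContinuousLinearMap.adjoint_inner_right, adjoint_integralOp_antisymmetric hg hs, neg_apply,
    inner_neg_right]
  simp

theorem rotOp_eq_kerOp (hg : MemLp (fun p : Y × Y => g p.1 p.2) 2 (κ.prod κ)) :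
    rotOp κ g = kerOp κ ((-Complex.I) • (memLp_ofReal_kernel hg).toLp _) := by
  rw [map_smul, ← integralOp_eq_kerOp (g := fun x y => (g x y : ℂ)) (memLp_ofReal_kernel hg), rotOp]

theorem isCompactOperator_rotOp (hg : MemLp (fun p : Y × Y => g p.1 p.2) 2 (κ.prod κ)) :
    IsCompactOperator (rotOp κ g) :=
  (isCompactOperator_integralOp (g := fun x y => (g x y : ℂ)) (memLp_ofReal_kernel hg)).smul
    (-Complex.I)

/-- The kernel of `T` is real, so conjugation commutes with `T` and changes the sign of `-i`: the
spectrum of `rotOp` is symmetric. -/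
theorem rotOp_star (hg : MemLp (fun p : Y × Y => g p.1 p.2) 2 (κ.prod κ)) {c : ℝ} {w : Lp ℂ 2 κ}
    (h : rotOp κ g w = (c : ℂ) • w) : rotOp κ g (star w) = ((-c : ℝ) : ℂ) • star w := by
  rw [rotOp_eq_smul_iff] at h ⊢
  rw [integralOp_star hg, h]
  refine Lp.ext ?_
  filter_upwards [Lp.coeFn_star ((Complex.I * (c : ℂ)) • w), Lp.coeFn_smul (Complex.I * (c : ℂ)) w,
    Lp.coeFn_star w, Lp.coeFn_smul (Complex.I * ((-c : ℝ) : ℂ)) (star w)] with x h1 h2 h3 h4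
  rw [h1, Pi.star_apply, h2, h4, Pi.smul_apply, Pi.smul_apply, h3, Pi.star_apply]
  simp

/-- The eigenvector expansion of the kernel of `rotOp`. -/
theorem hasSum_rotOp_kernel (hg : MemLp (fun p : Y × Y => g p.1 p.2) 2 (κ.prod κ)) {ι : Type}
    {lam : ι → ℝ} {v : ι → Lp ℂ 2 κ} (hv : Orthonormal ℂ v)
    (hl : ∀ r, rotOp κ g (v r) = (lam r : ℂ) • v r)
    (h0 : ∀ w, (∀ r, inner ℂ (v r) w = 0) → rotOp κ g w = 0) :
    HasSum (fun r => (lam r : ℂ) • tmul (v r) (star (v r)))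
      ((-Complex.I) • (memLp_ofReal_kernel hg).toLp _) := by
  rw [rotOp_eq_kerOp hg] at hl h0
  exact hasSum_kernel hv _ (fun r => (lam r : ℂ)) hl h0

theorem hasSum_sq_rotOp (hg : MemLp (fun p : Y × Y => g p.1 p.2) 2 (κ.prod κ)) {ι : Type}
    {lam : ι → ℝ} {v : ι → Lp ℂ 2 κ} (hv : Orthonormal ℂ v)
    (hl : ∀ r, rotOp κ g (v r) = (lam r : ℂ) • v r)
    (h0 : ∀ w, (∀ r, inner ℂ (v r) w = 0) → rotOp κ g w = 0) :
    HasSum (fun r => lam r ^ 2) (kernelNormSq κ g) := by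
  have h := hasSum_norm_sq_of_orthonormal (orthonormal_tmul_star hv) (hasSum_rotOp_kernel hg hv hl h0)
  rw [norm_smul, norm_neg, Complex.norm_I, one_mul, norm_toLp_ofReal_kernel hg] at h
  simpa using h

theorem inner_eq_zero_of_rotOp (hg : MemLp (fun p : Y × Y => g p.1 p.2) 2 (κ.prod κ))
    (hs : ∀ᵐ p ∂(κ.prod κ), g p.1 p.2 = -g p.2 p.1) {a b : ℝ} (hab : a ≠ b) {u w : Lp ℂ 2 κ}
    (hu : rotOp κ g u = (a : ℂ) • u) (hw : rotOp κ g w = (b : ℂ) • w) : inner ℂ u w = 0 := by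
  have h : inner ℂ (rotOp κ g u) w = inner ℂ u (rotOp κ g w) := isSymmetric_rotOp hg hs u w
  rw [hu, hw, inner_smul_left, inner_smul_right, Complex.conj_ofReal, ← sub_eq_zero, ← sub_mul] at h
  exact (mul_eq_zero.1 h).resolve_left (sub_ne_zero.2 (by exact_mod_cast hab))

/-- The eigenvectors with positive eigenvalues and their conjugates. -/
noncomputable def conjPair {ι : Type} {lam : ι → ℝ} (v : ι → Lp ℂ 2 κ)
    (p : {r // 0 < lam r} × Bool) : Lp ℂ 2 κ := if p.2 then v p.1 else star (v p.1)

theorem star_inner_star (u w : Lp ℂ 2 κ) : inner ℂ (star u) w = inner ℂ (star w) u := by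
  rw [← inner_star_star, star_star]

theorem orthonormal_conjPair (hg : MemLp (fun p : Y × Y => g p.1 p.2) 2 (κ.prod κ))
    (hs : ∀ᵐ p ∂(κ.prod κ), g p.1 p.2 = -g p.2 p.1) {ι : Type} {lam : ι → ℝ} {v : ι → Lp ℂ 2 κ}
    (hv : Orthonormal ℂ v) (hl : ∀ r, rotOp κ g (v r) = (lam r : ℂ) • v r) :
    Orthonormal ℂ (conjPair (lam := lam) v) := by
  classical
  have hz : ∀ r s : {r // 0 < lam r}, inner ℂ (v r) (star (v s)) = 0 := fun r s =>
    inner_eq_zero_of_rotOp hg hs (by linarith [r.2, s.2] : lam r ≠ -lam s) (hl r)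
      (rotOp_star hg (hl s))
  rw [orthonormal_iff_ite] at hv ⊢
  rintro ⟨r, a⟩ ⟨s, b⟩
  cases a <;> cases b
  · simp only [conjPair, Bool.false_eq_true, if_false, inner_star_star, hv, Prod.mk.injEq, and_true,
      Subtype.ext_iff, eq_comm]
  · simp only [conjPair, Bool.false_eq_true, if_false, if_true]
    rw [← inner_conj_symm, hz]
    simp
  · simp only [conjPair, Bool.false_eq_true, if_false, if_true, hz]
    simp
  · simp only [conjPair, if_true, hv, Prod.mk.injEq, and_true, Subtype.ext_iff]

theorem rotOp_conjPair (hg : MemLp (fun p : Y × Y => g p.1 p.2) 2 (κ.prod κ)) {ι : Type}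
    {lam : ι → ℝ} {v : ι → Lp ℂ 2 κ} (hl : ∀ r, rotOp κ g (v r) = (lam r : ℂ) • v r)
    (p : {r // 0 < lam r} × Bool) : rotOp κ g (conjPair v p) =
      ((if p.2 then lam p.1 else -lam p.1 : ℝ) : ℂ) • conjPair v p := by
  rcases p with ⟨r, a⟩
  cases a
  · simpa [conjPair] using rotOp_star hg (hl r)
  · simpa [conjPair] using hl r

/-- It must be seen that `x` is orthogonal to `v s` when `lam s < 0`. The vector `star (v s)` has
the positive eigenvalue `-lam s`. In the eigenvector expansion of `⟨star x, rotOp (star (v s))⟩`,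
the terms with negative eigenvalue vanish by orthogonality to `star (v s)`, those with positive
eigenvalue by hypothesis. -/
theorem rotOp_eq_zero_of_conjPair (hg : MemLp (fun p : Y × Y => g p.1 p.2) 2 (κ.prod κ))
    (hs : ∀ᵐ p ∂(κ.prod κ), g p.1 p.2 = -g p.2 p.1) {ι : Type} {lam : ι → ℝ} {v : ι → Lp ℂ 2 κ}
    (hv : Orthonormal ℂ v) (hl : ∀ r, rotOp κ g (v r) = (lam r : ℂ) • v r) (hne : ∀ r, lam r ≠ 0)
    (h0 : ∀ w, (∀ r, inner ℂ (v r) w = 0) → rotOp κ g w = 0) (x : Lp ℂ 2 κ)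
    (hx : ∀ p, inner ℂ (conjPair (lam := lam) v p) x = 0) : rotOp κ g x = 0 := by
  refine h0 x fun s => ?_
  rcases lt_or_gt_of_ne (hne s) with hneg | hpos
  · have hy := rotOp_star hg (hl s)
    have hG := rotOp_eq_kerOp hg
    have hk := hasSum_rotOp_kernel hg hv hl h0
    generalize (-Complex.I) • (memLp_ofReal_kernel hg).toLp _ = G at hG hk
    replace hk := hk.mapL (innerSL ℂ (tmul (star x) (star (star (v s)))))
    simp only [innerSL_apply_apply, inner_smul_right, inner_tmul, ← inner_kerOp, ← hG, hy] at hk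
    have hz : ∀ r, (lam r : ℂ) * (inner ℂ (star x) (v r) *
        inner ℂ (star (star (v s))) (star (v r))) = 0 := by
      intro r
      rcases lt_or_gt_of_ne (hne r) with h | h
      · rw [inner_star_star, inner_eq_zero_of_rotOp hg hs (by linarith : lam r ≠ -lam s) (hl r) hy]
        simp
      · have := hx (⟨r, h⟩, false)
        simp only [conjPair, Bool.false_eq_true, if_false] at this
        rw [star_inner_star, this]
        simp
    simp only [hz] at hk
    have h1 := hk.unique hasSum_zero
    have h2 : inner ℂ (star x) (star (v s)) = 0 :=
      (mul_eq_zero.1 h1).resolve_left (by exact_mod_cast neg_ne_zero.2 (hne s))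
    rwa [inner_star_star] at h2
  · simpa [conjPair] using hx (⟨s, hpos⟩, true)

/-- The rescaled real and imaginary parts of the eigenvectors with positive eigenvalues. -/
noncomputable def realPair {ι : Type} {lam : ι → ℝ} (v : ι → Lp ℂ 2 κ)
    (p : {r // 0 < lam r} × Bool) : Lp ℝ 2 κ :=
  √2 • if p.2 then reL (v p.1) else imL (v p.1)

/-- Besides the orthonormality of `v`, the vectors `v r` and `star (v s)` are orthogonal because
their eigenvalues have opposite signs. Adding and subtracting the real and imaginary parts of the
two relations separates the four inner products. -/
theorem inner_reL_imL (hg : MemLp (fun p : Y × Y => g p.1 p.2) 2 (κ.prod κ))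
    (hs : ∀ᵐ p ∂(κ.prod κ), g p.1 p.2 = -g p.2 p.1) {ι : Type} {lam : ι → ℝ} {v : ι → Lp ℂ 2 κ}
    (hv : Orthonormal ℂ v) (hl : ∀ r, rotOp κ g (v r) = (lam r : ℂ) • v r)
    {r s : ι} (hr : 0 < lam r) (hs' : 0 < lam s) [Decidable (r = s)] :
    2 * inner ℝ (reL (v r)) (reL (v s)) = (if r = s then (1 : ℝ) else 0) ∧
    2 * inner ℝ (imL (v r)) (imL (v s)) = (if r = s then (1 : ℝ) else 0) ∧
    inner ℝ (reL (v r)) (imL (v s)) = 0 := by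
  classical
  have h1 := orthonormal_iff_ite.1 hv r s
  have h2 : inner ℂ (v r) (star (v s)) = 0 :=
    inner_eq_zero_of_rotOp hg hs (by linarith : lam r ≠ -lam s) (hl r) (rotOp_star hg (hl s))
  have a1 := re_inner_eq (v r) (v s)
  have a2 := im_inner_eq (v r) (v s)
  have b1 := re_inner_eq (v r) (star (v s))
  have b2 := im_inner_eq (v r) (star (v s))
  rw [h1] at a1 a2
  rw [h2, reL_star, imL_star, inner_neg_right, Complex.zero_re] at b1
  rw [h2, reL_star, imL_star, inner_neg_right, Complex.zero_im] at b2
  by_cases h : r = s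
  · simp only [h, if_true, Complex.one_re, Complex.one_im] at a1 a2 b1 b2 ⊢
    refine ⟨?_, ?_, ?_⟩ <;> linarith
  · simp only [h, if_false, Complex.zero_re, Complex.zero_im] at a1 a2 b1 b2 ⊢
    refine ⟨?_, ?_, ?_⟩ <;> linarith

theorem orthonormal_realPair (hg : MemLp (fun p : Y × Y => g p.1 p.2) 2 (κ.prod κ))
    (hs : ∀ᵐ p ∂(κ.prod κ), g p.1 p.2 = -g p.2 p.1) {ι : Type} {lam : ι → ℝ} {v : ι → Lp ℂ 2 κ}
    (hv : Orthonormal ℂ v) (hl : ∀ r, rotOp κ g (v r) = (lam r : ℂ) • v r) :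
    Orthonormal ℝ (realPair (lam := lam) v) := by
  classical
  rw [orthonormal_iff_ite]
  rintro ⟨r, a⟩ ⟨s, b⟩
  obtain ⟨h1, h2, h3⟩ := inner_reL_imL hg hs hv hl r.2 s.2
  obtain ⟨-, -, h4⟩ := inner_reL_imL hg hs hv hl s.2 r.2
  have e : ∀ u w : Lp ℝ 2 κ, inner ℝ (√2 • u) (√2 • w) = 2 * inner ℝ u w := fun u w => by
    rw [real_inner_smul_left, real_inner_smul_right, ← mul_assoc, Real.mul_self_sqrt (by norm_num)]
  cases a <;> cases b
  · simp only [realPair, Bool.false_eq_true, if_false, e, h2, Prod.mk.injEq, and_true,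
      Subtype.ext_iff]
  · simp only [realPair, Bool.false_eq_true, if_false, if_true, e]
    rw [real_inner_comm, h4]
    simp
  · simp only [realPair, Bool.false_eq_true, if_false, if_true, e, h3]
    simp
  · simp only [realPair, if_true, e, h1, Prod.mk.injEq, and_true, Subtype.ext_iff]

/-- The real and imaginary parts of `T v = i λ v`. -/
theorem integralOp_realPair (hg : MemLp (fun p : Y × Y => g p.1 p.2) 2 (κ.prod κ)) {ι : Type}
    {lam : ι → ℝ} {v : ι → Lp ℂ 2 κ} (hl : ∀ r, rotOp κ g (v r) = (lam r : ℂ) • v r)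
    (r : {r // 0 < lam r}) :
    integralOp κ g (realPair v (r, true)) = -(lam r • realPair v (r, false)) ∧
    integralOp κ g (realPair v (r, false)) = lam r • realPair v (r, true) := by
  have h := (rotOp_eq_smul_iff _ _).1 (hl r)
  have h1 := reL_integralOp hg (v r)
  have h2 := imL_integralOp hg (v r)
  rw [h, reL_I_smul] at h1
  rw [h, imL_I_smul] at h2
  simp only [realPair, Bool.false_eq_true, if_false, if_true, map_smul, ← h1, ← h2, smul_neg]
  exact ⟨by rw [smul_comm], by rw [smul_comm]⟩

end Antisymmetric


/-! ### The limit law for antisymmetric kernels -/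

section AntisymmetricLimit

variable {S : Type*} [MeasurableSpace S] {ν : Measure S} [IsProbabilityMeasure ν]
  {Ω : Type*} [MeasurableSpace Ω] {P : Measure Ω} [IsProbabilityMeasure P] {X : ℕ → Ω → S}
  {f : S → S → ℝ}

/-- The conjugates of the eigenvectors with positive eigenvalue replace those with negative
eigenvalue in a complete system, so the positive ones account for the whole norm when counted twice.
-/
theorem hasSum_sq_pos_rotOp {g : S → S → ℝ} (hg : MemLp (fun p : S × S => g p.1 p.2) 2 (ν.prod ν))
    (hs : ∀ᵐ p ∂(ν.prod ν), g p.1 p.2 = -g p.2 p.1) {ι : Type} {lam : ι → ℝ} {v : ι → Lp ℂ 2 ν}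
    (hv : Orthonormal ℂ v) (hl : ∀ r, rotOp ν g (v r) = (lam r : ℂ) • v r) (hne : ∀ r, lam r ≠ 0)
    (h0 : ∀ w, (∀ r, inner ℂ (v r) w = 0) → rotOp ν g w = 0) :
    HasSum (fun p : {r // 0 < lam r} × Bool => lam p.1 ^ 2) (kernelNormSq ν g) := by
  have h := hasSum_sq_rotOp hg (orthonormal_conjPair hg hs hv hl) (rotOp_conjPair hg hl)
    (rotOp_eq_zero_of_conjPair hg hs hv hl hne h0)
  have e : ∀ p : {r // 0 < lam r} × Bool, (if p.2 then lam p.1 else -lam p.1) ^ 2 = lam p.1 ^ 2 :=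
    fun p => by split_ifs <;> ring
  simpa only [e] using h

/-- The limit law of a degenerate antisymmetric kernel. -/
theorem IsIID.tendsto_charFun_antisymmetric {g : S → S → ℝ} (hX : IsIID P ν X)
    (hd : IsDegenerate ν g) (hs : ∀ᵐ p ∂(ν.prod ν), g p.1 p.2 = -g p.2 p.1) :
    ∃ (Q : ℕ∞) (lam : Idx Q → ℝ),
      ListsPositiveImaginaryEigenvalues
        (integralOp ν (fun x y => (g x y : ℂ))).toLinearMap lam ∧
      HasSum (fun q => lam q ^ 2) ((1 / 2) * kernelNormSq ν g) ∧
      ∀ t : ℝ, ∃ L, HasProd (fun q => ((1 / √(Real.cosh (lam q * t)) : ℝ) : ℂ) ^ 2) L ∧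
        Tendsto (fun n : ℕ => charFun (P.map fun ω => (n : ℝ)⁻¹ * Upm g (fun i => X i ω) n) t)
          atTop (𝓝 L) := by
  have hg := hd.memLp
  obtain ⟨R, lam, v, hv, hl, h0, hli, hsum⟩ := exists_orthonormal_eigenvectors_idx (rotOp ν g)
    (isCompactOperator_rotOp hg) (isSymmetric_rotOp hg hs)
    fun ι lam v hv hl _ h0 => hasSum_sq_rotOp hg hv hl h0
  obtain ⟨Q, ⟨e⟩⟩ := exists_equiv_idx {r // 0 < lam r}
  have hpair := hasSum_sq_pos_rotOp hg hs hv hl hli.1 h0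
  refine ⟨Q, fun q => lam (e q), ⟨fun q => (e q).2, fun c hc => ?_⟩, ?_, fun t => ?_⟩
  · rw [← eigenspace_rotOp]
    have h1 := hli.2 c hc.ne'
    refine Eq.trans ?_ h1
    rw [encard_setOf_comp_equiv e fun r => lam r = c,
      ← Subtype.val_injective.encard_image {r : {r // 0 < lam r} | lam r = c}]
    congr 1
    ext r
    simp only [Set.mem_image, Set.mem_ofPred_eq, Subtype.exists, exists_and_right, exists_eq_right]
    exact ⟨fun h => h.2, fun h => ⟨h ▸ hc, h⟩⟩
  · have h1 : ∀ r : {r // 0 < lam r}, HasSum (fun _ : Bool => lam r ^ 2) (2 * lam r ^ 2) :=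
      fun r => by simpa [two_mul] using hasSum_fintype fun _ : Bool => lam r ^ 2
    have h2 : HasSum (fun r : {r // 0 < lam r} => 2 * lam r ^ 2) (kernelNormSq ν g) :=
      HasSum.prod_fiberwise hpair h1
    have h3 := (e.hasSum_iff.2 h2).mul_left (1 / 2)
    simpa [Function.comp_def] using h3
  · have hne : ∀ p : {r // 0 < lam r} × Bool, lam p.1 ≠ 0 := fun p => p.1.2.ne'
    have ho := orthonormal_realPair hg hs hv hl
    -- The right singular vectors are the real and imaginary parts exchanged, the left ones those
    -- parts with a sign on the imaginary part; the signs make the singular numbers positive.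
    have hsw : Orthonormal ℝ fun p : {r // 0 < lam r} × Bool =>
        realPair (lam := lam) v (p.1, !p.2) := by
      classical
      rw [orthonormal_iff_ite] at ho ⊢
      rintro ⟨r, a⟩ ⟨s, b⟩
      rw [ho]
      cases a <;> cases b <;> simp
    have hsg : Orthonormal ℝ fun p : {r // 0 < lam r} × Bool =>
        (if p.2 then (1 : ℝ) else -1) • realPair (lam := lam) v p := by
      classical
      rw [orthonormal_iff_ite] at ho ⊢
      rintro ⟨r, a⟩ ⟨s, b⟩
      rw [real_inner_smul_left, real_inner_smul_right, ho]
      cases a <;> cases b <;> simp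
    have hflip : integralOp ν (fun x y => g y x) = -integralOp ν g := by
      rw [← integralOp_neg hg]
      refine (integralOp_congr hg.neg ?_).symm
      filter_upwards [hs] with p hp
      simp [hp]
    have hA : ∀ p : {r // 0 < lam r} × Bool, integralOp ν g (realPair (lam := lam) v (p.1, !p.2)) =
        lam p.1 • (if p.2 then (1 : ℝ) else -1) • realPair (lam := lam) v p := by
      rintro ⟨r, a⟩
      obtain ⟨h1, h2⟩ := integralOp_realPair hg hl r
      cases a
      · simpa using h1
      · simpa using h2
    have hB : ∀ p : {r // 0 < lam r} × Bool, integralOp ν (fun x y => g y x)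
        ((if p.2 then (1 : ℝ) else -1) • realPair (lam := lam) v p) =
        lam p.1 • realPair (lam := lam) v (p.1, !p.2) := by
      rintro ⟨r, a⟩
      obtain ⟨h1, h2⟩ := integralOp_realPair hg hl r
      rw [hflip, neg_apply, map_smul]
      cases a
      · simpa using h2
      · simp [h1]
    obtain ⟨L, hL, hlim⟩ := hX.tendsto_charFun_Upm_singular hd hsg hsw hA hB hne hpair t
    refine ⟨L, ?_, hlim⟩
    -- Each positive number occurs twice as a singular number, so its factor is squared.
    have h1 : ∀ r : {r // 0 < lam r}, HasProd
        (fun _ : Bool => ((1 / √(Real.cosh (lam r * t)) : ℝ) : ℂ))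
        (((1 / √(Real.cosh (lam r * t)) : ℝ) : ℂ) ^ 2) := fun r => by
      have := hasProd_fintype fun _ : Bool => ((1 / √(Real.cosh (lam r * t)) : ℝ) : ℂ)
      rwa [Finset.prod_const, Finset.card_univ, Fintype.card_bool] at this
    have h2 : HasProd (fun r : {r // 0 < lam r} => ((1 / √(Real.cosh (lam r * t)) : ℝ) : ℂ) ^ 2)
        L := HasProd.prod_fiberwise hL h1
    exact e.hasProd_iff.2 h2

/-- The limit law for an antisymmetric kernel. -/
theorem IsIID.exists_limit_antisymmetric (hX : IsIID P ν X)
    (hm : Measurable fun p : S × S => f p.1 p.2)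
    (hf : MemLp (fun p : S × S => f p.1 p.2) 2 (ν.prod ν)) (h2 : ∀ᵐ y ∂ν, f2 ν f y = 0)
    (hs : ∀ᵐ p ∂(ν.prod ν), f p.1 p.2 = -f p.2 p.1) :
    ∃ (Q : ℕ∞) (lam : Idx Q → ℝ),
      ListsPositiveImaginaryEigenvalues
        (integralOp ν (fun x y => (f x y : ℂ))).toLinearMap lam ∧
      HasSum (fun q => lam q ^ 2) ((1 / 2) * varF12 ν f) ∧
      ∃ (Ω' : Type) (_ : MeasurableSpace Ω') (P' : Measure Ω') (_ : IsProbabilityMeasure P')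
        (η : Idx Q → Ω' → ℝ) (W : Ω' → ℝ),
        iIndepFun η P' ∧ (∀ q, IsStochasticArea P' (η q)) ∧
        IsL2Sum P' (fun q ω => lam q * η q ω) W ∧
        Var[W; P'] = (1 / 2) * varF12 ν f ∧
        TendstoInDistribution (fun (n : ℕ) ω => (n : ℝ)⁻¹ * Upm f (fun i => X i ω) n)
          atTop W (fun _ => P) P' := by
  have hd := isDegenerate_f12 hm hf
  -- Exchanging the two variables changes the sign of the mean. For the same reason `f1 = -f2`, so
  -- `f1` vanishes as well and `f12 = f` almost everywhere.
  have hmean : mean ν f = 0 := by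
    have h : mean ν f = -mean ν f := by
      conv_lhs => rw [mean, integral_congr_ae hs, integral_neg]
      rw [mean, ← integral_prod_swap]
      rfl
    linarith
  have h1 : ∀ᵐ x ∂ν, f1 ν f x = 0 := by
    filter_upwards [Measure.ae_ae_of_ae_prod hs, h2] with x hx hx2
    rw [f2, hmean, sub_zero] at hx2
    rw [f1, hmean, sub_zero, integral_congr_ae hx, integral_neg, hx2, neg_zero]
  have he := f12_ae_eq h1 h2
  simp only [hmean, sub_zero] at he
  have hs' : ∀ᵐ p ∂(ν.prod ν), f12 ν f p.1 p.2 = -f12 ν f p.2 p.1 := by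
    filter_upwards [he, Measure.measurePreserving_swap.quasiMeasurePreserving.ae he, hs]
      with p hp1 hp2 hp3
    simp only [Prod.fst_swap, Prod.snd_swap] at hp2
    rw [hp1, hp2, hp3]
  have hop : integralOp ν (fun x y => (f12 ν f x y : ℂ)) = integralOp ν (fun x y => (f x y : ℂ)) :=
    integralOp_congr (memLp_ofReal_kernel hd.memLp) (by filter_upwards [he] with p hp; rw [hp])
  have hU : ∀ n, ∫ ω, Upm f (fun i => X i ω) n ∂P = 0 := fun n => by
    rw [hX.integral_Upm_eq hm hf, hmean, mul_zero]
  rw [varF12_eq hm hf, ← hop]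
  obtain ⟨Q, lam, hli, hsum, hL⟩ := hX.tendsto_charFun_antisymmetric hd hs'
  obtain ⟨Ω', m, P', hP, η, W, k1, k3, k4, k5, k6⟩ := exists_area_l2Sum (Idx Q) hsum
  refine ⟨Q, lam, hli, hsum, Ω', m, P', hP, η, W, k1, k3, k4, k5,
    tendstoInDistribution_of_charFun
      (fun n => ((hX.memLp_Upm hf n).const_mul _).1.aemeasurable) k4.2.1.1.aemeasurable
      fun t => ?_⟩
  obtain ⟨L, hL, hlim⟩ := hL t
  rw [hL.unique (k6 t)] at hlim
  simpa only [hU, sub_zero] using hX.tendsto_charFun_of_f12 hm hf h2 hlim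

end AntisymmetricLimit

end AltU

/-! ### Main theorem -/

theorem theorem6p1 {Ω S : Type*} [MeasurableSpace Ω] [MeasurableSpace S]
    (P : Measure Ω) [IsProbabilityMeasure P] (ν : Measure S) [IsProbabilityMeasure ν]
    (X : ℕ → Ω → S) (hX : ∀ i, Measurable (X i)) (hlaw : ∀ i, P.map (X i) = ν)
    (hind : iIndepFun X P)
    (f : S → S → ℝ) (hf : Measurable (fun p : S × S => f p.1 p.2))
    (hf2 : MemLp (fun p : S × S => f p.1 p.2) 2 (ν.prod ν))
    (U : ℕ → Ω → ℝ) (hU : ∀ n ω, U n ω = AltU.Upm f (fun i => X i ω) n) :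
    -- (i) the mean (all variables being square integrable)
    (∀ n, MemLp (U n) 2 P ∧ P[U n] = (-1 : ℝ) ^ n * ((n / 2 : ℕ) : ℝ) * AltU.mean ν f) ∧
    -- (ii) the general case
    (Tendsto (fun n : ℕ => (n : ℝ) ^ (-3 : ℤ) * Var[U n; P]) atTop
        (𝓝 ((1 / 3) * ∫ x, AltU.f2 ν f x ^ 2 ∂ν)) ∧
      TendstoInDistribution (fun (n : ℕ) ω => (n : ℝ) ^ (-(3 / 2) : ℝ) * (U n ω - P[U n]))
        atTop (id : ℝ → ℝ) (fun _ => P)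
        (gaussianReal 0 ((1 / 3) * ∫ x, AltU.f2 ν f x ^ 2 ∂ν).toNNReal)) ∧
    -- (iii) the degenerate case
    ((∀ᵐ y ∂ν, AltU.f2 ν f y = 0) →
      (fun n : ℕ => Var[U n; P] - (1 / 2) * (n : ℝ) ^ 2 * AltU.varF12 ν f)
        =O[atTop] (fun n : ℕ => (n : ℝ)) ∧
      IsSelfAdjoint (AltU.altOp ν (AltU.f12 ν f)) ∧
      ∃ (R : ℕ∞) (lam : AltU.Idx R → ℝ),
        AltU.ListsNonzeroEigenvalues (AltU.altOp ν (AltU.f12 ν f)).toLinearMap lam ∧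
        HasSum (fun r => lam r ^ 2) (AltU.varF12 ν f) ∧
        ∃ (Ω' : Type) (_ : MeasurableSpace Ω') (P' : Measure Ω') (_ : IsProbabilityMeasure P')
          (ζ : AltU.Idx R → Ω' → ℝ) (W : Ω' → ℝ),
          iIndepFun ζ P' ∧ (∀ r, HasLaw (ζ r) (gaussianReal 0 1) P') ∧
          AltU.IsL2Sum P' (fun r ω => (1 / 2) * lam r * (ζ r ω ^ 2 - 1)) W ∧
          Var[W; P'] = (1 / 2) * AltU.varF12 ν f ∧
          TendstoInDistribution (fun (n : ℕ) ω => (n : ℝ)⁻¹ * (U n ω - P[U n]))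
            atTop W (fun _ => P) P') ∧
    -- (iv) the degenerate case with a symmetric kernel
    ((∀ᵐ y ∂ν, AltU.f2 ν f y = 0) → (∀ᵐ p ∂(ν.prod ν), f p.1 p.2 = f p.2 p.1) →
      ∃ (R : ℕ∞) (lam : AltU.Idx R → ℝ),
        AltU.ListsNonzeroEigenvalues
          (AltU.integralOp ν (fun x y => f x y - AltU.mean ν f)).toLinearMap lam ∧
        HasSum (fun r => lam r ^ 2) (AltU.varF12 ν f) ∧
        ∃ (Ω' : Type) (_ : MeasurableSpace Ω') (P' : Measure Ω') (_ : IsProbabilityMeasure P')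
          (ξ : AltU.Idx R → Ω' → ℝ) (W : Ω' → ℝ),
          iIndepFun ξ P' ∧ (∀ r, AltU.IsHalfStochasticArea P' (ξ r)) ∧
          AltU.IsL2Sum P' (fun r ω => lam r * ξ r ω) W ∧
          Var[W; P'] = (1 / 2) * AltU.varF12 ν f ∧
          TendstoInDistribution (fun (n : ℕ) ω => (n : ℝ)⁻¹ * (U n ω - P[U n]))
            atTop W (fun _ => P) P') ∧
    -- (v) the degenerate case with an antisymmetric kernel
    ((∀ᵐ y ∂ν, AltU.f2 ν f y = 0) → (∀ᵐ p ∂(ν.prod ν), f p.1 p.2 = -f p.2 p.1) →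
      ContinuousLinearMap.adjoint (AltU.integralOp ν (fun x y => (f x y : ℂ))) =
        -AltU.integralOp ν (fun x y => (f x y : ℂ)) ∧
      ∃ (Q : ℕ∞) (lam : AltU.Idx Q → ℝ),
        AltU.ListsPositiveImaginaryEigenvalues
          (AltU.integralOp ν (fun x y => (f x y : ℂ))).toLinearMap lam ∧
        HasSum (fun q => lam q ^ 2) ((1 / 2) * AltU.varF12 ν f) ∧
        ∃ (Ω' : Type) (_ : MeasurableSpace Ω') (P' : Measure Ω') (_ : IsProbabilityMeasure P')
          (η : AltU.Idx Q → Ω' → ℝ) (W : Ω' → ℝ),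
          iIndepFun η P' ∧ (∀ q, AltU.IsStochasticArea P' (η q)) ∧
          AltU.IsL2Sum P' (fun q ω => lam q * η q ω) W ∧
          Var[W; P'] = (1 / 2) * AltU.varF12 ν f ∧
          TendstoInDistribution (fun (n : ℕ) ω => (n : ℝ)⁻¹ * U n ω) atTop W (fun _ => P) P') ∧
    -- (vi) the completely degenerate case
    ((∀ᵐ y ∂ν, AltU.f2 ν f y = 0) → (∀ᵐ p ∂(ν.prod ν), AltU.f12 ν f p.1 p.2 = 0) →
      (fun n : ℕ => Var[U n; P] - (n : ℝ) * ((1 / 2) * Var[AltU.f1 ν f; ν]))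
        =O[atTop] (fun _ => (1 : ℝ)) ∧
      TendstoInDistribution (fun (n : ℕ) ω => (n : ℝ) ^ (-(1 / 2) : ℝ) * (U n ω - P[U n]))
        atTop (id : ℝ → ℝ) (fun _ => P)
        (gaussianReal 0 ((1 / 2) * Var[AltU.f1 ν f; ν]).toNNReal)) := by
  have hiid : AltU.IsIID P ν X := ⟨hX, hlaw, hind⟩
  obtain rfl : U = fun n ω => AltU.Upm f (fun i => X i ω) n := funext fun n => funext fun ω => hU n ω
  refine ⟨fun n => ⟨hiid.memLp_Upm hf2 n, hiid.integral_Upm_eq hf hf2 n⟩,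
    ⟨hiid.tendsto_variance_Upm hf hf2, hiid.tendstoInDistribution_Upm hf hf2⟩,
    fun h2 => ⟨hiid.variance_Upm_isBigO hf hf2 h2,
      AltU.isSelfAdjoint_altOp (AltU.isDegenerate_f12 hf hf2), hiid.exists_limit_degenerate hf hf2 h2⟩,
    fun h2 hs => hiid.exists_limit_symmetric hf hf2 h2 hs,
    fun h2 hs => ⟨AltU.adjoint_integralOp_antisymmetric hf2 hs,
      hiid.exists_limit_antisymmetric hf hf2 h2 hs⟩, fun h2 h12 => ?_⟩
  have hv : AltU.varF12 ν f = 0 := by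
    rw [AltU.varF12_eq hf hf2]
    exact MeasureTheory.integral_eq_zero_of_ae (by filter_upwards [h12] with p hp; simp [hp])
  exact ⟨hiid.variance_Upm_isBigO_one hf hf2 h2 hv,
    hiid.tendstoInDistribution_Upm_of_f12 hf hf2 h2 hv⟩
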